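/- Let $X$ be a smooth complex algebraic variety (a smooth separated scheme of finite type over $\mathbb{C}$) with the Zariski topology, let $\mathbb{C}^\hbar=\mathbb{C}[[\hbar]]$, and let $\mathcal{A}_X$ be a DQ-algebroid on $X$: a $\mathbb{C}^\hbar$-linear stack on $X$ which is locally non-empty, in which any two objects over the same open set are locally isomorphic, and such that for every open $U$ and every $\sigma\in\mathcal{A}_X(U)$ the sheaf of $\mathbb{C}^\hbar$-algebras $\mathcal{E}nd(\sigma)$ is locally isomorphic to a star algebra $(\mathcal{O}_X[[\hbar]],\star)$. (That is, $\star$ is an associative $\mathbb{C}^\hbar$-bilinear product with $f\star g=\sum_{i\ge 0}P_i(f,g)\hbar^i$ for $f,g\in\mathcal{O}_X$, where the $P_i$ are $\mathbb{C}$-bilinear bidifferential operators, $P_0(f,g)=fg$, and $P_i(f,1)=P_i(1,f)=0$ for $i>0$.) An $\mathcal{A}_X$-module is a $\mathbb{C}^\hbar$-linear functor of stacks from $\mathcal{A}_X$ to sheaves of $\mathbb{C}^\hbar$-modules; $\mathsf{D}(\mathcal{A}_X)$ is the unbounded derived category of the abelian category of $\mathcal{A}_X$-modules. Let $\mathcal{A}_X^{loc}=\mathbb{C}((\hbar))\otimes_{\mathbb{C}^\hbar}\mathcal{A}_X$.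 An object $\mathcal{M}\in\mathsf{D}(\mathcal{A}_X)$ is cohomologically complete if $\mathrm{R}\mathcal{H}om_{\mathcal{A}_X}(\mathcal{A}_X^{loc},\mathcal{M})\simeq 0$. Let $\mathrm{gr}_\hbar:\mathsf{D}(\mathcal{A}_X)\to\mathsf{D}(\mathcal{A}_X/\hbar\mathcal{A}_X)$ be the left derived functor of $\mathcal{M}\mapsto\mathcal{M}/\hbar\mathcal{M}$, where $(\mathcal{A}_X/\hbar\mathcal{A}_X)$-modules are the $\mathcal{A}_X$-modules annihilated by $\hbar$; given an additive equivalence $e:\mathrm{Mod}(\mathcal{A}_X/\hbar\mathcal{A}_X)\simeq\mathrm{Mod}(\mathcal{O}_X)$, it may also be viewed as the left derived functor $\mathsf{D}(\mathcal{A}_X)\to\mathsf{D}(\mathcal{O}_X)$ of $\mathcal{M}\mapsto e(\mathcal{M}/\hbar\mathcal{M})$. Then these left derived functors exist, and the following holds. Let $\mathcal{M}\in\mathsf{D}(\mathcal{A}_X)$ be cohomologically complete. If $\mathrm{gr}_\hbar\mathcal{M}$ is bounded, i.e. belongs to $\mathsf{D}^b(\mathcal{A}_X/\hbar\mathcal{A}_X)$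 (respectively, for some equivalence $e$ as above, to $\mathsf{D}^b(\mathcal{O}_X)$), then $\mathcal{M}$ is bounded: $\mathcal{M}\in\mathsf{D}^b(\mathcal{A}_X)$, so that $\mathcal{M}$ is a bounded cohomologically complete object. -/

import Mathlib

open CategoryTheory AlgebraicGeometry Opposite Limits Bicategory

universe w

noncomputable section

namespace DQ

/-- The ring `ℂ[[ħ]]` of formal power series. -/
abbrev Ch : Type := PowerSeries ℂ

/-- The formal parameter `ħ`. -/
abbrev hbar : Ch := PowerSeries.X

/-- A `ℂ[[ħ]]`-linear structure on a prestack (a pseudofunctor `Cᵒᵖ → Cat`): every fibre category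
is `ℂ[[ħ]]`-linear and every restriction functor is `ℂ[[ħ]]`-linear. -/
class LinearPrestack {C : Type} [SmallCategory C]
    (A : LocallyDiscrete Cᵒᵖ ⥤ᵖ Cat.{0, 0}) where
  preadditive (S : Cᵒᵖ) : Preadditive (A.obj ⟨S⟩)
  linear (S : Cᵒᵖ) : Linear Ch (A.obj ⟨S⟩)
  map_add {S T : Cᵒᵖ} (f : S ⟶ T) {x y : A.obj ⟨S⟩} (φ ψ : x ⟶ y) :
    (A.map f.toLoc).toFunctor.map (φ + ψ) =
      (A.map f.toLoc).toFunctor.map φ + (A.map f.toLoc).toFunctor.map ψ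
  map_smul {S T : Cᵒᵖ} (f : S ⟶ T) {x y : A.obj ⟨S⟩} (c : Ch) (φ : x ⟶ y) :
    (A.map f.toLoc).toFunctor.map (c • φ) = c • (A.map f.toLoc).toFunctor.map φ

attribute [reducible, instance] LinearPrestack.preadditive LinearPrestack.linear

section Total

variable {C : Type} [SmallCategory C] (A : LocallyDiscrete Cᵒᵖ ⥤ᵖ Cat.{0, 0})

/-- The total category of a prestack: objects are pairs `(U, σ)` with `σ ∈ A(U)`, and a morphism
`(U, σ) ⟶ (V, τ)` is a morphism `V ⟶ U` of the base together with a morphism `σ|_V ⟶ τ`. -/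
abbrev Tot : Type := Pseudofunctor.Grothendieck A

variable {A}

/-- The morphism of the total category given by a base morphism and a morphism in the fibre. -/
abbrev homMk {a b : Tot A} (f : a.base ⟶ b.base)
    (φ : (A.map f.toLoc).toFunctor.obj a.fiber ⟶ b.fiber) : a ⟶ b :=
  ⟨f, φ⟩

/-- The restriction of `a = (U, σ)` along `V ⟶ U`. -/
abbrev res (a : Tot A) {S : Cᵒᵖ} (f : a.base ⟶ S) : Tot A :=
  ⟨S, (A.map f.toLoc).toFunctor.obj a.fiber⟩

/-- The restriction morphism `(U, σ) ⟶ (V, σ|_V)`. -/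
def toRes (a : Tot A) {S : Cᵒᵖ} (f : a.base ⟶ S) : a ⟶ res a f :=
  homMk (b := res a f) f (𝟙 _)

lemma homMk_ext {a b : Tot A} {f g : a.base ⟶ b.base} (h : f = g)
    (φ : (A.map f.toLoc).toFunctor.obj a.fiber ⟶ b.fiber)
    (ψ : (A.map g.toLoc).toFunctor.obj a.fiber ⟶ b.fiber)
    (hφ : eqToHom (by rw [h]) ≫ φ = ψ) : homMk f φ = homMk g ψ := by
  subst h; subst hφ; simp

lemma homMk_comp {a b c : Tot A} (f : a.base ⟶ b.base) (g : b.base ⟶ c.base)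
    (φ : (A.map f.toLoc).toFunctor.obj a.fiber ⟶ b.fiber)
    (ψ : (A.map g.toLoc).toFunctor.obj b.fiber ⟶ c.fiber) :
    homMk f φ ≫ homMk g ψ = homMk (f ≫ g) ((A.mapComp f.toLoc g.toLoc).hom.toNatTrans.app a.fiber ≫
      (A.map g.toLoc).toFunctor.map φ ≫ ψ) := rfl

lemma comp_aux₁ {D : Type} [SmallCategory D] {x₀ x₁ x₂ x₃ y : D} (e : x₀ ⟶ x₁) (m : x₁ ⟶ x₂)
    (k : x₂ ⟶ x₃) (i : x₃ ⟶ x₀) (φ : x₀ ⟶ y) (h : e ≫ m ≫ k ≫ i = 𝟙 x₀) :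
    e ≫ m ≫ k ≫ i ≫ φ = φ := by
  simpa using congrArg (· ≫ φ) h

lemma comp_aux₃ {D : Type} [SmallCategory D] {x y z : D} (e : x ⟶ y) (k : y ⟶ z) :
    e ≫ k ≫ 𝟙 z = e ≫ k := by
  rw [Category.comp_id]

lemma comp_aux₂ {D : Type} [SmallCategory D] {x y : D} (e : x ⟶ y) (k : y ⟶ y)
    (i : y ⟶ x) (hk : k = 𝟙 y) (h : e ≫ i = 𝟙 x) : e ≫ k ≫ i = 𝟙 x := by
  rw [hk, Category.id_comp, h]

/-- The vertical morphism of the total category out of a restriction of `a`, given by a morphism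
in the fibre. -/
def vert {a b : Tot A} {f : a.base ⟶ b.base}
    (φ : (A.map f.toLoc).toFunctor.obj a.fiber ⟶ b.fiber) : res a f ⟶ b :=
  homMk (a := res a f) (𝟙 b.base) ((A.mapId ⟨b.base⟩).hom.toNatTrans.app _ ≫ φ)

lemma toRes_vert {a b : Tot A} {f : a.base ⟶ b.base}
    (φ : (A.map f.toLoc).toFunctor.obj a.fiber ⟶ b.fiber) :
    toRes a f ≫ vert φ = homMk f φ := by
  have key : toRes a f ≫ homMk (a := res a f) (b := res a f) (𝟙 b.base)
      ((A.mapId ⟨b.base⟩).hom.toNatTrans.app _) = toRes a f := Category.comp_id (toRes a f)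
  refine Pseudofunctor.Grothendieck.Hom.ext _ _ (Category.comp_id f) ?_
  change _ ≫ (A.mapComp f.toLoc (𝟙 b.base).toLoc).hom.toNatTrans.app a.fiber ≫
      (A.map (𝟙 b.base).toLoc).toFunctor.map (𝟙 _) ≫
      (A.mapId ⟨b.base⟩).hom.toNatTrans.app _ ≫ φ = φ
  obtain ⟨h4, h5⟩ := (Pseudofunctor.Grothendieck.Hom.ext_iff _ _).1 key
  change _ ≫ (A.mapComp f.toLoc (𝟙 b.base).toLoc).hom.toNatTrans.app a.fiber ≫
      (A.map (𝟙 b.base).toLoc).toFunctor.map (𝟙 _) ≫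
      (A.mapId ⟨b.base⟩).hom.toNatTrans.app _ = 𝟙 _ at h5
  exact comp_aux₁ _ _ _ _ φ h5

lemma fac (a : Tot A) {b : Tot A} (h : a ⟶ b) : toRes a h.base ≫ vert h.fiber = h :=
  toRes_vert _

lemma homMk_toRes {a b : Tot A} (f : a.base ⟶ b.base)
    (φ : (A.map f.toLoc).toFunctor.obj a.fiber ⟶ b.fiber) {S : Cᵒᵖ} (g : b.base ⟶ S) :
    homMk f φ ≫ toRes b g = toRes a (f ≫ g) ≫ vert (b := res b g)
      ((A.mapComp f.toLoc g.toLoc).hom.toNatTrans.app a.fiber ≫ (A.map g.toLoc).toFunctor.map φ) := by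
  rw [toRes_vert (b := res b g)]
  exact congrArg (homMk (b := res b g) (f ≫ g)) (comp_aux₃ _ _)

lemma toRes_toRes (a : Tot A) {S T : Cᵒᵖ} (f : a.base ⟶ S) (g : S ⟶ T) :
    toRes a f ≫ homMk (a := res a f) (b := res a (f ≫ g)) g
      ((A.mapComp f.toLoc g.toLoc).inv.toNatTrans.app a.fiber) = toRes a (f ≫ g) := by
  refine congrArg (homMk (b := res a (f ≫ g)) (f ≫ g)) ?_
  refine comp_aux₂ _ _ _ (CategoryTheory.Functor.map_id _ _) ?_
  exact congrArg (fun k => k.toNatTrans.app a.fiber) (A.mapComp f.toLoc g.toLoc).hom_inv_id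

/-- The restriction of a fibre morphism `σ|_V ⟶ τ` to a smaller object of the base. -/
def resFiber {a b : Tot A} (f : a.base ⟶ b.base) {S : Cᵒᵖ} (g : b.base ⟶ S)
    (φ : (A.map f.toLoc).toFunctor.obj a.fiber ⟶ b.fiber) :
    (A.map (𝟙 S : S ⟶ S).toLoc).toFunctor.obj (res a (f ≫ g)).fiber ⟶ (res b g).fiber :=
  (A.mapId ⟨S⟩).hom.toNatTrans.app _ ≫
    (A.mapComp f.toLoc g.toLoc).hom.toNatTrans.app a.fiber ≫ (A.map g.toLoc).toFunctor.map φ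

lemma homMk_resFiber {a b : Tot A} (f : a.base ⟶ b.base) {S : Cᵒᵖ} (g : b.base ⟶ S)
    (φ : (A.map f.toLoc).toFunctor.obj a.fiber ⟶ b.fiber) :
    homMk f φ ≫ toRes b g = toRes a (f ≫ g) ≫ homMk (𝟙 S) (resFiber f g φ) :=
  homMk_toRes f φ g

/-- The sieve of the base formed by the restrictions which belong to a sieve of the total
category. -/
def baseSieve {a : Tot A} (S : Sieve (op a)) : Sieve a.base.unop where
  arrows _ f := S (toRes a f.op).op
  downward_closed {V W f} hf g := by
    have h := S.downward_closed hf (homMk (a := res a f.op) (b := res a (g ≫ f).op) g.op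
        ((A.mapComp f.op.toLoc g.op.toLoc).inv.toNatTrans.app a.fiber)).op
    rw [← op_comp] at h
    exact (congrArg (fun k => S k.op) (toRes_toRes a f.op g.op)).mp h

lemma mem_of_baseSieve {a b : Tot A} {S : Sieve (op a)} (h : a ⟶ b)
    (hS : baseSieve S h.base.unop) : S h.op := by
  have := S.downward_closed hS (vert h.fiber).op
  rw [← op_comp] at this
  exact (congrArg (fun k => S k.op) (fac a h)).mp this

/-- The topology on the (opposite of the) total category which is induced by a topology of the
base: a sieve on `(U, σ)` is covering if the restrictions `(V, σ|_V)` that belong to it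
cover `U`. -/
def totTopology (K : GrothendieckTopology C) (A : LocallyDiscrete Cᵒᵖ ⥤ᵖ Cat.{0, 0}) :
    GrothendieckTopology (Tot A)ᵒᵖ where
  sieves a := {S | baseSieve (a := a.unop) S ∈ K _}
  top_mem' a := K.superset_covering (fun _ _ _ => trivial) (K.top_mem _)
  pullback_stable' a b S g hS := by
    refine K.superset_covering ?_ (K.pullback_stable g.unop.base.unop hS)
    intro W w hw
    change S ((toRes b.unop w.op).op ≫ g)
    have e : (toRes b.unop w.op).op ≫ g = (g.unop ≫ toRes b.unop w.op).op := rfl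
    rw [e]
    exact mem_of_baseSieve (g.unop ≫ toRes b.unop w.op) hw
  transitive' a S hS T hT := by
    refine K.transitive hS _ ?_
    intro V f hf
    have h := hT hf
    refine K.superset_covering ?_ h
    intro W w hw
    have h' := T.downward_closed (mem_of_baseSieve (homMk (a := res a.unop f.op)
      (b := res a.unop (w ≫ f).op) w.op
        ((A.mapComp f.op.toLoc w.op.toLoc).inv.toNatTrans.app a.unop.fiber)) hw) (𝟙 _)
    rw [Category.id_comp] at h'
    change T (_ ≫ _) at h'
    rw [← op_comp] at h'
    exact (congrArg (fun k => T k.op) (toRes_toRes a.unop f.op w.op)).mp h'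

lemma mem_totTopology {K : GrothendieckTopology C} {a : Tot A} (S : Sieve (op a)) :
    S ∈ totTopology K A (op a) ↔ baseSieve S ∈ K _ := Iff.rfl

end Total

section Modules

variable {C : Type} [SmallCategory C] (A : LocallyDiscrete Cᵒᵖ ⥤ᵖ Cat.{0, 0}) [LinearPrestack A]

/-- A presheaf of `ℂ[[ħ]]`-modules on the total category, `(U, σ) ↦ M(U, σ)`, is linear if its
action on the morphisms `σ|_V ⟶ τ` is `ℂ[[ħ]]`-linear. -/
structure IsLinear (M : (Tot A)ᵒᵖᵒᵖ ⥤ ModuleCat.{0} Ch) : Prop where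
  map_add {a b : Tot A} (f : a.base ⟶ b.base)
    (φ ψ : (A.map f.toLoc).toFunctor.obj a.fiber ⟶ b.fiber) (x : M.obj (op (op a))) :
    M.map (homMk f (φ + ψ)).op.op x = M.map (homMk f φ).op.op x + M.map (homMk f ψ).op.op x
  map_smul {a b : Tot A} (f : a.base ⟶ b.base) (c : Ch)
    (φ : (A.map f.toLoc).toFunctor.obj a.fiber ⟶ b.fiber) (x : M.obj (op (op a))) :
    M.map (homMk f (c • φ)).op.op x = c • M.map (homMk f φ).op.op x

variable {A}

lemma comp_add_aux {D : Type} [SmallCategory D] [Preadditive D] {w x y z : D} (e : w ⟶ x)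
    (m : x ⟶ y) (φ ψ : y ⟶ z) : e ≫ m ≫ (φ + ψ) = e ≫ m ≫ φ + e ≫ m ≫ ψ := by simp

lemma comp_smul_aux {D : Type} [SmallCategory D] [Preadditive D] [Linear Ch D] {w x y z : D}
    (e : w ⟶ x) (m : x ⟶ y) (c : Ch) (φ : y ⟶ z) : e ≫ m ≫ (c • φ) = c • (e ≫ m ≫ φ) := by simp

lemma IsLinear.of_injective {M N : (Tot A)ᵒᵖᵒᵖ ⥤ ModuleCat.{0} Ch} (i : M ⟶ N)
    (hi : ∀ a, Function.Injective (i.app a)) (hN : IsLinear A N) : IsLinear A M where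
  map_add {a b} f φ ψ x := by
    apply hi
    simp only [_root_.map_add, NatTrans.naturality_apply, hN.map_add]
  map_smul {a b} f c φ x := by
    apply hi
    simp only [_root_.map_smul, NatTrans.naturality_apply, hN.map_smul]

lemma resFiber_add {a b : Tot A} (f : a.base ⟶ b.base) {S : Cᵒᵖ} (g : b.base ⟶ S)
    (φ ψ : (A.map f.toLoc).toFunctor.obj a.fiber ⟶ b.fiber) :
    resFiber f g (φ + ψ) = resFiber f g φ + resFiber f g ψ := by
  simp only [resFiber, LinearPrestack.map_add]
  exact comp_add_aux _ _ _ _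

lemma resFiber_smul {a b : Tot A} (f : a.base ⟶ b.base) {S : Cᵒᵖ} (g : b.base ⟶ S) (c : Ch)
    (φ : (A.map f.toLoc).toFunctor.obj a.fiber ⟶ b.fiber) :
    resFiber f g (c • φ) = c • resFiber f g φ := by
  simp only [resFiber, LinearPrestack.map_smul]
  exact comp_smul_aux _ _ _ _

lemma IsLinear.of_locallySurjective (K : GrothendieckTopology C)
    {M N : (Tot A)ᵒᵖᵒᵖ ⥤ ModuleCat.{0} Ch} (p : M ⟶ N)
    [Presheaf.IsLocallySurjective (totTopology K A) p]
    (hM : IsLinear A M) (hN : Presheaf.IsSheaf (totTopology K A) N) : IsLinear A N := by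
  have key : ∀ {a b : Tot A} (f : a.base ⟶ b.base) (y : N.obj (op (op a)))
      (u v : N.obj (op (op b))),
      (∀ (S : Cᵒᵖ) (g : b.base ⟶ S) (x : M.obj (op (op (res a (f ≫ g))))),
        p.app _ x = N.map (toRes a (f ≫ g)).op.op y →
        N.map (toRes b g).op.op u = N.map (toRes b g).op.op v) → u = v := by
    intro a b f y u v h
    let T : Sieve (op b) :=
      { arrows := fun c g => N.map g.op u = N.map g.op v
        downward_closed := fun {c d g} hg k => by
          rw [op_comp, N.map_comp, ConcreteCategory.comp_apply, hg, ConcreteCategory.comp_apply] }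
    refine hN.isSeparated _ T ?_ u v fun _ _ hg => hg
    rw [mem_totTopology]
    refine K.superset_covering ?_
      (K.pullback_stable f.unop (Presheaf.imageSieve_mem (totTopology K A) p y))
    rintro W w ⟨x, hx⟩
    exact h (op W) w.op x hx
  have e : ∀ {a b : Tot A} (f : a.base ⟶ b.base) (y : N.obj (op (op a))) {S : Cᵒᵖ} (g : b.base ⟶ S)
      (φ : (A.map f.toLoc).toFunctor.obj a.fiber ⟶ b.fiber) (x : M.obj (op (op (res a (f ≫ g))))),
        p.app _ x = N.map (toRes a (f ≫ g)).op.op y →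
      N.map (toRes b g).op.op (N.map (homMk f φ).op.op y) =
        p.app _ (M.map (homMk (𝟙 S) (resFiber f g φ)).op.op x) := by
    intro a b f y S g φ x h
    rw [NatTrans.naturality_apply, h, ← ConcreteCategory.comp_apply, ← ConcreteCategory.comp_apply,
      ← N.map_comp, ← N.map_comp, ← op_comp, ← op_comp, ← op_comp, ← op_comp, homMk_resFiber]
  constructor
  · intro a b f φ ψ y
    refine key f y _ _ fun S g x h => ?_
    rw [_root_.map_add, e f y g _ x h, e f y g _ x h, e f y g _ x h, resFiber_add, hM.map_add, _root_.map_add]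
  · intro a b f c φ y
    refine key f y _ _ fun S g x h => ?_
    rw [_root_.map_smul, e f y g _ x h, e f y g _ x h, resFiber_smul, hM.map_smul, _root_.map_smul]

end Modules
section Quotient

universe v u

variable {𝓒 : Type u} [Category.{v} 𝓒] [Abelian 𝓒] (θ : 𝟭 𝓒 ⟶ 𝟭 𝓒)

/-- The objects of an abelian category on which an endomorphism `θ` of the identity functor
acts by zero. -/
def annihilated : ObjectProperty 𝓒 := fun M => θ.app M = 0

instance : (annihilated θ).IsClosedUnderSubobjects where
  prop_of_mono {X Y} f _ hY := by
    have h := θ.naturality f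
    have hY' : θ.app Y = 0 := hY
    dsimp at h
    rw [hY', comp_zero] at h
    exact zero_of_comp_mono f h.symm

instance : (annihilated θ).IsClosedUnderQuotients where
  prop_of_epi {X Y} f _ hX := by
    have h := θ.naturality f
    have hX' : θ.app X = 0 := hX
    dsimp at h
    rw [hX', zero_comp] at h
    exact zero_of_epi_comp f h

instance : (annihilated θ).ContainsZero where
  exists_zero := by
    obtain ⟨Z, hZ⟩ := HasZeroObject.zero (C := 𝓒)
    exact ⟨Z, hZ, hZ.eq_of_tgt _ _⟩

instance : (annihilated θ).IsClosedUnderFiniteProducts where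
  isClosedUnderLimitsOfShape J _ :=
    { limitsOfShape_le := by
        rintro X ⟨p⟩
        refine p.isLimit.hom_ext fun j => ?_
        have h := θ.naturality (p.π.app j)
        have hj : θ.app (p.diag.obj j) = 0 := p.prop_diag_obj j
        dsimp at h ⊢
        rw [hj, comp_zero] at h
        rw [zero_comp]
        exact h.symm }

/-- The cokernel of `θ`, as a functor. -/
def cokernelFunctor : 𝓒 ⥤ 𝓒 where
  obj M := cokernel (θ.app M)
  map {M N} f := cokernel.map (θ.app M) (θ.app N) f f (θ.naturality f).symm
  map_id M := by
    rw [← cancel_epi (cokernel.π (θ.app M))]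
    simp
  map_comp {M N P} f g := by
    rw [← cancel_epi (cokernel.π (θ.app M))]
    simp

lemma annihilated_cokernel (M : 𝓒) : annihilated θ ((cokernelFunctor θ).obj M) := by
  have h := θ.naturality (cokernel.π (θ.app M))
  have h' : cokernel.π (θ.app M) ≫ θ.app (cokernel (θ.app M)) = 0 :=
    h.trans (cokernel.condition (θ.app M))
  exact zero_of_epi_comp (cokernel.π (θ.app M)) h'

/-- The functor `M ↦ M / θM`, from an abelian category to the category of its objects that are
annihilated by `θ`. -/
def quotientFunctor : 𝓒 ⥤ (annihilated θ).FullSubcategory :=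
  (annihilated θ).lift (cokernelFunctor θ) (annihilated_cokernel θ)

instance : (cokernelFunctor θ).Additive where
  map_add {M N f g} := by
    refine (cancel_epi (cokernel.π (θ.app M))).1 ?_
    simp only [cokernelFunctor, cokernel.map, cokernel.π_desc, Preadditive.add_comp]
    exact (congrArg₂ (· + ·) (cokernel.π_desc ..) (cokernel.π_desc ..)).symm.trans
      (Preadditive.comp_add ..).symm

instance : (quotientFunctor θ).Additive where
  map_add {_ _ f g} := ObjectProperty.hom_ext _ ((cokernelFunctor θ).map_add (f := f) (g := g))

end Quotient

section LinearSheaves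

variable {C : Type} [SmallCategory C] (K : GrothendieckTopology C)
  (A : LocallyDiscrete Cᵒᵖ ⥤ᵖ Cat.{0, 0})

lemma injective_of_mono {M N : Sheaf (totTopology K A) (ModuleCat.{0} Ch)} (f : M ⟶ N) [Mono f]
    (a) : Function.Injective (f.hom.app a) := by
  have : Mono ((sheafToPresheaf _ _).map f) := inferInstance
  have : Mono f.hom := this
  have : Mono (f.hom.app a) := inferInstance
  exact (ModuleCat.mono_iff_injective _).1 this

variable [LinearPrestack A]

/-- The sheaves of `ℂ[[ħ]]`-modules on the total category of `A` that are linear. -/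
def linearSheaves : ObjectProperty (Sheaf (totTopology K A) (ModuleCat.{0} Ch)) :=
  fun M => IsLinear A M.obj

instance : (linearSheaves K A).IsClosedUnderSubobjects where
  prop_of_mono f _ hY := IsLinear.of_injective f.hom (injective_of_mono K A f) hY

instance : (linearSheaves K A).IsClosedUnderQuotients where
  prop_of_epi {X Y} f _ hX := by
    have : Sheaf.IsLocallySurjective f := (Sheaf.isLocallySurjective_iff_epi' _ f).2 inferInstance
    have : Presheaf.IsLocallySurjective (totTopology K A) f.hom := this
    exact IsLinear.of_locallySurjective K f.hom hX Y.property

instance : (linearSheaves K A).IsClosedUnderFiniteProducts where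
  isClosedUnderLimitsOfShape J _ :=
    { limitsOfShape_le := by
        rintro X ⟨p⟩
        have inj : ∀ (a : (Tot A)ᵒᵖᵒᵖ) (x y : X.obj.obj a),
            (∀ j, (p.π.app j).hom.app a x = (p.π.app j).hom.app a y) → x = y := by
          intro a x y h
          exact Concrete.isLimit_ext _ (isLimitOfPreserves (sheafToPresheaf _ _ ⋙
            (evaluation _ _).obj a) p.isLimit) x y h
        refine ⟨fun {a b} f φ ψ x => ?_, fun {a b} f c φ x => ?_⟩
        · refine inj _ _ _ fun j => ?_
          have hj : IsLinear A (p.diag.obj j).obj := p.prop_diag_obj j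
          refine (NatTrans.naturality_apply (p.π.app j).hom _ _).trans ?_
          rw [_root_.map_add]
          refine (hj.map_add f φ ψ _).trans ?_
          exact congrArg₂ (· + ·) (NatTrans.naturality_apply (p.π.app j).hom _ _).symm
            (NatTrans.naturality_apply (p.π.app j).hom _ _).symm
        · refine inj _ _ _ fun j => ?_
          have hj : IsLinear A (p.diag.obj j).obj := p.prop_diag_obj j
          refine (NatTrans.naturality_apply (p.π.app j).hom _ _).trans ?_
          rw [_root_.map_smul]
          refine (hj.map_smul f c φ _).trans ?_
          exact congrArg (c • ·) (NatTrans.naturality_apply (p.π.app j).hom _ _).symm }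

instance : (linearSheaves K A).ContainsZero where
  exists_zero := by
    obtain ⟨Z, hZ⟩ := HasZeroObject.zero (C := Sheaf (totTopology K A) (ModuleCat.{0} Ch))
    have hs : ∀ (a : (Tot A)ᵒᵖᵒᵖ), Subsingleton (Z.obj.obj a) := fun a =>
      ModuleCat.subsingleton_of_isZero
        ((sheafToPresheaf _ _ ⋙ (evaluation _ _).obj a).map_isZero hZ)
    exact ⟨Z, hZ, fun _ _ _ _ => (hs _).elim _ _, fun _ _ _ _ => (hs _).elim _ _⟩

/-- The category of (left) modules over the `ℂ[[ħ]]`-linear prestack `A`: sheaves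
`(U, σ) ↦ M(U, σ)` of `ℂ[[ħ]]`-modules on which the morphisms of `A` act `ℂ[[ħ]]`-linearly. -/
abbrev AMod : Type 1 := (linearSheaves K A).FullSubcategory

/-- Multiplication by `ħ` on modules. -/
def hbarMap : 𝟭 (AMod K A) ⟶ 𝟭 (AMod K A) where
  app M := ObjectProperty.homMk ⟨{ app := fun a => ModuleCat.ofHom (hbar • LinearMap.id) }⟩

end LinearSheaves

section Localization

variable {C : Type} [SmallCategory C] {A : LocallyDiscrete Cᵒᵖ ⥤ᵖ Cat.{0, 0}} [LinearPrestack A]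

open scoped DirectSum

/-- The module freely generated by `a = (U, σ)`, at `b = (V, τ)`: the direct sum over
`V ⟶ U` of the modules `Hom(σ|_V, τ)`. -/
abbrev FreeAt (a b : Tot A) : Type :=
  ⨁ f : a.base ⟶ b.base, ((A.map f.toLoc).toFunctor.obj a.fiber ⟶ b.fiber)

open scoped Classical in
/-- The element of the free module given by a morphism of the total category. -/
def FreeAt.single {a b : Tot A} (h : a ⟶ b) : FreeAt a b :=
  DirectSum.lof Ch _ (fun f : a.base ⟶ b.base =>
    ((A.map f.toLoc).toFunctor.obj a.fiber ⟶ b.fiber)) h.base h.fiber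

lemma comp_add_aux' {D : Type} [SmallCategory D] [Preadditive D] {w x y z : D} (e : w ⟶ x)
    (φ ψ : x ⟶ y) (m : y ⟶ z) : e ≫ (φ + ψ) ≫ m = e ≫ φ ≫ m + e ≫ ψ ≫ m := by simp

lemma comp_smul_aux' {D : Type} [SmallCategory D] [Preadditive D] [Linear Ch D] {w x y z : D}
    (e : w ⟶ x) (c : Ch) (φ : x ⟶ y) (m : y ⟶ z) : e ≫ (c • φ) ≫ m = c • (e ≫ φ ≫ m) := by simp

open scoped Classical in
/-- Post-composition with a morphism of the total category. -/
def FreeAt.map (a : Tot A) {b c : Tot A} (g : b ⟶ c) : FreeAt a b →ₗ[Ch] FreeAt a c :=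
  DirectSum.toModule Ch _ _ fun f =>
    { toFun := fun φ => FreeAt.single (homMk f φ ≫ g)
      map_add' := fun φ ψ => by
        refine Eq.trans ?_ (_root_.map_add (DirectSum.lof Ch _ (fun f : a.base ⟶ c.base =>
          ((A.map f.toLoc).toFunctor.obj a.fiber ⟶ c.fiber)) (f ≫ g.base)) _ _)
        refine congrArg (DirectSum.lof Ch _ (fun f : a.base ⟶ c.base =>
          ((A.map f.toLoc).toFunctor.obj a.fiber ⟶ c.fiber)) (f ≫ g.base)) ?_
        change _ ≫ (A.map g.base.toLoc).toFunctor.map (φ + ψ) ≫ g.fiber = _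
        rw [LinearPrestack.map_add]
        exact comp_add_aux' _ _ _ _
      map_smul' := fun r φ => by
        refine Eq.trans ?_ (_root_.map_smul (DirectSum.lof Ch _ (fun f : a.base ⟶ c.base =>
          ((A.map f.toLoc).toFunctor.obj a.fiber ⟶ c.fiber)) (f ≫ g.base)) _ _)
        refine congrArg (DirectSum.lof Ch _ (fun f : a.base ⟶ c.base =>
          ((A.map f.toLoc).toFunctor.obj a.fiber ⟶ c.fiber)) (f ≫ g.base)) ?_
        change _ ≫ (A.map g.base.toLoc).toFunctor.map (r • φ) ≫ g.fiber = _
        rw [LinearPrestack.map_smul]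
        exact comp_smul_aux' _ _ _ _ }

open scoped Classical in
lemma FreeAt.map_single {a b c : Tot A} (h : a ⟶ b) (g : b ⟶ c) :
    FreeAt.map a g (FreeAt.single h) = FreeAt.single (h ≫ g) :=
  DirectSum.toModule_lof ..

open scoped Classical in
lemma FreeAt.hom_ext {a b : Tot A} {N : Type} [AddCommMonoid N] [Module Ch N]
    {u v : FreeAt a b →ₗ[Ch] N} (h : ∀ k : a ⟶ b, u (single k) = v (single k)) : u = v := by
  refine DirectSum.linearMap_ext _ fun f => LinearMap.ext fun φ => ?_
  exact h (homMk f φ)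

/-- The free presheaf on the generator `a = (U, σ)`: it sends `(V, τ)` to the direct sum over
`V ⟶ U` of the modules `Hom(σ|_V, τ)`. -/
def freePresheaf (a : Tot A) : (Tot A)ᵒᵖᵒᵖ ⥤ ModuleCat.{0} Ch where
  obj b := ModuleCat.of Ch (FreeAt a b.unop.unop)
  map g := ModuleCat.ofHom (FreeAt.map a g.unop.unop)
  map_id b := by
    refine ModuleCat.hom_ext (FreeAt.hom_ext fun k => ?_)
    exact (FreeAt.map_single k _).trans (congrArg FreeAt.single (Category.comp_id k))
  map_comp g h := by
    refine ModuleCat.hom_ext (FreeAt.hom_ext fun k => ?_)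
    refine (FreeAt.map_single k _).trans ?_
    refine (congrArg FreeAt.single (Category.assoc k g.unop.unop h.unop.unop).symm).trans ?_
    refine (FreeAt.map_single (k ≫ g.unop.unop) h.unop.unop).symm.trans ?_
    exact congrArg _ (FreeAt.map_single k g.unop.unop).symm

/-- The `ħ`-localization of the free presheaf on `a = (U, σ)`: it sends `(V, τ)` to the direct sum
over `V ⟶ U` of the modules `ℂ((ħ)) ⊗ Hom(σ|_V, τ)`. -/
def freeLocPresheaf (a : Tot A) : (Tot A)ᵒᵖᵒᵖ ⥤ ModuleCat.{0} Ch :=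
  freePresheaf a ⋙ MonoidalCategory.tensorLeft (ModuleCat.of Ch (LaurentSeries ℂ))

open scoped TensorProduct

lemma freePresheaf_map_add (a : Tot A) {b c : Tot A} (f : b.base ⟶ c.base)
    (φ ψ : (A.map f.toLoc).toFunctor.obj b.fiber ⟶ c.fiber) :
    FreeAt.map a (homMk f (φ + ψ)) = FreeAt.map a (homMk f φ) + FreeAt.map a (homMk f ψ) := by
  classical
  refine FreeAt.hom_ext fun k => ?_
  rw [LinearMap.add_apply, FreeAt.map_single, FreeAt.map_single, FreeAt.map_single]
  refine Eq.trans ?_ (_root_.map_add (DirectSum.lof Ch _ (fun f : a.base ⟶ c.base =>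
    ((A.map f.toLoc).toFunctor.obj a.fiber ⟶ c.fiber)) (k.base ≫ f)) _ _)
  exact congrArg (DirectSum.lof Ch _ (fun f : a.base ⟶ c.base =>
    ((A.map f.toLoc).toFunctor.obj a.fiber ⟶ c.fiber)) (k.base ≫ f)) (comp_add_aux _ _ _ _)

lemma freePresheaf_map_smul (a : Tot A) {b c : Tot A} (f : b.base ⟶ c.base) (r : Ch)
    (φ : (A.map f.toLoc).toFunctor.obj b.fiber ⟶ c.fiber) :
    FreeAt.map a (homMk f (r • φ)) = r • FreeAt.map a (homMk f φ) := by
  classical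
  refine FreeAt.hom_ext fun k => ?_
  rw [LinearMap.smul_apply, FreeAt.map_single, FreeAt.map_single]
  refine Eq.trans ?_ (_root_.map_smul (DirectSum.lof Ch _ (fun f : a.base ⟶ c.base =>
    ((A.map f.toLoc).toFunctor.obj a.fiber ⟶ c.fiber)) (k.base ≫ f)) _ _)
  exact congrArg (DirectSum.lof Ch _ (fun f : a.base ⟶ c.base =>
    ((A.map f.toLoc).toFunctor.obj a.fiber ⟶ c.fiber)) (k.base ≫ f)) (comp_smul_aux _ _ _ _)

lemma isLinear_freeLocPresheaf (a : Tot A) : IsLinear A (freeLocPresheaf a) where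
  map_add {b c} f φ ψ x := by
    change (FreeAt.map a (homMk f (φ + ψ))).lTensor (LaurentSeries ℂ) x =
      (FreeAt.map a (homMk f φ)).lTensor (LaurentSeries ℂ) x +
        (FreeAt.map a (homMk f ψ)).lTensor (LaurentSeries ℂ) x
    rw [freePresheaf_map_add, LinearMap.lTensor_add]
    rfl
  map_smul {b c} f r φ x := by
    change (FreeAt.map a (homMk f (r • φ))).lTensor (LaurentSeries ℂ) x =
      r • (FreeAt.map a (homMk f φ)).lTensor (LaurentSeries ℂ) x
    rw [freePresheaf_map_smul, LinearMap.lTensor_smul]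
    rfl

/-- The `A`-module `j_!(A^loc(σ, -))` for `a = (U, σ)`, where `A^loc = ℂ((ħ)) ⊗ A` and `j` is the
inclusion of `U`: the sheaf associated with the `ħ`-localization of the free presheaf on `a`.
It represents `M ↦ Γ(U; Hom_A(A^loc, M)(σ))`. -/
def locModule (K : GrothendieckTopology C) (a : Tot A) : AMod K A :=
  ⟨(presheafToSheaf (totTopology K A) _).obj (freeLocPresheaf a),
    IsLinear.of_locallySurjective K (toSheafify (totTopology K A) (freeLocPresheaf a))
      (isLinear_freeLocPresheaf a)
      ((presheafToSheaf (totTopology K A) _).obj (freeLocPresheaf a)).property⟩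

end Localization

section StarProducts

/-- A map `D : R → R` is a differential operator of order at most `n` on the commutative
ring `R`: it is `R`-linear if `n = 0`, and its commutators with the multiplications by elements
of `R` are differential operators of order at most `n - 1` if `n > 0`. -/
def IsDiffOp {R : Type} [CommRing R] : ℕ → (R → R) → Prop
  | 0, D => ∀ a b, D (a * b) = a * D b
  | n + 1, D => ∀ a, IsDiffOp n fun b => D (a * b) - a * D b

variable {X : Scheme.{0}} (f : X ⟶ Spec (.of ℂ))

/-- The constant functions, as sections of the structure sheaf of a scheme over `ℂ`. -/
def constants (W : X.Opens) : ℂ →+* Γ(X, W) :=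
  ((Scheme.ΓSpecIso (.of ℂ)).inv ≫ f.appTop ≫ X.presheaf.map (homOfLE le_top).op).hom

/-- A star product `g ⋆ h = ∑ i, P i (g, h) ħ ^ i` on `𝒪_V[[ħ]]`, where `V` is an open subset of a
scheme over `ℂ`: an associative product with `ℂ`-bilinear bidifferential operators
`P i : 𝒪_V × 𝒪_V → 𝒪_V` such that `P 0 (g, h) = g h`, and `P i (g, 1) = P i (1, g) = 0`
for `i > 0`. -/
structure StarProduct (V : X.Opens) where
  /-- The operators `P i`, on the sections over `W ⊆ V`. -/
  P (i : ℕ) (W : X.Opens) (hW : W ≤ V) : Γ(X, W) →+ Γ(X, W) →+ Γ(X, W)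
  P_res (i : ℕ) {W W' : X.Opens} (hW : W ≤ V) (hW' : W' ≤ W) (g h : Γ(X, W)) :
    X.presheaf.map (homOfLE hW').op (P i W hW g h) =
      P i W' (hW'.trans hW) (X.presheaf.map (homOfLE hW').op g) (X.presheaf.map (homOfLE hW').op h)
  P_const_left (i : ℕ) (W : X.Opens) (hW : W ≤ V) (c : ℂ) (g h : Γ(X, W)) :
    P i W hW (constants f W c * g) h = constants f W c * P i W hW g h
  P_const_right (i : ℕ) (W : X.Opens) (hW : W ≤ V) (c : ℂ) (g h : Γ(X, W)) :
    P i W hW g (constants f W c * h) = constants f W c * P i W hW g h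
  /-- Locally, `P i` is a differential operator of bounded order in each argument. -/
  bidifferential (i : ℕ) (x : X) (hx : x ∈ V) :
    ∃ (V' : X.Opens) (hV' : V' ≤ V) (n : ℕ), x ∈ V' ∧
      ∀ (W : X.Opens) (hW : W ≤ V') (g : Γ(X, W)),
        IsDiffOp n (fun h => P i W (hW.trans hV') g h) ∧
          IsDiffOp n (fun h => P i W (hW.trans hV') h g)
  P_zero (W : X.Opens) (hW : W ≤ V) (g h : Γ(X, W)) : P 0 W hW g h = g * h
  P_one_left (i : ℕ) (hi : 0 < i) (W : X.Opens) (hW : W ≤ V) (g : Γ(X, W)) : P i W hW 1 g = 0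
  P_one_right (i : ℕ) (hi : 0 < i) (W : X.Opens) (hW : W ≤ V) (g : Γ(X, W)) : P i W hW g 1 = 0
  assoc (n : ℕ) (W : X.Opens) (hW : W ≤ V) (g h k : Γ(X, W)) :
    ∑ p ∈ Finset.HasAntidiagonal.antidiagonal n, P p.1 W hW (P p.2 W hW g h) k =
      ∑ p ∈ Finset.HasAntidiagonal.antidiagonal n, P p.1 W hW g (P p.2 W hW h k)

variable {f}

/-- The product `G ⋆ H` of formal power series: it is the `ħ`-bilinear and `ħ`-adically continuous
extension of the star product of functions, so that its coefficient of `ħ ^ n` is the sum of the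
`P i (G_a, H_b)` with `i + (a + b) = n`. -/
def StarProduct.star {V : X.Opens} (S : StarProduct f V) {W : X.Opens} (hW : W ≤ V)
    (G H : PowerSeries Γ(X, W)) : PowerSeries Γ(X, W) :=
  PowerSeries.mk fun n => ∑ p ∈ Finset.HasAntidiagonal.antidiagonal n,
    ∑ q ∈ Finset.HasAntidiagonal.antidiagonal p.2,
      S.P p.1 W hW (PowerSeries.coeff q.1 G) (PowerSeries.coeff q.2 H)

variable (f)

/-- The object `σ|_V`, for `V ⊆ U` and `σ ∈ A(U)`. -/
abbrev restr {A : LocallyDiscrete X.Opensᵒᵖ ⥤ᵖ Cat.{0, 0}} {U V : X.Opens} (h : V ≤ U)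
    (σ : A.obj ⟨op U⟩) : A.obj ⟨op V⟩ :=
  (A.map (homOfLE h).op.toLoc).toFunctor.obj σ

/-- The restriction map `Hom(σ|_W, σ|_W) → Hom(σ|_{W'}, σ|_{W'})`, for `W' ⊆ W ⊆ U`
and `σ ∈ A(U)`. -/
def endRestr {A : LocallyDiscrete X.Opensᵒᵖ ⥤ᵖ Cat.{0, 0}} {U W W' : X.Opens} (h : W ≤ U)
    (h' : W' ≤ W) {σ : A.obj ⟨op U⟩} (u : restr h σ ⟶ restr h σ) :
    restr (h'.trans h) σ ⟶ restr (h'.trans h) σ :=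
  Pseudofunctor.LocallyDiscreteOpToCat.pullHom u (homOfLE h') (homOfLE (h'.trans h))
    (homOfLE (h'.trans h))

/-- An isomorphism of sheaves of `ℂ[[ħ]]`-algebras, over the open subset `V ⊆ U`, between the sheaf
of endomorphisms of `σ ∈ A(U)` and the star algebra `(𝒪_V[[ħ]], ⋆)`. -/
structure EndTrivialization {A : LocallyDiscrete X.Opensᵒᵖ ⥤ᵖ Cat.{0, 0}} [LinearPrestack A]
    {U V : X.Opens} (hV : V ≤ U) (σ : A.obj ⟨op U⟩) (S : StarProduct f V) where
  /-- The isomorphism on the sections over `W ⊆ V`. -/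
  equiv (W : X.Opens) (hW : W ≤ V) :
    (restr (hW.trans hV) σ ⟶ restr (hW.trans hV) σ) ≃+ PowerSeries Γ(X, W)
  map_smul (W : X.Opens) (hW : W ≤ V) (c : Ch) (u : restr (hW.trans hV) σ ⟶ restr (hW.trans hV) σ) :
    equiv W hW (c • u) = PowerSeries.map (constants f W) c * equiv W hW u
  /-- The product of two endomorphisms `u` and `v` is `u ∘ v`. -/
  map_mul (W : X.Opens) (hW : W ≤ V) (u v : restr (hW.trans hV) σ ⟶ restr (hW.trans hV) σ) :
    equiv W hW (v ≫ u) = S.star hW (equiv W hW u) (equiv W hW v)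
  map_res (W W' : X.Opens) (hW : W ≤ V) (hW' : W' ≤ W)
      (u : restr (hW.trans hV) σ ⟶ restr (hW.trans hV) σ) :
    equiv W' (hW'.trans hW) (endRestr (hW.trans hV) hW' u) =
      PowerSeries.map (X.presheaf.map (homOfLE hW').op).hom (equiv W hW u)

/-- A DQ-algebroid on a scheme `X` over `ℂ` (for the Zariski topology): a `ℂ[[ħ]]`-linear stack `A`
on `X` which is locally non-empty, in which any two objects are locally isomorphic, and such that
for every local object `σ` the sheaf of algebras of endomorphisms of `σ` is locally isomorphic
to a star algebra. -/
structure IsDQAlgebroid (A : LocallyDiscrete X.Opensᵒᵖ ⥤ᵖ Cat.{0, 0}) [LinearPrestack A] :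
    Prop where
  isStack : A.IsStack (Opens.grothendieckTopology X)
  locally_nonempty (x : X) : ∃ V : X.Opens, x ∈ V ∧ Nonempty (A.obj ⟨op V⟩)
  locally_iso (U : X.Opens) (σ τ : A.obj ⟨op U⟩) (x : X) (hx : x ∈ U) :
    ∃ (V : X.Opens) (hV : V ≤ U), x ∈ V ∧ Nonempty (restr hV σ ≅ restr hV τ)
  locally_star (U : X.Opens) (σ : A.obj ⟨op U⟩) (x : X) (hx : x ∈ U) :
    ∃ (V : X.Opens) (hV : V ≤ U), x ∈ V ∧
      ∃ S : StarProduct f V, Nonempty (EndTrivialization f hV σ S)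

end StarProducts

section Derived

/-- For an additive functor `G` of abelian categories, the functor from complexes to the derived
category of which the left derived functor of `G` is the total left derived functor. -/
abbrev onComplexes {𝓒 𝓑 : Type 1} [Category.{0} 𝓒] [Category.{0} 𝓑] [Abelian 𝓒] [Abelian 𝓑]
    [HasDerivedCategory.{w} 𝓑] (G : 𝓒 ⥤ 𝓑) [G.Additive] :
    CochainComplex 𝓒 ℤ ⥤ DerivedCategory 𝓑 :=
  G.mapHomologicalComplex (ComplexShape.up ℤ) ⋙ DerivedCategory.Q

/-- An additive functor `G` of abelian categories has a left derived functor, on unbounded derived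
categories. -/
abbrev HasLeftDerived {𝓒 𝓑 : Type 1} [Category.{0} 𝓒] [Category.{0} 𝓑] [Abelian 𝓒] [Abelian 𝓑]
    [HasDerivedCategory.{w} 𝓑] (G : 𝓒 ⥤ 𝓑) [G.Additive] : Prop :=
  (onComplexes G).HasLeftDerivedFunctor (HomologicalComplex.quasiIso 𝓒 (ComplexShape.up ℤ))

/-- The left derived functor `D(𝓒) ⥤ D(𝓑)` of an additive functor `G : 𝓒 ⥤ 𝓑`. -/
abbrev leftDerived {𝓒 𝓑 : Type 1} [Category.{0} 𝓒] [Category.{0} 𝓑] [Abelian 𝓒] [Abelian 𝓑]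
    [HasDerivedCategory.{w} 𝓒] [HasDerivedCategory.{w} 𝓑] (G : 𝓒 ⥤ 𝓑) [G.Additive]
    [HasLeftDerived G] : DerivedCategory 𝓒 ⥤ DerivedCategory 𝓑 :=
  (onComplexes G).totalLeftDerived DerivedCategory.Q
    (HomologicalComplex.quasiIso 𝓒 (ComplexShape.up ℤ))

/-- An object of the derived category has bounded cohomology. -/
abbrev IsBounded {𝓒 : Type 1} [Category.{0} 𝓒] [Abelian 𝓒] [HasDerivedCategory.{w} 𝓒]
    (M : DerivedCategory 𝓒) : Prop :=
  DerivedCategory.TStructure.t.bounded M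

variable {C : Type} [SmallCategory C] (K : GrothendieckTopology C)
  (A : LocallyDiscrete Cᵒᵖ ⥤ᵖ Cat.{0, 0}) [LinearPrestack A]

/-- The category of modules over `A / ħA`, i.e. of `A`-modules which are annihilated by `ħ`. -/
abbrev GrMod : Type 1 := (annihilated (hbarMap K A)).FullSubcategory

/-- The functor `M ↦ M / ħM = (A / ħA) ⊗_A M`. -/
abbrev gr : AMod K A ⥤ GrMod K A := quotientFunctor (hbarMap K A)

variable {K A}

/-- An object `M` of the derived category of `A`-modules is cohomologically complete:
`RHom_A(A^loc, M) = 0`. This is expressed by the vanishing, for all `n : ℤ` and all `σ ∈ A(U)`, of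
`H^n(U; RHom_A(A^loc, M)(σ)) = Hom_{D(A)}(j_!(A^loc(σ, -)), M[n])`. -/
def IsCohomologicallyComplete [HasDerivedCategory.{w} (AMod K A)]
    (M : DerivedCategory (AMod K A)) : Prop :=
  ∀ (a : Tot A) (n : ℤ) (u : (DerivedCategory.singleFunctor (AMod K A) 0).obj (locModule K a) ⟶
    (shiftFunctor (DerivedCategory (AMod K A)) n).obj M), u = 0

end Derived

end DQ

end

/-!
A sum of the modules `freeMod a` has no `ħ`-torsion, so the functorial resolutions made of such
sums compute the left derived functor of `M ↦ M / ħM`; the long exact sequence of the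
multiplication by `ħ` then shows that, when `gr M` is bounded, `ħ` is invertible on `Hⁱ M` for `i`
outside a bounded range. A morphism from a module on which `ħ` is invertible is zero as soon as
its composites with the morphisms from the modules `locModule a` are. Hence, when `Hⁱ` of the part
of `M` below the range is nonzero, there is a nonzero morphism from some `(locModule a)[-i]` to
that part, and so to `M`, which contradicts cohomological completeness. Above the range, the
obstruction to lifting such a morphism to `M` is a morphism to a bounded complex, which vanishes
for large `i` because the groups `Ext n (locModule a) G` vanish for `n > dim X + 1`. To see this,
filter `G` by the codimension of the supports of sections, as in a Cousin resolution: this reduces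
the claim to a flasque `G` and `n ≥ 2`. The cokernels of embeddings of `G` in injective modules are
then flasque and divisible by `ħ`, and morphisms from `locModule a`, which amount to sequences of
sections with `ħ s (n + 1) = s n`, lift along an epimorphism that is surjective on sections and
whose kernel is divisible.
-/

noncomputable section

namespace DQ

section Cocartesian

variable {C : Type} [SmallCategory C] {A : LocallyDiscrete Cᵒᵖ ⥤ᵖ Cat.{0, 0}}

/-- The coherence isomorphism between the restriction of `a` along `f ≫ g` and the restriction
along `g` of its restriction along `f`. -/
def resCompIso (a : Tot A) {S T : Cᵒᵖ} (f : a.base ⟶ S) (g : S ⟶ T) :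
    (res a (f ≫ g)).fiber ≅ (res (res a f) g).fiber :=
  (Cat.Hom.toNatIso (A.mapComp f.toLoc g.toLoc)).app a.fiber

lemma toRes_comp_fiber (a : Tot A) {S : Cᵒᵖ} (f : a.base ⟶ S) {c : Tot A} (u : res a f ⟶ c) :
    (toRes a f ≫ u).fiber = (resCompIso a f u.base).hom ≫ u.fiber := by
  have h : (A.map u.base.toLoc).toFunctor.map (𝟙 (res a f).fiber) = 𝟙 _ :=
    CategoryTheory.Functor.map_id _ _
  exact congrArg ((resCompIso a f u.base).hom ≫ ·)
    ((congrArg (· ≫ u.fiber) h).trans (Category.id_comp u.fiber))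

lemma res_hom_ext {a c : Tot A} {S : Cᵒᵖ} {f : a.base ⟶ S} {u v : res a f ⟶ c}
    (hb : u.base = v.base) (h : toRes a f ≫ u = toRes a f ≫ v) : u = v := by
  obtain ⟨g, φ⟩ := u
  obtain ⟨g', ψ⟩ := v
  obtain rfl : g = g' := hb
  have h' := Pseudofunctor.Grothendieck.Hom.congr h
  rw [toRes_comp_fiber, toRes_comp_fiber] at h'
  have : φ = ψ := (cancel_epi (resCompIso a f g).hom).1 (h'.trans (Category.id_comp _))
  rw [this]

/-- The factorization of a morphism `a ⟶ c` through a restriction of `a`. -/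
def resDesc {a c : Tot A} {S : Cᵒᵖ} (f : a.base ⟶ S) (h : a ⟶ c) (g : S ⟶ c.base)
    (hg : f ≫ g = h.base) : res a f ⟶ c :=
  homMk (a := res a f) g ((resCompIso a f g).inv ≫ eqToHom (by rw [← hg]) ≫ h.fiber)

lemma toRes_resDesc {a c : Tot A} {S : Cᵒᵖ} (f : a.base ⟶ S) (h : a ⟶ c) (g : S ⟶ c.base)
    (hg : f ≫ g = h.base) : toRes a f ≫ resDesc f h g hg = h := by
  obtain ⟨k, φ⟩ := h
  obtain rfl : f ≫ g = k := hg
  refine Pseudofunctor.Grothendieck.Hom.ext _ _ rfl ?_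
  rw [toRes_comp_fiber]
  exact (Category.id_comp _).trans
    (((resCompIso a f g).hom_inv_id_assoc _).trans (Category.id_comp φ))

end Cocartesian

section Action

variable {C : Type} [SmallCategory C] {A : LocallyDiscrete Cᵒᵖ ⥤ᵖ Cat.{0, 0}}

/-- The action of a morphism of the total category on the sections of a presheaf. -/
abbrev act (F : (Tot A)ᵒᵖᵒᵖ ⥤ ModuleCat.{0} Ch) {a b : Tot A} (h : a ⟶ b) :
    F.obj (op (op a)) →ₗ[Ch] F.obj (op (op b)) :=
  (F.map h.op.op).hom

variable (F : (Tot A)ᵒᵖᵒᵖ ⥤ ModuleCat.{0} Ch)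

lemma act_comp {a b c : Tot A} (h : a ⟶ b) (k : b ⟶ c) (s : F.obj (op (op a))) :
    act F (h ≫ k) s = act F k (act F h s) := by
  simp only [act, op_comp, F.map_comp]
  rfl

lemma act_id (a : Tot A) (s : F.obj (op (op a))) : act F (𝟙 a) s = s := by
  simp only [act, op_id, F.map_id]
  rfl

variable {F} in
lemma act_naturality {G : (Tot A)ᵒᵖᵒᵖ ⥤ ModuleCat.{0} Ch} (p : F ⟶ G) {a b : Tot A} (h : a ⟶ b)
    (s : F.obj (op (op a))) : p.app _ (act F h s) = act G h (p.app _ s) :=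
  NatTrans.naturality_apply p h.op.op s

end Action

section Gluing

open TopologicalSpace

variable {X : Type} [TopologicalSpace X] {A : LocallyDiscrete (Opens X)ᵒᵖ ⥤ᵖ Cat.{0, 0}}

/-- The open subset `U` underlying `a = (U, σ)`. -/
abbrev dom (a : Tot A) : Opens X := a.base.unop

/-- The restriction `(V, σ|_V)` of `a = (U, σ)`, for `V ⊆ U`. -/
abbrev restrict (a : Tot A) (V : Opens X) (h : V ≤ dom a) : Tot A := res a (homOfLE h).op

/-- The restriction morphism `(U, σ) ⟶ (V, σ|_V)`. -/
abbrev toRestrict (a : Tot A) (V : Opens X) (h : V ≤ dom a) : a ⟶ restrict a V h :=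
  toRes a (homOfLE h).op

/-- The factorization of `a ⟶ c` through the restriction of `a` to `V`. -/
def restrictDesc {a c : Tot A} {V : Opens X} (hV : V ≤ dom a) (h : a ⟶ c) (hc : dom c ≤ V) :
    restrict a V hV ⟶ c :=
  resDesc _ h (homOfLE hc).op (Subsingleton.elim _ _)

lemma toRestrict_restrictDesc {a c : Tot A} {V : Opens X} (hV : V ≤ dom a) (h : a ⟶ c)
    (hc : dom c ≤ V) : toRestrict a V hV ≫ restrictDesc hV h hc = h :=
  toRes_resDesc _ _ _ _

lemma restrict_hom_ext {a c : Tot A} {V : Opens X} {hV : V ≤ dom a} {u v : restrict a V hV ⟶ c}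
    (h : toRestrict a V hV ≫ u = toRestrict a V hV ≫ v) : u = v :=
  res_hom_ext (Subsingleton.elim _ _) h

lemma restrictDesc_comp {a c d : Tot A} {V : Opens X} (hV : V ≤ dom a) (h : a ⟶ c)
    (hc : dom c ≤ V) (k : c ⟶ d) :
    restrictDesc hV h hc ≫ k = restrictDesc hV (h ≫ k) ((leOfHom k.base.unop).trans hc) :=
  restrict_hom_ext (by rw [← Category.assoc, toRestrict_restrictDesc, toRestrict_restrictDesc])

lemma restrictDesc_toRestrict (a : Tot A) {V : Opens X} (hV : V ≤ dom a) :
    restrictDesc hV (toRestrict a V hV) le_rfl = 𝟙 _ :=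
  restrict_hom_ext (by rw [toRestrict_restrictDesc, Category.comp_id])

/-- The restriction morphism `(V, σ|_V) ⟶ (W, σ|_W)`, for `W ⊆ V ⊆ U` and `a = (U, σ)`. -/
abbrev restrictMap (a : Tot A) {V W : Opens X} (hV : V ≤ dom a) (hW : W ≤ V) :
    restrict a V hV ⟶ restrict a W (hW.trans hV) :=
  restrictDesc hV (toRestrict a W (hW.trans hV)) hW

lemma toRestrict_restrictMap (a : Tot A) {V W : Opens X} (hV : V ≤ dom a) (hW : W ≤ V) :
    toRestrict a V hV ≫ restrictMap a hV hW = toRestrict a W (hW.trans hV) :=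
  toRestrict_restrictDesc _ _ _

lemma restrictMap_restrictDesc {a c : Tot A} {V W : Opens X} (hV : V ≤ dom a) (hW : W ≤ V)
    (h : a ⟶ c) (hc : dom c ≤ W) :
    restrictMap a hV hW ≫ restrictDesc (hW.trans hV) h hc = restrictDesc hV h (hc.trans hW) :=
  restrict_hom_ext (by
    rw [← Category.assoc, toRestrict_restrictMap, toRestrict_restrictDesc,
      toRestrict_restrictDesc])

lemma restrictMap_restrictMap (a : Tot A) {V W Z : Opens X} (hV : V ≤ dom a) (hW : W ≤ V)
    (hZ : Z ≤ W) : restrictMap a hV hW ≫ restrictMap a (hW.trans hV) hZ =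
      restrictMap a hV (hZ.trans hW) :=
  restrictMap_restrictDesc _ _ _ _

/-- The sieve of the morphisms from `(U, σ)` to the objects over some member of a family of open
subsets. -/
def coverSieve (a : Tot A) {ι : Type} (V : ι → Opens X) : Sieve (op a) where
  arrows c _ := ∃ i, dom c.unop ≤ V i
  downward_closed := by
    rintro c d _ ⟨i, hi⟩ g
    exact ⟨i, (leOfHom g.unop.base.unop).trans hi⟩

lemma coverSieve_mem_totTopology (a : Tot A) {ι : Type} (V : ι → Opens X)
    (hV : ∀ x ∈ dom a, ∃ i, x ∈ V i) :
    coverSieve a V ∈ totTopology (Opens.grothendieckTopology X) A (op a) := by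
  rw [mem_totTopology]
  intro x hx
  obtain ⟨i, hi⟩ := hV x hx
  exact ⟨V i ⊓ dom a, homOfLE inf_le_right, ⟨i, inf_le_left⟩, hi, hx⟩

variable {F : (Tot A)ᵒᵖᵒᵖ ⥤ ModuleCat.{0} Ch} {a : Tot A}

lemma eq_of_locally_eq (hF : Presheaf.IsSheaf (totTopology (Opens.grothendieckTopology X) A) F)
    (s t : F.obj (op (op a)))
    (h : ∀ x ∈ dom a, ∃ (V : Opens X) (hV : V ≤ dom a), x ∈ V ∧
      act F (toRestrict a V hV) s = act F (toRestrict a V hV) t) : s = t := by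
  choose! V hV hx hst using h
  refine hF.isSeparated (op a) _ (coverSieve_mem_totTopology a (fun x : dom a => V x.1)
    fun x hx' => ⟨⟨x, hx'⟩, hx x hx'⟩) s t ?_
  rintro ⟨c⟩ g ⟨⟨x, hxa⟩, hc⟩
  change act F g.unop s = act F g.unop t
  rw [← toRestrict_restrictDesc (hV x hxa) g.unop hc, act_comp, act_comp, hst x hxa]

lemma act_restrictDesc_eq {V W : Opens X} {hV : V ≤ dom a} {hW : W ≤ dom a}
    {s : F.obj (op (op (restrict a V hV)))} {t : F.obj (op (op (restrict a W hW)))}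
    (hst : act F (restrictMap a hV (inf_le_left : V ⊓ W ≤ V)) s =
      act F (restrictMap a hW (inf_le_right : V ⊓ W ≤ W)) t)
    {c : Tot A} (g : a ⟶ c) (hcV : dom c ≤ V) (hcW : dom c ≤ W) :
    act F (restrictDesc hV g hcV) s = act F (restrictDesc hW g hcW) t := by
  rw [← restrictMap_restrictDesc hV inf_le_left g (le_inf hcV hcW),
    ← restrictMap_restrictDesc hW inf_le_right g (le_inf hcV hcW), act_comp, act_comp, hst]

lemma exists_glue (hF : Presheaf.IsSheaf (totTopology (Opens.grothendieckTopology X) A) F)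
    {ι : Type} (V : ι → Opens X) (hV : ∀ i, V i ≤ dom a)
    (hcov : ∀ x ∈ dom a, ∃ i, x ∈ V i) (s : ∀ i, F.obj (op (op (restrict a (V i) (hV i)))))
    (hs : ∀ i j, act F (restrictMap a (hV i) (inf_le_left : V i ⊓ V j ≤ V i)) (s i) =
      act F (restrictMap a (hV j) (inf_le_right : V i ⊓ V j ≤ V j)) (s j)) :
    ∃ t : F.obj (op (op a)), ∀ i, act F (toRestrict a (V i) (hV i)) t = s i := by
  have hF' := (Presheaf.isSheaf_iff_isSheaf_forget _ F (forget _)).1 hF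
  rw [isSheaf_iff_isSheaf_of_type] at hF'
  let z : Presieve.FamilyOfElements (F ⋙ forget _) (coverSieve a V).arrows :=
    fun c g hg => act F (restrictDesc (hV hg.choose) g.unop hg.choose_spec) (s hg.choose)
  have hz : z.Compatible := by
    rw [Presieve.compatible_iff_sieveCompatible]
    rintro ⟨c⟩ ⟨d⟩ f g hf
    have hg : (coverSieve a V) (g ≫ f) := (coverSieve a V).downward_closed hf g
    change act F (restrictDesc (hV hg.choose) (g ≫ f).unop hg.choose_spec) (s hg.choose) =
      act F g.unop (act F (restrictDesc (hV hf.choose) f.unop hf.choose_spec) (s hf.choose))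
    rw [← act_comp, restrictDesc_comp]
    exact act_restrictDesc_eq (hs _ _) _ _ _
  obtain ⟨t, ht, -⟩ := hF' _ (coverSieve_mem_totTopology a V hcov) z hz
  refine ⟨t, fun i => ?_⟩
  have hi : (coverSieve a V) (toRestrict a (V i) (hV i)).op := ⟨i, le_rfl⟩
  calc act F (toRestrict a (V i) (hV i)) t
      = act F (restrictDesc (hV hi.choose) (toRestrict a (V i) (hV i)) hi.choose_spec)
          (s hi.choose) := ht _ hi
    _ = act F (restrictDesc (hV i) (toRestrict a (V i) (hV i)) le_rfl) (s i) :=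
        act_restrictDesc_eq (hs _ _) _ _ _
    _ = s i := by rw [restrictDesc_toRestrict, act_id]

end Gluing

section SubPresheaf

variable {C : Type} [SmallCategory C] {A : LocallyDiscrete Cᵒᵖ ⥤ᵖ Cat.{0, 0}}

/-- A subpresheaf of modules, given by its modules of sections. -/
structure SubPresheaf (F : (Tot A)ᵒᵖᵒᵖ ⥤ ModuleCat.{0} Ch) where
  /-- The submodule of the sections over `a`. -/
  carrier (a : Tot A) : Submodule Ch (F.obj (op (op a)))
  act_mem {a b : Tot A} (h : a ⟶ b) {s : F.obj (op (op a))} (hs : s ∈ carrier a) :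
    act F h s ∈ carrier b

variable {F : (Tot A)ᵒᵖᵒᵖ ⥤ ModuleCat.{0} Ch} (p : SubPresheaf F)

/-- The presheaf of modules underlying a subpresheaf. -/
def SubPresheaf.presheaf : (Tot A)ᵒᵖᵒᵖ ⥤ ModuleCat.{0} Ch where
  obj a := ModuleCat.of Ch (p.carrier a.unop.unop)
  map h := ModuleCat.ofHom ((act F h.unop.unop).restrict fun _ hs => p.act_mem h.unop.unop hs)
  map_id a := by
    refine ModuleCat.hom_ext (LinearMap.ext fun s => Subtype.ext ?_)
    exact act_id F _ s.1
  map_comp h k := by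
    refine ModuleCat.hom_ext (LinearMap.ext fun s => Subtype.ext ?_)
    exact act_comp F h.unop.unop k.unop.unop s.1

/-- The inclusion of a subpresheaf. -/
def SubPresheaf.incl : p.presheaf ⟶ F where
  app a := ModuleCat.ofHom (p.carrier a.unop.unop).subtype

lemma SubPresheaf.incl_injective (a) : Function.Injective (p.incl.app a) :=
  Subtype.val_injective

/-- Locality of a subpresheaf: a section which belongs to it on a covering belongs to it. -/
def SubPresheaf.IsLocal (K : GrothendieckTopology C) : Prop :=
  ∀ (a : Tot A) (S : Sieve (op a)), S ∈ totTopology K A (op a) → ∀ s : F.obj (op (op a)),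
    (∀ (c : Tot A) (g : a ⟶ c), S g.op → act F g s ∈ p.carrier c) → s ∈ p.carrier a

lemma SubPresheaf.isSheaf {K : GrothendieckTopology C}
    (hF : Presheaf.IsSheaf (totTopology K A) F) (hp : p.IsLocal K) :
    Presheaf.IsSheaf (totTopology K A) p.presheaf := by
  rw [Presheaf.isSheaf_iff_isSheaf_forget _ _ (forget _), isSheaf_iff_isSheaf_of_type]
  have hF' := (Presheaf.isSheaf_iff_isSheaf_forget _ F (forget _)).1 hF
  rw [isSheaf_iff_isSheaf_of_type] at hF'
  rintro ⟨a⟩ S hS z hz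
  have key := hF' S hS
  let y : Presieve.FamilyOfElements (F ⋙ forget _) S.arrows := fun c g hg => (z g hg).1
  have hy : y.Compatible := by
    rw [Presieve.compatible_iff_sieveCompatible] at hz ⊢
    intro c d f g hf
    exact congrArg Subtype.val (hz f g hf)
  obtain ⟨t, ht, ht'⟩ := key y hy
  refine ⟨⟨t, hp a S hS t fun c g hg => ?_⟩, fun c g hg => Subtype.ext (ht g hg), ?_⟩
  · have := ht g.op hg
    change act F g t = _ at this
    rw [this]
    exact (z g.op hg).2
  · intro t₁ h₁
    exact Subtype.ext (ht' t₁.1 fun c g hg => congrArg Subtype.val (h₁ g hg))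

lemma act_homMk_toRes (F : (Tot A)ᵒᵖᵒᵖ ⥤ ModuleCat.{0} Ch) {b c : Tot A} (f : b.base ⟶ c.base)
    (φ : (A.map f.toLoc).toFunctor.obj b.fiber ⟶ c.fiber) {S : Cᵒᵖ} (k : c.base ⟶ S)
    (t : F.obj (op (op b))) :
    act F (toRes c k) (act F (homMk f φ) t) =
      act F (homMk (𝟙 S) (resFiber f k φ)) (act F (toRes b (f ≫ k)) t) := by
  rw [← act_comp, ← act_comp]
  exact congrArg (fun h => act F h t) (homMk_resFiber f k φ)

lemma eq_of_eq_on_sieve {K : GrothendieckTopology C} (hF : Presheaf.IsSheaf (totTopology K A) F)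
    {a b : Tot A} (S : Sieve (op a)) (hS : S ∈ totTopology K A (op a)) (h : a.base ⟶ b.base)
    (u v : F.obj (op (op b)))
    (huv : ∀ (T : Cᵒᵖ) (k : b.base ⟶ T), S (toRes a (h ≫ k)).op →
      act F (toRes b k) u = act F (toRes b k) v) : u = v := by
  let R : Sieve (op b) :=
    { arrows := fun c g => act F g.unop u = act F g.unop v
      downward_closed := fun {c d g} hg k => by
        rw [unop_comp, act_comp, act_comp, hg] }
  refine hF.isSeparated _ R ?_ u v fun _ _ hg => hg
  rw [mem_totTopology]
  refine K.superset_covering ?_ (K.pullback_stable h.unop hS)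
  intro W w hw
  exact huv (op W) w.op hw

variable [LinearPrestack A]

/-- The subpresheaf of the sections `s` such that the morphisms of `A` act linearly on every
restriction of `s`. -/
def linearSubPresheaf (F : (Tot A)ᵒᵖᵒᵖ ⥤ ModuleCat.{0} Ch) : SubPresheaf F where
  carrier a :=
    { carrier := {s | ∀ (b c : Tot A) (g : a ⟶ b) (f : b.base ⟶ c.base)
        (φ ψ : (A.map f.toLoc).toFunctor.obj b.fiber ⟶ c.fiber) (r : Ch),
        act F (homMk f (φ + ψ)) (act F g s) =
          act F (homMk f φ) (act F g s) + act F (homMk f ψ) (act F g s) ∧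
        act F (homMk f (r • φ)) (act F g s) = r • act F (homMk f φ) (act F g s)}
      add_mem' := by
        intro s t hs ht b c g f φ ψ r
        obtain ⟨h1, h2⟩ := hs b c g f φ ψ r
        obtain ⟨h3, h4⟩ := ht b c g f φ ψ r
        simp only [map_add, h1, h2, h3, h4, smul_add]
        exact ⟨by abel, trivial⟩
      zero_mem' := by
        intro b c g f φ ψ r
        simp
      smul_mem' := by
        intro x s hs b c g f φ ψ r
        obtain ⟨h1, h2⟩ := hs b c g f φ ψ r
        simp only [map_smul, h1, h2, smul_add]
        exact ⟨trivial, smul_comm _ _ _⟩ }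
  act_mem {a a'} h s hs := by
    intro b c g f φ ψ r
    have := hs b c (h ≫ g) f φ ψ r
    rwa [act_comp F h g] at this

lemma linearSubPresheaf_isLocal {K : GrothendieckTopology C}
    (hF : Presheaf.IsSheaf (totTopology K A) F) : (linearSubPresheaf F).IsLocal K := by
  intro a S hS s hs b c g f φ ψ r
  have key : ∀ (T : Cᵒᵖ) (k : c.base ⟶ T), S (toRes a (g.base ≫ f ≫ k)).op →
      act F (toRes b (f ≫ k)) (act F g s) ∈ (linearSubPresheaf F).carrier _ := by
    intro T k hT
    rw [← act_comp]
    have e : g ≫ toRes b (f ≫ k) = toRes a (g.base ≫ f ≫ k) ≫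
        vert (b := res b (f ≫ k)) _ := homMk_toRes g.base g.fiber (f ≫ k)
    rw [e, act_comp]
    exact (linearSubPresheaf F).act_mem _ (hs _ _ hT)
  constructor
  · refine eq_of_eq_on_sieve hF S hS (g.base ≫ f) _ _ fun T k hT => ?_
    rw [Category.assoc] at hT
    have h := (key T k hT _ (res c k) (𝟙 _) (𝟙 T) (resFiber f k φ) (resFiber f k ψ) r).1
    rw [act_id] at h
    rw [map_add, act_homMk_toRes, act_homMk_toRes, act_homMk_toRes, resFiber_add]
    exact h
  · refine eq_of_eq_on_sieve hF S hS (g.base ≫ f) _ _ fun T k hT => ?_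
    rw [Category.assoc] at hT
    have h := (key T k hT _ (res c k) (𝟙 _) (𝟙 T) (resFiber f k φ) (resFiber f k ψ) r).2
    rw [act_id] at h
    rw [map_smul, act_homMk_toRes, act_homMk_toRes, resFiber_smul]
    exact h

lemma isLinear_linearSubPresheaf (F : (Tot A)ᵒᵖᵒᵖ ⥤ ModuleCat.{0} Ch) :
    IsLinear A (linearSubPresheaf F).presheaf where
  map_add {a b} f φ ψ s := by
    have h := (s.2 a b (𝟙 a) f φ ψ 0).1
    rw [act_id] at h
    exact Subtype.ext h
  map_smul {a b} f r φ s := by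
    have h := (s.2 a b (𝟙 a) f φ φ r).2
    rw [act_id] at h
    exact Subtype.ext h

lemma mem_linearSubPresheaf_of_isLinear {G : (Tot A)ᵒᵖᵒᵖ ⥤ ModuleCat.{0} Ch} (hG : IsLinear A G)
    (p : G ⟶ F) {a : Tot A} (s : G.obj (op (op a))) :
    p.app _ s ∈ (linearSubPresheaf F).carrier a := by
  intro b c g f φ ψ r
  constructor
  · rw [← act_naturality, ← act_naturality, ← act_naturality, ← act_naturality, ← map_add]
    exact congrArg _ (hG.map_add f φ ψ _)
  · rw [← act_naturality, ← act_naturality, ← act_naturality, ← map_smul]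
    exact congrArg _ (hG.map_smul f r φ _)

variable (K : GrothendieckTopology C)

/-- The largest `A`-module contained in a sheaf on the total category. It is the value of the right
adjoint of the inclusion of the `A`-modules in the sheaves. -/
def linearPart (F : Sheaf (totTopology K A) (ModuleCat.{0} Ch)) : AMod K A :=
  ⟨⟨(linearSubPresheaf F.obj).presheaf,
    (linearSubPresheaf F.obj).isSheaf F.property (linearSubPresheaf_isLocal F.property)⟩,
    isLinear_linearSubPresheaf F.obj⟩

variable {K}

/-- The inclusion of the largest linear subsheaf. -/
def linearPartι (F : Sheaf (totTopology K A) (ModuleCat.{0} Ch)) : (linearPart K F).obj ⟶ F :=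
  ⟨(linearSubPresheaf F.obj).incl⟩

/-- The factorization of a morphism from an `A`-module to a sheaf through the largest linear
subsheaf. -/
def linearPartLift {M : AMod K A} {F : Sheaf (totTopology K A) (ModuleCat.{0} Ch)}
    (p : M.obj ⟶ F) : M ⟶ linearPart K F :=
  ObjectProperty.homMk ⟨
    { app := fun a => ModuleCat.ofHom ((p.hom.app a).hom.codRestrict _ fun s =>
        mem_linearSubPresheaf_of_isLinear M.property p.hom s)
      naturality := fun a b h => by
        ext s
        exact Subtype.ext (act_naturality p.hom h.unop.unop s) }⟩

lemma linearPartLift_ι {M : AMod K A} {F : Sheaf (totTopology K A) (ModuleCat.{0} Ch)}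
    (p : M.obj ⟶ F) : (linearPartLift p).hom ≫ linearPartι F = p := rfl

instance mono_linearPartι (F : Sheaf (totTopology K A) (ModuleCat.{0} Ch)) :
    Mono (linearPartι F) := by
  refine (sheafToPresheaf _ _).mono_of_mono_map ?_
  have : ∀ a, Mono ((linearSubPresheaf F.obj).incl.app a) := fun a =>
    (ModuleCat.mono_iff_injective _).2 ((linearSubPresheaf F.obj).incl_injective a)
  exact NatTrans.mono_of_mono_app (linearSubPresheaf F.obj).incl

end SubPresheaf

section ExactInclusion

universe v u

variable {𝓒 : Type u} [Category.{v} 𝓒] [Abelian 𝓒] (P : ObjectProperty 𝓒) [P.ContainsZero]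
  [P.IsClosedUnderSubobjects] [P.IsClosedUnderQuotients] [P.IsClosedUnderFiniteProducts]

lemma preservesFiniteLimits_ι : PreservesFiniteLimits P.ι := by
  have := P.preservesKernels_ι
  exact P.ι.preservesFiniteLimits_of_preservesKernels

lemma preservesFiniteColimits_ι : PreservesFiniteColimits P.ι := by
  have := P.preservesCokernels_ι
  exact P.ι.preservesFiniteColimits_of_preservesCokernels

end ExactInclusion

section Colimits

variable {C : Type} [SmallCategory C] (K : GrothendieckTopology C)
  (A : LocallyDiscrete Cᵒᵖ ⥤ᵖ Cat.{0, 0}) [LinearPrestack A]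

instance : PreservesFiniteLimits (linearSheaves K A).ι := preservesFiniteLimits_ι _

instance : PreservesFiniteColimits (linearSheaves K A).ι := preservesFiniteColimits_ι _

instance : EnoughInjectives (AMod K A) where
  presentation M := by
    let I := Injective.under M.obj
    refine ⟨⟨linearPart K I, ⟨fun {Y Z} g f _ => ?_⟩, linearPartLift (Injective.ι M.obj), ?_⟩⟩
    · have : Mono f.hom := inferInstanceAs (Mono ((linearSheaves K A).ι.map f))
      refine ⟨linearPartLift (Injective.factorThru (g.hom ≫ linearPartι I) f.hom), ?_⟩
      refine ObjectProperty.hom_ext _ ?_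
      rw [← cancel_mono (linearPartι I)]
      simp only [ObjectProperty.FullSubcategory.comp_hom, Category.assoc, linearPartLift_ι,
        Injective.comp_factorThru]
    · have : Mono (linearPartLift (Injective.ι M.obj)).hom :=
        mono_of_mono_fac (linearPartLift_ι (Injective.ι M.obj))
      exact (linearSheaves K A).ι.mono_of_mono_map this

variable {K A}

lemma IsLinear.of_surjective {M N : (Tot A)ᵒᵖᵒᵖ ⥤ ModuleCat.{0} Ch} (p : M ⟶ N)
    (hp : ∀ a, Function.Surjective (p.app a)) (hM : IsLinear A M) : IsLinear A N where
  map_add {a b} f φ ψ y := by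
    obtain ⟨x, rfl⟩ := hp _ y
    simp only [← NatTrans.naturality_apply, hM.map_add, _root_.map_add]
  map_smul {a b} f r φ y := by
    obtain ⟨x, rfl⟩ := hp _ y
    simp only [← NatTrans.naturality_apply, hM.map_smul, _root_.map_smul]

variable (K A)

instance (J : Type*) [Category* J] : (linearSheaves K A).IsClosedUnderColimitsOfShape J where
  colimitsOfShape_le := by
    rintro F ⟨p⟩
    let lift (j : J) : p.diag.obj j ⟶ (linearPart K F).obj :=
      (linearPartLift (M := ⟨_, p.prop_diag_obj j⟩) (p.ι.app j)).hom
    have hlift (j : J) : lift j ≫ linearPartι F = p.ι.app j := linearPartLift_ι _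
    let c : Cocone p.diag := ⟨(linearPart K F).obj,
      { app := lift
        naturality := fun i j f => by
          rw [← cancel_mono (linearPartι F), Category.assoc, hlift, Category.assoc]
          simp [hlift] }⟩
    let d : F ⟶ (linearPart K F).obj := p.isColimit.desc c
    have hd : d ≫ linearPartι F = 𝟙 F := p.isColimit.hom_ext fun j => by
      rw [← Category.assoc]
      have : p.ι.app j ≫ d = lift j := p.isColimit.fac c j
      refine (congrArg (· ≫ linearPartι F) this).trans ?_
      exact (hlift j).trans (Category.comp_id _).symm
    refine IsLinear.of_surjective (linearPartι F).hom (fun a s => ⟨d.hom.app a s, ?_⟩)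
      (linearPart K F).property
    exact congrArg (fun k => k.hom.app a s) hd

instance : HasColimitsOfSize.{0, 0} (Sheaf (totTopology K A) (ModuleCat.{0} Ch)) :=
  IsGrothendieckAbelian.hasColimits _

instance : HasColimitsOfSize.{0, 0} (AMod K A) where
  has_colimits_of_shape _ _ := inferInstance

instance (J : Type) : HasExactColimitsOfShape (Discrete J) (AMod K A) := by
  have : AB4OfSize.{0} (Sheaf (totTopology K A) (ModuleCat.{0} Ch)) :=
    IsGrothendieckAbelian.ab4OfSize _
  exact HasExactColimitsOfShape.domain_of_functor _ (linearSheaves K A).ι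

instance : HasExactColimitsOfShape ℕ (AMod K A) :=
  HasExactColimitsOfShape.domain_of_functor _ (linearSheaves K A).ι

end Colimits

section Away

variable {R Z : Type*} [CommRing R] [AddCommGroup Z] [Module R Z]

/-- The sequences `s` with `x • s (n + 1) = s n`, on which `x` acts bijectively. They correspond to
the linear maps `R[x⁻¹] → Z`, by `x ^ (-n) ↦ s n`. -/
def divisionSeq (x : R) (Z : Type*) [AddCommGroup Z] [Module R Z] : Submodule R (ℕ → Z) where
  carrier := {s | ∀ n, x • s (n + 1) = s n}
  add_mem' hs ht n := (smul_add x _ _).trans (congrArg₂ (· + ·) (hs n) (ht n))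
  zero_mem' _ := smul_zero x
  smul_mem' r _ hs n := (smul_comm x r _).trans (congrArg (r • ·) (hs n))

lemma isUnit_algebraMap_end_divisionSeq (x : R) (y : Submonoid.powers x) :
    IsUnit (algebraMap R (Module.End R (divisionSeq x Z)) y) := by
  suffices IsUnit (algebraMap R (Module.End R (divisionSeq x Z)) x) by
    obtain ⟨_, n, rfl⟩ := y
    exact (map_pow (algebraMap R (Module.End R (divisionSeq x Z))) x n).symm ▸ this.pow n
  refine (Module.End.isUnit_iff _).2 ⟨(injective_iff_map_eq_zero _).2 fun s hs => ?_, fun s => ?_⟩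
  · exact Subtype.ext (funext fun n =>
      (s.2 n).symm.trans (congrFun (congrArg Subtype.val hs) (n + 1)))
  · exact ⟨⟨fun n => s.1 (n + 1), fun n => s.2 (n + 1)⟩, Subtype.ext (funext s.2)⟩

lemma pow_smul_divisionSeq {x : R} (s : divisionSeq x Z) (n : ℕ) : x ^ n • s.1 n = s.1 0 := by
  induction n with
  | zero => rw [pow_zero, one_smul]
  | succ n ih => rw [pow_succ, mul_smul, s.2, ih]

variable (x : R) {L : Type*} [CommRing L] [Algebra R L] [IsLocalization.Away x L]

variable (L) in
/-- The element `x ^ (-n)` of a localization away from `x`. -/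
def invPow (n : ℕ) : L := IsLocalization.Away.invSelf x ^ n

lemma smul_invPow_succ (n : ℕ) : x • invPow x L (n + 1) = invPow x L n := by
  rw [invPow, pow_succ', Algebra.smul_def, ← mul_assoc, IsLocalization.Away.mul_invSelf, one_mul,
    invPow]

lemma pow_smul_invPow (n : ℕ) : x ^ n • invPow x L n = 1 :=
  (pow_smul_divisionSeq ⟨invPow x L, fun m => smul_invPow_succ x m⟩ n).trans (pow_zero _)

variable (L) {x}

/-- The linear map `R[x⁻¹] → Z` with `x ^ (-n) ↦ s n`. -/
def awayDesc (s : ℕ → Z) (hs : s ∈ divisionSeq x Z) : L →ₗ[R] Z :=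
  LinearMap.proj 0 ∘ₗ (divisionSeq x Z).subtype ∘ₗ
    IsLocalizedModule.lift (Submonoid.powers x) (Algebra.linearMap R L)
      (LinearMap.toSpanSingleton R _ ⟨s, hs⟩) (isUnit_algebraMap_end_divisionSeq x)

lemma awayDesc_invPow {s : ℕ → Z} (hs : s ∈ divisionSeq x Z) (n : ℕ) :
    awayDesc L s hs (invPow x L n) = s n := by
  let φ : L →ₗ[R] divisionSeq x Z :=
    IsLocalizedModule.lift (Submonoid.powers x) (Algebra.linearMap R L)
      (LinearMap.toSpanSingleton R _ ⟨s, hs⟩) (isUnit_algebraMap_end_divisionSeq x)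
  have h1 : φ 1 = ⟨s, hs⟩ := by
    have := IsLocalizedModule.lift_apply (Submonoid.powers x) (Algebra.linearMap R L)
      (LinearMap.toSpanSingleton R _ ⟨s, hs⟩) (isUnit_algebraMap_end_divisionSeq x) 1
    rwa [Algebra.linearMap_apply, map_one, LinearMap.toSpanSingleton_apply, one_smul] at this
  calc (φ (invPow x L n)).1 0 = x ^ n • (φ (invPow x L n)).1 n := (pow_smul_divisionSeq _ n).symm
    _ = (φ (x ^ n • invPow x L n)).1 n := by rw [map_smul]; rfl
    _ = s n := by rw [pow_smul_invPow, h1]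

variable {L}

lemma away_hom_ext (x : R) [IsLocalization.Away x L] {f g : L →ₗ[R] Z}
    (h : ∀ n, f (invPow x L n) = g (invPow x L n)) : f = g := by
  refine LinearMap.ext fun y => ?_
  obtain ⟨n, c, hy⟩ := IsLocalization.Away.surj x y
  have : y = c • invPow x L n := by
    rw [Algebra.smul_def, ← hy, mul_assoc, ← map_pow, ← Algebra.smul_def, pow_smul_invPow, mul_one]
  rw [this, map_smul, map_smul, h]

end Away

section Sections

variable {C : Type} [SmallCategory C] {A : LocallyDiscrete Cᵒᵖ ⥤ᵖ Cat.{0, 0}} [LinearPrestack A]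
  {K : GrothendieckTopology C} {M N : AMod K A}

/-- The module of sections of an `A`-module over `a = (U, σ)`. -/
abbrev sections (M : AMod K A) (a : Tot A) : ModuleCat.{0} Ch := M.obj.obj.obj (op (op a))

/-- The map induced on sections by a morphism of `A`-modules. -/
abbrev onSections (f : M ⟶ N) (a : Tot A) : sections M a →ₗ[Ch] sections N a :=
  (f.hom.hom.app (op (op a))).hom

lemma onSections_act (f : M ⟶ N) {a b : Tot A} (h : a ⟶ b) (s : sections M a) :
    onSections f b (act M.obj.obj h s) = act N.obj.obj h (onSections f a s) :=
  act_naturality f.hom.hom h s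

lemma onSections_comp {P : AMod K A} (f : M ⟶ N) (g : N ⟶ P) (a : Tot A) (s : sections M a) :
    onSections (f ≫ g) a s = onSections g a (onSections f a s) := rfl

lemma onSections_zero (a : Tot A) (s : sections M a) : onSections (0 : M ⟶ N) a s = 0 := rfl

lemma onSections_hbarMap (M : AMod K A) (a : Tot A) (s : sections M a) :
    onSections ((hbarMap K A).app M) a s = hbar • s := rfl

lemma hom_eq_zero_of_onSections (f : M ⟶ N) (h : ∀ a s, onSections f a s = 0) : f = 0 := by
  refine ObjectProperty.hom_ext _ (Sheaf.hom_ext (NatTrans.ext (funext fun a => ?_)))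
  exact ModuleCat.hom_ext (LinearMap.ext fun s => h a.unop.unop s)

end Sections

section Sheafification

variable {C : Type} [SmallCategory C] {A : LocallyDiscrete Cᵒᵖ ⥤ᵖ Cat.{0, 0}} [LinearPrestack A]
  (K : GrothendieckTopology C)

/-- The `A`-module associated with a linear presheaf. -/
def sheafifyMod (P : (Tot A)ᵒᵖᵒᵖ ⥤ ModuleCat.{0} Ch) (hP : IsLinear A P) : AMod K A :=
  ⟨(presheafToSheaf (totTopology K A) _).obj P,
    IsLinear.of_locallySurjective K (toSheafify (totTopology K A) P) hP
      ((presheafToSheaf (totTopology K A) _).obj P).property⟩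

/-- The canonical morphism to the associated `A`-module. -/
def toSheafifyMod (P : (Tot A)ᵒᵖᵒᵖ ⥤ ModuleCat.{0} Ch) (hP : IsLinear A P) :
    P ⟶ (sheafifyMod K P hP).obj.obj :=
  toSheafify (totTopology K A) P

variable {K} {P P' : (Tot A)ᵒᵖᵒᵖ ⥤ ModuleCat.{0} Ch} {hP : IsLinear A P} {M : AMod K A}

/-- The morphism from the associated `A`-module given by a morphism of presheaves. -/
def sheafifyModLift (η : P ⟶ M.obj.obj) : sheafifyMod K P hP ⟶ M :=
  ObjectProperty.homMk ⟨sheafifyLift (totTopology K A) η M.obj.property⟩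

lemma toSheafifyMod_lift (η : P ⟶ M.obj.obj) :
    toSheafifyMod K P hP ≫ (sheafifyModLift (hP := hP) η).hom.hom = η :=
  toSheafify_sheafifyLift _ _ _

lemma sheafifyMod_hom_ext {f g : sheafifyMod K P hP ⟶ M}
    (h : toSheafifyMod K P hP ≫ f.hom.hom = toSheafifyMod K P hP ≫ g.hom.hom) : f = g :=
  ObjectProperty.hom_ext _ (Sheaf.hom_ext (sheafify_hom_ext _ _ _ M.obj.property h))

/-- The functoriality of the associated `A`-module. -/
def sheafifyModMap (hP : IsLinear A P) (hP' : IsLinear A P') (η : P ⟶ P') :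
    sheafifyMod K P hP ⟶ sheafifyMod K P' hP' :=
  ObjectProperty.homMk ((presheafToSheaf (totTopology K A) _).map η)

lemma toSheafifyMod_map (hP : IsLinear A P) (hP' : IsLinear A P') (η : P ⟶ P') :
    toSheafifyMod K P hP ≫ (sheafifyModMap hP hP' η).hom.hom = η ≫ toSheafifyMod K P' hP' :=
  (toSheafify_naturality (totTopology K A) η).symm

lemma mono_sheafifyModMap (hP : IsLinear A P) (hP' : IsLinear A P') (η : P ⟶ P')
    (h : ∀ a, Function.Injective (η.app a)) : Mono (sheafifyModMap (K := K) hP hP' η) := by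
  refine (linearSheaves K A).ι.mono_of_mono_map ?_
  have : ∀ a, Mono (η.app a) := fun a => (ModuleCat.mono_iff_injective _).2 (h a)
  have : Mono η := NatTrans.mono_of_mono_app η
  exact inferInstanceAs (Mono ((presheafToSheaf (totTopology K A) _).map η))

end Sheafification

section Free

variable {C : Type} [SmallCategory C] {A : LocallyDiscrete Cᵒᵖ ⥤ᵖ Cat.{0, 0}} [LinearPrestack A]

lemma isLinear_freePresheaf (a : Tot A) : IsLinear A (freePresheaf a) where
  map_add f φ ψ x := LinearMap.congr_fun (freePresheaf_map_add a f φ ψ) x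
  map_smul f r φ x := LinearMap.congr_fun (freePresheaf_map_smul a f r φ) x

/-- The generator of the free presheaf on `a`. -/
def freePresheafGen (a : Tot A) : (freePresheaf a).obj (op (op a)) := FreeAt.single (𝟙 a)

lemma act_freePresheafGen {a b : Tot A} (k : a ⟶ b) :
    act (freePresheaf a) k (freePresheafGen a) = FreeAt.single k :=
  (FreeAt.map_single (𝟙 a) k).trans (congrArg FreeAt.single (Category.id_comp k))

lemma freePresheaf_hom_ext {M : (Tot A)ᵒᵖᵒᵖ ⥤ ModuleCat.{0} Ch} {a : Tot A}
    {f g : freePresheaf a ⟶ M}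
    (h : f.app _ (freePresheafGen a) = g.app _ (freePresheafGen a)) : f = g := by
  refine NatTrans.ext (funext fun b => ModuleCat.hom_ext (FreeAt.hom_ext fun k => ?_))
  rw [← act_freePresheafGen k]
  exact (act_naturality f k _).trans ((congrArg _ h).trans (act_naturality g k _).symm)

variable {M : (Tot A)ᵒᵖᵒᵖ ⥤ ModuleCat.{0} Ch} (hM : IsLinear A M)

/-- The bilinear map sending `k : a ⟶ b` and `s ∈ M(a)` to the image of `s` by `k` in `M(b)`. -/
def freeEval (a b : Tot A) : FreeAt a b →ₗ[Ch] M.obj (op (op a)) →ₗ[Ch] M.obj (op (op b)) := by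
  classical
  exact DirectSum.toModule Ch _ _ fun f =>
    { toFun := fun φ => act M (homMk f φ)
      map_add' := fun φ ψ => LinearMap.ext fun s => hM.map_add f φ ψ s
      map_smul' := fun r φ => LinearMap.ext fun s => hM.map_smul f r φ s }

lemma freeEval_single {a b : Tot A} (k : a ⟶ b) :
    freeEval hM a b (FreeAt.single k) = act M k := by
  classical
  exact DirectSum.toModule_lof ..

lemma freeEval_freePresheafGen {a : Tot A} (s : M.obj (op (op a))) :
    freeEval hM a a (freePresheafGen a) s = s :=
  (LinearMap.congr_fun (freeEval_single hM (𝟙 a)) s).trans (act_id M a s)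

lemma freeEval_map {a b c : Tot A} (g : b ⟶ c) (x : FreeAt a b) (s : M.obj (op (op a))) :
    freeEval hM a c (FreeAt.map a g x) s = act M g (freeEval hM a b x s) := by
  have : (freeEval hM a c).flip s ∘ₗ FreeAt.map a g = act M g ∘ₗ (freeEval hM a b).flip s := by
    refine FreeAt.hom_ext fun k => ?_
    simp only [LinearMap.comp_apply, LinearMap.flip_apply, FreeAt.map_single, freeEval_single]
    exact act_comp M k g s
  exact LinearMap.congr_fun this x

/-- The morphism from the free presheaf given by a section. -/
def freePresheafDesc {a : Tot A} (s : M.obj (op (op a))) : freePresheaf a ⟶ M where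
  app b := ModuleCat.ofHom ((freeEval hM a b.unop.unop).flip s)
  naturality _ _ g := ModuleCat.hom_ext (LinearMap.ext fun x => freeEval_map hM g.unop.unop x s)

open scoped TensorProduct

/-- The section `ħ ^ (-n)` of the localized free presheaf. -/
def freeLocPresheafGen (a : Tot A) (n : ℕ) : (freeLocPresheaf a).obj (op (op a)) :=
  (invPow hbar (LaurentSeries ℂ) n ⊗ₜ[Ch] (freePresheafGen a : FreeAt a a) :
    LaurentSeries ℂ ⊗[Ch] FreeAt a a)

lemma hbar_smul_freeLocPresheafGen (a : Tot A) (n : ℕ) :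
    hbar • freeLocPresheafGen a (n + 1) = freeLocPresheafGen a n :=
  (TensorProduct.smul_tmul' hbar _ _).trans
    (congrArg (· ⊗ₜ[Ch] (freePresheafGen a : FreeAt a a)) (smul_invPow_succ hbar n))

lemma freeLocPresheaf_hom_ext {a : Tot A} {f g : freeLocPresheaf a ⟶ M}
    (h : ∀ n, f.app _ (freeLocPresheafGen a n) = g.app _ (freeLocPresheafGen a n)) : f = g := by
  refine NatTrans.ext (funext fun b => ModuleCat.hom_ext ?_)
  refine TensorProduct.ext (away_hom_ext hbar fun n => FreeAt.hom_ext fun k => ?_)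
  have e : act (freeLocPresheaf a) k (freeLocPresheafGen a n) =
      (invPow hbar (LaurentSeries ℂ) n ⊗ₜ[Ch] (FreeAt.single k : FreeAt a b.unop.unop) :
        LaurentSeries ℂ ⊗[Ch] FreeAt a b.unop.unop) :=
    congrArg (invPow hbar (LaurentSeries ℂ) n ⊗ₜ[Ch] ·) (act_freePresheafGen k)
  calc f.app b _ = f.app b (act (freeLocPresheaf a) k (freeLocPresheafGen a n)) :=
        congrArg (f.app b).hom e.symm
    _ = g.app b (act (freeLocPresheaf a) k (freeLocPresheafGen a n)) :=
        (act_naturality f k _).trans ((congrArg _ (h n)).trans (act_naturality g k _).symm)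
    _ = g.app b _ := congrArg (g.app b).hom e

/-- The morphism from the localized free presheaf given by a sequence of sections. -/
def freeLocPresheafDesc {a : Tot A} (s : ℕ → M.obj (op (op a)))
    (hs : ∀ n, hbar • s (n + 1) = s n) : freeLocPresheaf a ⟶ M where
  app b := ModuleCat.ofHom
    (TensorProduct.lift ((freeEval hM a b.unop.unop).flip ∘ₗ awayDesc (LaurentSeries ℂ) s hs))
  naturality _ _ g := ModuleCat.hom_ext (TensorProduct.ext' fun x y =>
    freeEval_map hM g.unop.unop y (awayDesc (LaurentSeries ℂ) s hs x))

lemma freeLocPresheafDesc_gen {a : Tot A} (s : ℕ → M.obj (op (op a)))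
    (hs : ∀ n, hbar • s (n + 1) = s n) (n : ℕ) :
    (freeLocPresheafDesc hM s hs).app _ (freeLocPresheafGen a n) = s n :=
  (freeEval_freePresheafGen hM _).trans (awayDesc_invPow (LaurentSeries ℂ) hs n)

end Free

section FreeModules

variable {C : Type} [SmallCategory C] {A : LocallyDiscrete Cᵒᵖ ⥤ᵖ Cat.{0, 0}} [LinearPrestack A]
  (K : GrothendieckTopology C)

/-- The free `A`-module generated by `a = (U, σ)`. -/
def freeMod (a : Tot A) : AMod K A := sheafifyMod K (freePresheaf a) (isLinear_freePresheaf a)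

/-- The generator of the free `A`-module. -/
def freeGen (a : Tot A) : sections (freeMod K a) a :=
  (toSheafifyMod K (freePresheaf a) (isLinear_freePresheaf a)).app _ (freePresheafGen a)

/-- The section `ħ ^ (-n)` of the localized free module. -/
def locGen (a : Tot A) (n : ℕ) : sections (locModule K a) a :=
  (toSheafifyMod K (freeLocPresheaf a) (isLinear_freeLocPresheaf a)).app _ (freeLocPresheafGen a n)

lemma hbar_smul_locGen (a : Tot A) (n : ℕ) : hbar • locGen K a (n + 1) = locGen K a n :=
  (map_smul ((toSheafifyMod K (freeLocPresheaf a) (isLinear_freeLocPresheaf a)).app _).hom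
    hbar _).symm.trans (congrArg _ (hbar_smul_freeLocPresheafGen a n))

variable {K} {M : AMod K A} {a : Tot A}

/-- The morphism from the free `A`-module given by a section. -/
def freeDesc (s : sections M a) : freeMod K a ⟶ M :=
  sheafifyModLift (freePresheafDesc M.property s)

lemma onSections_freeDesc (s : sections M a) : onSections (freeDesc s) a (freeGen K a) = s :=
  (congrArg (fun u => u.app (op (op a)) (freePresheafGen a))
    (toSheafifyMod_lift (freePresheafDesc M.property s))).trans
      (freeEval_freePresheafGen M.property s)

lemma freeMod_hom_ext {f g : freeMod K a ⟶ M}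
    (h : onSections f a (freeGen K a) = onSections g a (freeGen K a)) : f = g :=
  sheafifyMod_hom_ext (freePresheaf_hom_ext h)

/-- The morphism from the localized free module given by a sequence of sections. -/
def locDesc (s : ℕ → sections M a) (hs : ∀ n, hbar • s (n + 1) = s n) : locModule K a ⟶ M :=
  sheafifyModLift (hP := isLinear_freeLocPresheaf a) (freeLocPresheafDesc M.property s hs)

lemma onSections_locDesc (s : ℕ → sections M a) (hs : ∀ n, hbar • s (n + 1) = s n) (n : ℕ) :
    onSections (locDesc s hs) a (locGen K a n) = s n :=
  (congrArg (fun u => u.app (op (op a)) (freeLocPresheafGen a n))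
    (toSheafifyMod_lift (hP := isLinear_freeLocPresheaf a)
      (freeLocPresheafDesc M.property s hs))).trans (freeLocPresheafDesc_gen M.property s hs n)

lemma locModule_hom_ext {f g : locModule K a ⟶ M}
    (h : ∀ n, onSections f a (locGen K a n) = onSections g a (locGen K a n)) : f = g :=
  sheafifyMod_hom_ext (hP := isLinear_freeLocPresheaf a) (freeLocPresheaf_hom_ext h)

lemma exists_onSections_eq_of_exact {S : ShortComplex (AMod K A)} (hS : S.Exact) [Mono S.f]
    (s : sections S.X₂ a) (hs : onSections S.g a s = 0) :
    ∃ t : sections S.X₁ a, onSections S.f a t = s := by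
  have h0 : freeDesc s ≫ S.g = 0 := freeMod_hom_ext (by
    rw [onSections_comp, onSections_freeDesc, hs, onSections_zero])
  exact ⟨onSections (hS.lift (freeDesc s) h0) a (freeGen K a), by
    rw [← onSections_comp, hS.lift_f, onSections_freeDesc]⟩

end FreeModules

section LocalSections

open TopologicalSpace

variable {X : Type} [TopologicalSpace X] {A : LocallyDiscrete (Opens X)ᵒᵖ ⥤ᵖ Cat.{0, 0}}

/-- The comparison isomorphism between `(σ|_V)|_W` and `σ|_W`, for `W ⊆ V ⊆ U` and `a = (U, σ)`. -/
def restrictRestrict (a : Tot A) {V W : Opens X} (hV : V ≤ dom a) (hW : W ≤ V) :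
    restrict (restrict a V hV) W hW ≅ restrict a W (hW.trans hV) where
  hom := restrictDesc hW (restrictMap a hV hW) le_rfl
  inv := restrictDesc (hW.trans hV) (toRestrict a V hV ≫ toRestrict (restrict a V hV) W hW) le_rfl
  hom_inv_id := restrict_hom_ext (restrict_hom_ext (by
    simp only [← Category.assoc, toRestrict_restrictDesc, Category.comp_id]))
  inv_hom_id := restrict_hom_ext (by
    rw [← Category.assoc, toRestrict_restrictDesc, Category.assoc, toRestrict_restrictDesc,
      toRestrict_restrictMap, Category.comp_id])

lemma toRestrict_restrictRestrict_hom (a : Tot A) {V W : Opens X} (hV : V ≤ dom a) (hW : W ≤ V) :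
    toRestrict (restrict a V hV) W hW ≫ (restrictRestrict a hV hW).hom = restrictMap a hV hW :=
  toRestrict_restrictDesc _ _ _

lemma restrictMap_restrictRestrict_inv (a : Tot A) {V W Z : Opens X} (hV : V ≤ dom a) (hW : W ≤ V)
    (hZ : Z ≤ W) : (restrictRestrict a hV hW).inv ≫ restrictMap (restrict a V hV) hW hZ =
      restrictMap a (hW.trans hV) hZ ≫ (restrictRestrict a hV (hZ.trans hW)).inv :=
  restrict_hom_ext (by
    dsimp only [restrictRestrict]
    simp only [← Category.assoc, toRestrict_restrictDesc]
    rw [Category.assoc, toRestrict_restrictMap])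

variable [LinearPrestack A]

local notation "𝓜" => AMod (Opens.grothendieckTopology X) A

/-- The section `s` of `N` lifts to `M` on a neighbourhood of `x`. -/
def LiftsNear {M N : 𝓜} (f : M ⟶ N) {a : Tot A} (s : sections N a) (x : X) : Prop :=
  ∃ (V : Opens X) (hV : V ≤ dom a) (t : sections M (restrict a V hV)), x ∈ V ∧
    onSections f _ t = act N.obj.obj (toRestrict a V hV) s

lemma liftsNear_of_epi {M N : 𝓜} (f : M ⟶ N) [Epi f] {a : Tot A} (s : sections N a) {x : X}
    (hx : x ∈ dom a) : LiftsNear f s x := by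
  have : Epi f.hom := inferInstanceAs (Epi ((linearSheaves _ A).ι.map f))
  have : Sheaf.IsLocallySurjective f.hom := (Sheaf.isLocallySurjective_iff_epi' _ f.hom).2 this
  have : Presheaf.IsLocallySurjective (totTopology (Opens.grothendieckTopology X) A) f.hom.hom :=
    this
  obtain ⟨V, g, ⟨t, ht⟩, hxV⟩ :=
    (Presheaf.imageSieve_mem (totTopology (Opens.grothendieckTopology X) A) f.hom.hom s) x hx
  exact ⟨V, leOfHom g, t, hxV, ht⟩

lemma LiftsNear.map {M N : 𝓜} {f : M ⟶ N} {a b : Tot A} {s : sections N a} {x : X}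
    (hs : LiftsNear f s x) (h : a ⟶ b) (hx : x ∈ dom b) : LiftsNear f (act N.obj.obj h s) x := by
  obtain ⟨V, hV, t, hxV, ht⟩ := hs
  refine ⟨V ⊓ dom b, inf_le_right, act M.obj.obj
    (restrictDesc hV (h ≫ toRestrict b (V ⊓ dom b) inf_le_right) inf_le_left) t, ⟨hxV, hx⟩, ?_⟩
  rw [onSections_act, ht, ← act_comp, toRestrict_restrictDesc, act_comp]

lemma LiftsNear.of_act_toRestrict {M N : 𝓜} {f : M ⟶ N} {a : Tot A} {s : sections N a} {x : X}
    {V : Opens X} {hV : V ≤ dom a} (h : LiftsNear f (act N.obj.obj (toRestrict a V hV) s) x) :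
    LiftsNear f s x := by
  obtain ⟨W, hW, t, hxW, ht⟩ := h
  refine ⟨W, le_trans hW hV, act M.obj.obj (restrictRestrict a hV hW).hom t, hxW, ?_⟩
  rw [onSections_act, ht, ← act_comp, ← act_comp, toRestrict_restrictRestrict_hom,
    toRestrict_restrictMap]

lemma eq_of_locally_eq_restrict (M : 𝓜) {a : Tot A} {Z : Opens X} (hZ : Z ≤ dom a)
    (s t : sections M (restrict a Z hZ))
    (h : ∀ x ∈ Z, ∃ (V : Opens X) (hV : V ≤ Z), x ∈ V ∧
      act M.obj.obj (restrictMap a hZ hV) s = act M.obj.obj (restrictMap a hZ hV) t) : s = t := by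
  refine eq_of_locally_eq M.obj.property s t fun x hx => ?_
  obtain ⟨V, hV, hxV, e⟩ := h x hx
  refine ⟨V, hV, hxV, ?_⟩
  rw [← (Iso.comp_inv_eq _).2 (toRestrict_restrictRestrict_hom a hZ hV).symm, act_comp, act_comp, e]

lemma exists_glue_restrict (M : 𝓜) {a : Tot A} {Z : Opens X} (hZ : Z ≤ dom a) {ι : Type}
    (V : ι → Opens X) (hV : ∀ i, V i ≤ Z) (hcov : ∀ x ∈ Z, ∃ i, x ∈ V i)
    (s : ∀ i, sections M (restrict a (V i) ((hV i).trans hZ)))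
    (hs : ∀ i j,
      act M.obj.obj (restrictMap a ((hV i).trans hZ) (inf_le_left : V i ⊓ V j ≤ V i)) (s i) =
      act M.obj.obj (restrictMap a ((hV j).trans hZ) (inf_le_right : V i ⊓ V j ≤ V j)) (s j)) :
    ∃ t : sections M (restrict a Z hZ), ∀ i, act M.obj.obj (restrictMap a hZ (hV i)) t = s i := by
  obtain ⟨t, ht⟩ := exists_glue M.obj.property (a := restrict a Z hZ) V hV hcov
    (fun i => act M.obj.obj (restrictRestrict a hZ (hV i)).inv (s i)) (fun i j => by
      rw [← act_comp, ← act_comp, restrictMap_restrictRestrict_inv,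
        restrictMap_restrictRestrict_inv, act_comp, act_comp]
      exact congrArg _ (hs i j))
  refine ⟨t, fun i => ?_⟩
  rw [← toRestrict_restrictRestrict_hom, act_comp, ht, ← act_comp, Iso.inv_hom_id, act_id]

lemma exists_glue_sup (M : 𝓜) {a : Tot A} {V W : Opens X} (hV : V ≤ dom a) (hW : W ≤ dom a)
    (s : sections M (restrict a V hV)) (t : sections M (restrict a W hW))
    (h : act M.obj.obj (restrictMap a hV (inf_le_left : V ⊓ W ≤ V)) s =
      act M.obj.obj (restrictMap a hW (inf_le_right : V ⊓ W ≤ W)) t) :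
    ∃ u : sections M (restrict a (V ⊔ W) (sup_le hV hW)),
      act M.obj.obj (restrictMap a _ (le_sup_left : V ≤ V ⊔ W)) u = s ∧
        act M.obj.obj (restrictMap a _ (le_sup_right : W ≤ V ⊔ W)) u = t := by
  have hle : ∀ i, cond i V W ≤ V ⊔ W := Bool.forall_bool.2 ⟨le_sup_right, le_sup_left⟩
  have h' : act M.obj.obj (restrictMap a hW (inf_le_left : W ⊓ V ≤ W)) t =
      act M.obj.obj (restrictMap a hV (inf_le_right : W ⊓ V ≤ V)) s := by
    rw [← restrictMap_restrictMap a hW (inf_le_right : V ⊓ W ≤ W) (inf_comm W V).le,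
      ← restrictMap_restrictMap a hV (inf_le_left : V ⊓ W ≤ V) (inf_comm W V).le, act_comp,
      act_comp]
    exact congrArg _ h.symm
  obtain ⟨u, hu⟩ := exists_glue_restrict M (sup_le hV hW) (fun i : Bool => cond i V W) hle
    (fun x hx => hx.elim (fun hx => ⟨true, hx⟩) fun hx => ⟨false, hx⟩)
    (fun i => match i with | true => s | false => t)
    (fun i j => by
      rcases i with (_ | _) <;> rcases j with (_ | _)
      exacts [rfl, h', h, rfl])
  exact ⟨u, hu true, hu false⟩

end LocalSections

section Flasque

open TopologicalSpace

variable {X : Type} [TopologicalSpace X] {A : LocallyDiscrete (Opens X)ᵒᵖ ⥤ᵖ Cat.{0, 0}}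
  [LinearPrestack A]

local notation "𝓜" => AMod (Opens.grothendieckTopology X) A

/-- Flasque `A`-modules: every section over `(V, σ|_V)` extends to `(U, σ)`. -/
def IsFlasque (M : 𝓜) : Prop :=
  ∀ (a : Tot A) (V : Opens X) (hV : V ≤ dom a),
    Function.Surjective (act M.obj.obj (toRestrict a V hV))

lemma exists_lift_sup {S : ShortComplex 𝓜} (hS : S.ShortExact) (hJ : IsFlasque S.X₁) {a : Tot A}
    (q : sections S.X₃ a) {V W : Opens X} (hV : V ≤ dom a) (hW : W ≤ dom a)
    (t : sections S.X₂ (restrict a V hV)) (t' : sections S.X₂ (restrict a W hW))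
    (ht : onSections S.g _ t = act S.X₃.obj.obj (toRestrict a V hV) q)
    (ht' : onSections S.g _ t' = act S.X₃.obj.obj (toRestrict a W hW) q) :
    ∃ u : sections S.X₂ (restrict a (V ⊔ W) (sup_le hV hW)),
      onSections S.g _ u = act S.X₃.obj.obj (toRestrict a (V ⊔ W) (sup_le hV hW)) q := by
  have := hS.mono_f
  obtain ⟨j, hj⟩ := exists_onSections_eq_of_exact hS.exact
    (act S.X₂.obj.obj (restrictMap a hV (inf_le_left : V ⊓ W ≤ V)) t -
      act S.X₂.obj.obj (restrictMap a hW (inf_le_right : V ⊓ W ≤ W)) t') (by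
      rw [map_sub, onSections_act, onSections_act, ht, ht', ← act_comp, ← act_comp,
        toRestrict_restrictMap, toRestrict_restrictMap, sub_self])
  obtain ⟨j', rfl⟩ := hJ a (V ⊓ W) (inf_le_left.trans hV) j
  obtain ⟨u, huV, huW⟩ := exists_glue_sup S.X₂ hV hW t
    (t' + onSections S.f _ (act S.X₁.obj.obj (toRestrict a W hW) j')) (by
      rw [map_add, ← onSections_act, ← act_comp, toRestrict_restrictMap, hj]
      abel)
  refine ⟨u, eq_of_locally_eq_restrict S.X₃ _ _ _ fun y hy => ?_⟩
  rcases hy with hy | hy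
  · refine ⟨V, le_sup_left, hy, ?_⟩
    rw [← onSections_act, huV, ht, ← act_comp, toRestrict_restrictMap]
  · refine ⟨W, le_sup_right, hy, ?_⟩
    rw [← onSections_act, huW, map_add, ht', ← act_comp, toRestrict_restrictMap,
      ← onSections_comp, S.zero, onSections_zero, add_zero]

lemma onSections_surjective_of_isFlasque [NoetherianSpace X] {S : ShortComplex 𝓜}
    (hS : S.ShortExact) (hJ : IsFlasque S.X₁) (a : Tot A) :
    Function.Surjective (onSections S.g a) := by
  have := hS.epi_g
  intro q
  let 𝒱 : Set (Opens X) := {V | ∃ (hV : V ≤ dom a) (t : sections S.X₂ (restrict a V hV)),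
    onSections S.g _ t = act S.X₃.obj.obj (toRestrict a V hV) q}
  have hne : 𝒱.Nonempty := ⟨⊥, bot_le, 0,
    eq_of_locally_eq S.X₃.obj.property _ _ fun x hx => hx.elim⟩
  obtain ⟨V, ⟨hV, t, ht⟩, hmax⟩ := WellFounded.has_min
    (wellFounded_gt : WellFounded ((· > ·) : Opens X → Opens X → Prop)) 𝒱 hne
  obtain rfl : V = dom a := by
    refine le_antisymm hV fun x hx => ?_
    obtain ⟨W, hW, t', hxW, ht'⟩ := liftsNear_of_epi S.g q hx
    have hle : ¬ V < V ⊔ W :=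
      hmax _ ⟨sup_le hV hW, exists_lift_sup hS hJ q hV hW t t' ht ht'⟩
    rw [left_lt_sup, not_not] at hle
    exact hle hxW
  refine ⟨act S.X₂.obj.obj (restrictDesc le_rfl (𝟙 a) le_rfl) t, ?_⟩
  rw [onSections_act, ht, ← act_comp, toRestrict_restrictDesc, act_id]

lemma IsFlasque.of_shortExact [NoetherianSpace X] {S : ShortComplex 𝓜} (hS : S.ShortExact)
    (h₁ : IsFlasque S.X₁) (h₂ : IsFlasque S.X₂) : IsFlasque S.X₃ := by
  intro a V hV q
  obtain ⟨t, rfl⟩ := onSections_surjective_of_isFlasque hS h₁ _ q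
  obtain ⟨t', rfl⟩ := h₂ a V hV t
  exact ⟨onSections S.g a t', (onSections_act _ _ _).symm⟩

open scoped Classical in
lemma exists_freeAt_eq_single {a b : Tot A} (g : a.base ⟶ b.base) (x : FreeAt a b) :
    ∃ φ, x = FreeAt.single (homMk g φ) := by
  refine ⟨x g, ?_⟩
  ext f
  obtain rfl : f = g := Subsingleton.elim _ _
  exact (DirectSum.lof_apply Ch (M := fun f : a.base ⟶ b.base =>
    ((A.map f.toLoc).toFunctor.obj a.fiber ⟶ b.fiber)) f (x f)).symm

open scoped Classical in
lemma freeAt_single_homMk_injective {a b : Tot A} (g : a.base ⟶ b.base) :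
    Function.Injective fun φ : (A.map g.toLoc).toFunctor.obj a.fiber ⟶ b.fiber =>
      FreeAt.single (homMk g φ) :=
  DirectSum.of_injective (β := fun f : a.base ⟶ b.base =>
    ((A.map f.toLoc).toFunctor.obj a.fiber ⟶ b.fiber)) g

/-- The morphism of free presheaves sending the generator to the restriction of the generator. -/
def freeRestrict (a : Tot A) (V : Opens X) (hV : V ≤ dom a) :
    freePresheaf (restrict a V hV) ⟶ freePresheaf a :=
  freePresheafDesc (isLinear_freePresheaf a)
    (act (freePresheaf a) (toRestrict a V hV) (freePresheafGen a))

lemma freeRestrict_single (a : Tot A) (V : Opens X) (hV : V ≤ dom a) {b : Tot A}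
    (k : restrict a V hV ⟶ b) :
    (freeRestrict a V hV).app (op (op b)) (FreeAt.single k) =
      FreeAt.single (toRestrict a V hV ≫ k) := by
  rw [← act_freePresheafGen (toRestrict a V hV ≫ k), act_comp]
  exact LinearMap.congr_fun (freeEval_single (isLinear_freePresheaf a) k) _

lemma freeRestrict_injective (a : Tot A) (V : Opens X) (hV : V ≤ dom a) (b) :
    Function.Injective ((freeRestrict a V hV).app b) := by
  intro x y hxy
  by_cases h : Nonempty ((restrict a V hV).base ⟶ b.unop.unop.base)
  · obtain ⟨g⟩ := h
    obtain ⟨φ, rfl⟩ := exists_freeAt_eq_single g x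
    obtain ⟨ψ, rfl⟩ := exists_freeAt_eq_single g y
    rw [freeRestrict_single, freeRestrict_single] at hxy
    have h : toRestrict a V hV ≫ homMk (a := restrict a V hV) g φ =
        toRestrict a V hV ≫ homMk (a := restrict a V hV) g ψ :=
      Pseudofunctor.Grothendieck.Hom.ext _ _ rfl (by
        simpa using freeAt_single_homMk_injective ((homOfLE hV).op ≫ g) hxy)
    rw [restrict_hom_ext h]
  · exact DirectSum.ext fun f => (h ⟨f⟩).elim

lemma isFlasque_of_injective (I : 𝓜) [Injective I] : IsFlasque I := by
  intro a V hV s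
  let K := Opens.grothendieckTopology X
  let i : freeMod K (restrict a V hV) ⟶ freeMod K a := sheafifyModMap _ _ (freeRestrict a V hV)
  have : Mono i := mono_sheafifyModMap _ _ _ (freeRestrict_injective a V hV)
  have hi : act (freeMod K a).obj.obj (toRestrict a V hV) (freeGen K a) =
      onSections i _ (freeGen K (restrict a V hV)) := by
    have hgen : (freeRestrict a V hV).app _ (freePresheafGen _) =
        act (freePresheaf a) (toRestrict a V hV) (freePresheafGen a) :=
      freeEval_freePresheafGen (isLinear_freePresheaf a) _
    have hmap := congrArg (fun u => u.app (op (op (restrict a V hV))) (freePresheafGen _))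
      (toSheafifyMod_map (K := K) (isLinear_freePresheaf (restrict a V hV))
        (isLinear_freePresheaf a) (freeRestrict a V hV))
    refine Eq.trans ?_ ((congrArg _ hgen.symm).trans hmap.symm)
    exact (act_naturality (toSheafifyMod K _ (isLinear_freePresheaf a)) (toRestrict a V hV) _).symm
  refine ⟨onSections (Injective.factorThru (freeDesc s) i) a (freeGen K a), ?_⟩
  rw [← onSections_act, hi, ← onSections_comp, Injective.comp_factorThru, onSections_freeDesc]

end Flasque

section DimensionShifting

open Abelian

variable {𝓑 : Type*} [Category* 𝓑] [Abelian 𝓑]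

/-- The sequence `X ⟶ Y ⟶ Y / X` attached to a morphism `X ⟶ Y`. -/
abbrev cokernelSeq {X Y : 𝓑} (f : X ⟶ Y) : ShortComplex 𝓑 :=
  ShortComplex.mk f (cokernel.π f) (cokernel.condition f)

lemma cokernelSeq_shortExact {X Y : 𝓑} (f : X ⟶ Y) [Mono f] : (cokernelSeq f).ShortExact where
  exact := ShortComplex.exact_cokernel f
  mono_f := ‹_›
  epi_g := inferInstanceAs (Epi (cokernel.π f))

variable [HasExt.{w} 𝓑]

lemma ext_eq_zero_of_shortExact {S : ShortComplex 𝓑} (hS : S.ShortExact) (L : 𝓑) (n : ℕ)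
    (h₂ : ∀ x : Ext.{w} L S.X₂ (n + 1), x = 0) (h₃ : ∀ x : Ext.{w} L S.X₃ n, x = 0)
    (x : Ext.{w} L S.X₁ (n + 1)) : x = 0 := by
  obtain ⟨y, rfl⟩ := Ext.covariant_sequence_exact₁ L hS x (h₂ _) rfl
  rw [h₃ y, Ext.zero_comp]

end DimensionShifting

section Divisible

variable {C : Type} [SmallCategory C] {A : LocallyDiscrete Cᵒᵖ ⥤ᵖ Cat.{0, 0}} [LinearPrestack A]
  {K : GrothendieckTopology C}

/-- The `A`-modules whose modules of sections are divisible by `ħ`. -/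
def IsDivisible (M : AMod K A) : Prop :=
  ∀ (a : Tot A) (s : sections M a), ∃ t : sections M a, hbar • t = s

lemma isDivisible_of_injective (hT : ∀ a : Tot A, Mono ((hbarMap K A).app (freeMod K a)))
    (I : AMod K A) [Injective I] : IsDivisible I := by
  intro a s
  have := hT a
  let g : freeMod K a ⟶ I := Injective.factorThru (freeDesc s) ((hbarMap K A).app (freeMod K a))
  refine ⟨onSections g a (freeGen K a), ?_⟩
  calc hbar • onSections g a (freeGen K a)
      = onSections ((hbarMap K A).app (freeMod K a) ≫ g) a (freeGen K a) := (map_smul _ _ _).symm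
    _ = onSections (freeDesc s) a (freeGen K a) := by rw [Injective.comp_factorThru]
    _ = s := onSections_freeDesc s

lemma exists_lift_locModule {S : ShortComplex (AMod K A)} (hS : S.ShortExact) {a : Tot A}
    (hg : Function.Surjective (onSections S.g a)) (h₁ : IsDivisible S.X₁)
    (f : locModule K a ⟶ S.X₃) : ∃ g : locModule K a ⟶ S.X₂, g ≫ S.g = f := by
  have := hS.mono_f
  let q (n : ℕ) := onSections f a (locGen K a n)
  have hq (n : ℕ) : hbar • q (n + 1) = q n := by
    rw [← map_smul, hbar_smul_locGen]
  have extend : ∀ (n : ℕ) (t : sections S.X₂ a), onSections S.g a t = q n →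
      ∃ t', onSections S.g a t' = q (n + 1) ∧ hbar • t' = t := by
    intro n t ht
    obtain ⟨u, hu⟩ := hg (q (n + 1))
    obtain ⟨j, hj⟩ := exists_onSections_eq_of_exact hS.exact (a := a) (hbar • u - t)
      (by rw [map_sub, map_smul, hu, ht, hq, sub_self])
    obtain ⟨j', rfl⟩ := h₁ a j
    refine ⟨u - onSections S.f a j', ?_, ?_⟩
    · rw [map_sub, hu, ← onSections_comp, S.zero, onSections_zero, sub_zero]
    · rw [smul_sub, ← map_smul, hj, sub_sub_cancel]
  obtain ⟨t₀, ht₀⟩ := hg (q 0)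
  choose! next hnext hsmul using extend
  let t (n : ℕ) : sections S.X₂ a := n.rec t₀ next
  have ht (n : ℕ) : onSections S.g a (t n) = q n := by
    induction n with
    | zero => exact ht₀
    | succ n ih => exact hnext n _ ih
  refine ⟨locDesc t fun n => hsmul n _ (ht n), locModule_hom_ext fun n => ?_⟩
  exact (congrArg (onSections S.g a) (onSections_locDesc t _ n)).trans (ht n)

end Divisible

section ExtVanishing

open TopologicalSpace Abelian

variable {X : Type} [TopologicalSpace X] [NoetherianSpace X]
  {A : LocallyDiscrete (Opens X)ᵒᵖ ⥤ᵖ Cat.{0, 0}} [LinearPrestack A]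

local notation "𝓚" => Opens.grothendieckTopology X
local notation "𝓜" => AMod (Opens.grothendieckTopology X) A

lemma IsDivisible.of_shortExact {S : ShortComplex 𝓜} (hS : S.ShortExact) (h₁ : IsFlasque S.X₁)
    (h₂ : IsDivisible S.X₂) : IsDivisible S.X₃ := by
  intro a q
  obtain ⟨s, rfl⟩ := onSections_surjective_of_isFlasque hS h₁ a q
  obtain ⟨t, rfl⟩ := h₂ a s
  exact ⟨onSections S.g a t, (map_smul _ _ _).symm⟩

variable [HasExt.{w} (AMod (Opens.grothendieckTopology X) A)]

lemma ext_eq_zero_of_isFlasque_of_isDivisible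
    (hT : ∀ a : Tot A, Mono ((hbarMap 𝓚 A).app (freeMod 𝓚 a))) (n : ℕ) {Q : 𝓜}
    (hQ : IsFlasque Q) (hQ' : IsDivisible Q) (a : Tot A)
    (x : Ext.{w} (locModule 𝓚 a) Q (n + 1)) : x = 0 := by
  have hS := cokernelSeq_shortExact (Injective.ι Q)
  induction n generalizing Q with
  | zero =>
    obtain ⟨y, rfl⟩ := Ext.covariant_sequence_exact₁ (locModule 𝓚 a) hS x
      (Ext.eq_zero_of_injective (I := Injective.under Q) _) rfl
    obtain ⟨f, rfl⟩ := (Ext.mk₀_bijective _ _).2 y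
    obtain ⟨g, rfl⟩ :=
      exists_lift_locModule hS (onSections_surjective_of_isFlasque hS hQ a) hQ' f
    rw [← Ext.mk₀_comp_mk₀, Ext.comp_assoc_of_second_deg_zero, hS.comp_extClass, Ext.comp_zero]
  | succ n ih =>
    refine ext_eq_zero_of_shortExact hS _ (n + 1)
      (fun y => Ext.eq_zero_of_injective (I := Injective.under Q) y) (fun y => ?_) x
    exact ih (hQ.of_shortExact hS (isFlasque_of_injective (Injective.under Q)))
      (.of_shortExact hS hQ (isDivisible_of_injective hT (Injective.under Q))) y
      (cokernelSeq_shortExact _)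

lemma ext_eq_zero_of_isFlasque (hT : ∀ a : Tot A, Mono ((hbarMap 𝓚 A).app (freeMod 𝓚 a))) (n : ℕ)
    {F : 𝓜} (hF : IsFlasque F) (a : Tot A) (x : Ext.{w} (locModule 𝓚 a) F (n + 2)) : x = 0 := by
  have hS := cokernelSeq_shortExact (Injective.ι F)
  refine ext_eq_zero_of_shortExact hS _ (n + 1)
    (fun y => Ext.eq_zero_of_injective (I := Injective.under F) y) (fun y => ?_) x
  exact ext_eq_zero_of_isFlasque_of_isDivisible hT n
    (hF.of_shortExact hS (isFlasque_of_injective (Injective.under F)))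
    (.of_shortExact hS hF (isDivisible_of_injective hT (Injective.under F))) a y

end ExtVanishing

section Support

open TopologicalSpace

lemma exists_specializes_of_mem_closure {X : Type*} [TopologicalSpace X] [NoetherianSpace X]
    [QuasiSober X] {Z : Set X} (hZ : IsLocallyClosed Z) {x : X} (hx : x ∈ closure Z) :
    ∃ z ∈ Z, z ⤳ x := by
  obtain ⟨V, F, hV, hF, rfl⟩ := hZ
  obtain ⟨T, hTf, hTc, hTi, hTF⟩ := NoetherianSpace.exists_finite_set_isClosed_irreducible hF
  rw [hTF, Set.sUnion_eq_biUnion, Set.inter_iUnion₂, hTf.closure_biUnion] at hx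
  simp only [Set.mem_iUnion] at hx
  obtain ⟨t, ht, hxt⟩ := hx
  obtain ⟨z, hz⟩ := QuasiSober.sober (hTi t ht) (hTc t ht)
  have hzV : z ∈ V := (hz.mem_open_set_iff hV).2 (by
    rw [Set.inter_comm]
    exact closure_nonempty_iff.1 ⟨x, hxt⟩)
  have hzF : z ∈ F := hTF ▸ Set.mem_sUnion_of_mem hz.mem ht
  exact ⟨z, ⟨hzV, hzF⟩, hz.specializes (closure_minimal Set.inter_subset_right (hTc t ht) hxt)⟩

variable {X : Type} [TopologicalSpace X] {A : LocallyDiscrete (Opens X)ᵒᵖ ⥤ᵖ Cat.{0, 0}}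
  [LinearPrestack A]

local notation "𝓜" => AMod (Opens.grothendieckTopology X) A

variable {M N : AMod (Opens.grothendieckTopology X) A} {a : Tot A}

/-- The section `s` vanishes on a neighbourhood of `x`. -/
def VanishesNear (s : sections M a) (x : X) : Prop :=
  ∃ (V : Opens X) (hV : V ≤ dom a), x ∈ V ∧ act M.obj.obj (toRestrict a V hV) s = 0

lemma VanishesNear.of_act_toRestrict {s : sections M a} {x : X} {V : Opens X} {hV : V ≤ dom a}
    (h : VanishesNear (M := M) (act M.obj.obj (toRestrict a V hV) s) x) :
    VanishesNear s x := by
  obtain ⟨W, hW, hxW, e⟩ := h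
  refine ⟨W, le_trans hW hV, hxW, ?_⟩
  rw [← toRestrict_restrictMap a hV hW, ← toRestrict_restrictRestrict_hom, act_comp, act_comp, e,
    map_zero]

lemma VanishesNear.onSections {s : sections M a} {x : X} (h : VanishesNear s x) (f : M ⟶ N) :
    VanishesNear (onSections f a s) x := by
  obtain ⟨V, hV, hxV, e⟩ := h
  exact ⟨V, hV, hxV, by rw [← onSections_act, e, map_zero]⟩

lemma eq_zero_of_vanishesNear (s : sections M a) (h : ∀ x ∈ dom a, VanishesNear s x) : s = 0 :=
  eq_of_locally_eq M.obj.property s 0 fun x hx => by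
    obtain ⟨V, hV, hxV, e⟩ := h x hx
    exact ⟨V, hV, hxV, e.trans (map_zero _).symm⟩

/-- The support of a section. -/
def support (s : sections M a) : Set X := {x | x ∈ dom a ∧ ¬ VanishesNear s x}

lemma isLocallyClosed_support (s : sections M a) : IsLocallyClosed (support s) := by
  let 𝒰 : Set (Opens X) := {W | ∃ hW : W ≤ dom a, act M.obj.obj (toRestrict a W hW) s = 0}
  refine ⟨dom a, ((sSup 𝒰 : Opens X) : Set X)ᶜ, (dom a).2, (sSup 𝒰).2.isClosed_compl, ?_⟩
  ext x
  simp only [support, VanishesNear, 𝒰, Set.mem_ofPred_eq, Set.mem_inter_iff, SetLike.mem_coe,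
    Set.mem_compl_iff, Opens.mem_sSup, not_exists, not_and]
  exact and_congr_right fun _ =>
    ⟨fun h W ⟨hW, e⟩ hxW => h W hW hxW e, fun h W hW hxW e => h W ⟨hW, e⟩ hxW⟩

lemma IsFlasque.exists_extension (hM : IsFlasque M) {V : Opens X} (hV : V ≤ dom a)
    (s : sections M (restrict a V hV)) :
    ∃ s' : sections M a, act M.obj.obj (toRestrict a V hV) s' = s ∧
      ∀ x ∈ dom a, x ∉ closure (support s) → VanishesNear s' x := by
  let W : Opens X := dom a ⊓ ⟨(closure (support s))ᶜ, isClosed_closure.isOpen_compl⟩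
  have hW : W ≤ dom a := inf_le_left
  have hs : act M.obj.obj (restrictMap a hV (inf_le_left : V ⊓ W ≤ V)) s = 0 := by
    refine eq_of_locally_eq_restrict M _ _ _ fun x hx => ?_
    obtain ⟨W', hW', hxW', e⟩ : VanishesNear s x :=
      not_not.1 fun h => hx.2.2 (subset_closure ⟨hx.1, h⟩)
    refine ⟨W' ⊓ (V ⊓ W), inf_le_right, ⟨hxW', hx⟩, ?_⟩
    rw [map_zero, ← act_comp, restrictMap_restrictMap, ← restrictMap_restrictMap a hV hW'
      inf_le_left, ← toRestrict_restrictRestrict_hom, act_comp, act_comp, e, map_zero, map_zero]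
  obtain ⟨u, huV, huW⟩ := exists_glue_sup M hV hW s 0 (by rw [hs, map_zero])
  obtain ⟨s', hs'⟩ := hM a _ (sup_le hV hW) u
  refine ⟨s', ?_, fun x hx hxs => ⟨W, hW, ⟨hx, hxs⟩, ?_⟩⟩
  · rw [← toRestrict_restrictMap a (sup_le hV hW) le_sup_left, act_comp, hs', huV]
  · rw [← toRestrict_restrictMap a (sup_le hV hW) le_sup_right, act_comp, hs', huW]

end Support

section Cousin

open TopologicalSpace Abelian

variable {X : Type} [TopologicalSpace X] {A : LocallyDiscrete (Opens X)ᵒᵖ ⥤ᵖ Cat.{0, 0}}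
  [LinearPrestack A]

local notation "𝓚" => Opens.grothendieckTopology X
local notation "𝓜" => AMod (Opens.grothendieckTopology X) A

variable (δ : X → ℕ)

/-- The `A`-modules whose sections are supported on the points of codimension at least `k`, where
`δ x` stands for the codimension of the point `x`. -/
def SupportedAbove (k : ℕ) (G : 𝓜) : Prop :=
  ∀ (a : Tot A) (s : sections G a), ∀ x ∈ support s, k ≤ δ x

variable {δ} {G I : AMod (Opens.grothendieckTopology X) A} (i : G ⟶ I) (k : ℕ)

variable (δ) in
/-- The subpresheaf of the sections of `I` which belong to `G` near the points of codimension at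
most `k`. -/
def cousinSubPresheaf : SubPresheaf I.obj.obj where
  carrier a :=
    { carrier := {s | ∀ x ∈ dom a, δ x ≤ k → LiftsNear i s x}
      add_mem' := by
        intro s s' hs hs' x hx hk
        obtain ⟨V, hV, t, hxV, ht⟩ := hs x hx hk
        obtain ⟨V', hV', t', hxV', ht'⟩ := hs' x hx hk
        refine ⟨V ⊓ V', inf_le_left.trans hV, act G.obj.obj (restrictMap a hV inf_le_left) t +
          act G.obj.obj (restrictMap a hV' inf_le_right) t', ⟨hxV, hxV'⟩, ?_⟩
        rw [map_add, onSections_act, onSections_act, ht, ht', ← act_comp, ← act_comp,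
          toRestrict_restrictMap, toRestrict_restrictMap, map_add]
      zero_mem' := fun x hx _ => ⟨dom a, le_rfl, 0, hx, by rw [map_zero, map_zero]⟩
      smul_mem' := by
        intro c s hs x hx hk
        obtain ⟨V, hV, t, hxV, ht⟩ := hs x hx hk
        exact ⟨V, hV, c • t, hxV, by rw [map_smul, ht, map_smul]⟩ }
  act_mem h _ hs x hx hk := (hs x (leOfHom h.base.unop hx) hk).map (N := I) h hx

lemma cousinSubPresheaf_isLocal : (cousinSubPresheaf δ i k).IsLocal 𝓚 := by
  intro a S hS s hs x hx hk
  obtain ⟨V, g, hg, hxV⟩ := hS x hx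
  exact .of_act_toRestrict (N := I) (hs _ (toRestrict a V (leOfHom g)) hg x hxV hk)

/-- The submodule of `I` of the sections which belong to `G` near the points of codimension at
most `k`; it is the step of a resolution of Cousin type. -/
def cousin (δ : X → ℕ) (i : G ⟶ I) (k : ℕ) : 𝓜 :=
  ⟨⟨(cousinSubPresheaf δ i k).presheaf,
    (cousinSubPresheaf δ i k).isSheaf I.obj.property (cousinSubPresheaf_isLocal i k)⟩,
    IsLinear.of_injective (cousinSubPresheaf δ i k).incl (cousinSubPresheaf δ i k).incl_injective
      I.property⟩

/-- The inclusion of `cousin δ i k` in `I`. -/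
def cousinι : cousin δ i k ⟶ I := ObjectProperty.homMk ⟨(cousinSubPresheaf δ i k).incl⟩

lemma cousinι_injective (a : Tot A) :
    Function.Injective (onSections (cousinι (δ := δ) i k) a) :=
  Subtype.val_injective

lemma liftsNear_cousinι {a : Tot A} (s : sections (cousin δ i k) a) {x : X} (hx : x ∈ dom a)
    (hk : δ x ≤ k) : LiftsNear i (onSections (cousinι i k) a s) x :=
  s.2 x hx hk

lemma exists_onSections_cousinι {a : Tot A} (s : sections I a)
    (hs : ∀ x ∈ dom a, δ x ≤ k → LiftsNear i s x) :
    ∃ t, onSections (cousinι (δ := δ) i k) a t = s :=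
  ⟨⟨s, hs⟩, rfl⟩

/-- The morphism from `G` to `cousin δ i k`. -/
def toCousin (δ : X → ℕ) (i : G ⟶ I) (k : ℕ) : G ⟶ cousin δ i k :=
  ObjectProperty.homMk ⟨
    { app := fun a => ModuleCat.ofHom ((i.hom.hom.app a).hom.codRestrict _ fun s x hx _ =>
        ⟨dom a.unop.unop, le_rfl, act G.obj.obj (toRestrict _ _ le_rfl) s, hx,
          onSections_act i _ s⟩)
      naturality := fun a b h => by
        ext s
        exact Subtype.ext (act_naturality i.hom.hom h.unop.unop s) }⟩

lemma toCousin_ι : toCousin δ i k ≫ cousinι i k = i := rfl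

instance [Mono i] : Mono (toCousin δ i k) := mono_of_mono_fac (toCousin_ι i k)

variable {k}

lemma liftsNear_toCousin {a : Tot A} (s : sections (cousin δ i k) a) {x : X} (hx : x ∈ dom a)
    (hk : δ x ≤ k) : LiftsNear (toCousin δ i k) s x := by
  obtain ⟨V, hV, t, hxV, ht⟩ := liftsNear_cousinι i k s hx hk
  refine ⟨V, hV, t, hxV, cousinι_injective i k _ ?_⟩
  rw [← onSections_comp, toCousin_ι, ht, onSections_act]

lemma SupportedAbove.cousin (hG : SupportedAbove δ k G) : SupportedAbove δ k (cousin δ i k) := by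
  intro a s x ⟨hx, hs⟩
  by_contra! hk
  obtain ⟨V, hV, t, hxV, ht⟩ := liftsNear_toCousin i s hx hk.le
  have h : VanishesNear t x := not_not.1 fun h => (hG _ t x ⟨hxV, h⟩).not_gt hk
  refine hs (.of_act_toRestrict (hV := hV) ?_)
  rw [← ht]
  exact h.onSections _

lemma supportedAbove_cokernel_toCousin :
    SupportedAbove δ (k + 1) (cokernel (toCousin δ i k)) := by
  intro a q x ⟨hx, hq⟩
  by_contra! hk
  obtain ⟨V, hV, s, hxV, hs⟩ := liftsNear_of_epi (cokernel.π (toCousin δ i k)) q hx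
  obtain ⟨W, hW, t, hxW, ht⟩ := liftsNear_toCousin i s hxV (Nat.lt_succ_iff.1 hk)
  refine hq (.of_act_toRestrict (hV := hV) ⟨W, hW, hxW, ?_⟩)
  rw [← hs, ← onSections_act, ← ht, ← onSections_comp, cokernel.condition, onSections_zero]

lemma id_eq_zero_of_supportedAbove (h : ∀ x, δ x < k) (hG : SupportedAbove δ k G) : 𝟙 G = 0 :=
  hom_eq_zero_of_onSections _ fun a s => eq_zero_of_vanishesNear _ fun x hx =>
    not_not.1 fun hs => (hG a s x ⟨hx, hs⟩).not_gt (h x)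

variable [NoetherianSpace X] [QuasiSober X]

lemma isFlasque_cousin (hδ : ∀ x y : X, x ⤳ y → x ≠ y → δ x < δ y) (hI : IsFlasque I)
    (hG : SupportedAbove δ k G) : IsFlasque (cousin δ i k) := by
  intro a V hV s
  obtain ⟨s', hs', hvan⟩ := hI.exists_extension hV (onSections (cousinι i k) _ s)
  obtain ⟨t, ht⟩ := exists_onSections_cousinι (δ := δ) (k := k) i s' fun x hx hk => by
    by_cases hxV : x ∈ V
    · refine .of_act_toRestrict (hV := hV) ?_
      rw [hs']
      exact liftsNear_cousinι i k s hxV hk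
    · obtain ⟨W, hW, hxW, e⟩ := hvan x hx fun hxs => by
        obtain ⟨z, ⟨hzV, hz⟩, hzx⟩ :=
          exists_specializes_of_mem_closure (isLocallyClosed_support _) hxs
        have hkz : k ≤ δ z := hG.cousin i _ s z ⟨hzV, fun h => hz (h.onSections _)⟩
        exact (hkz.trans_lt (hδ z x hzx fun h => hxV (h ▸ hzV))).not_ge hk
      exact ⟨W, hW, 0, hxW, by rw [map_zero, e]⟩
  refine ⟨t, cousinι_injective i k _ ?_⟩
  rw [onSections_act, ht, hs']

variable [HasExt.{w} (AMod (Opens.grothendieckTopology X) A)]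

lemma ext_eq_zero_of_supportedAbove (hT : ∀ a : Tot A, Mono ((hbarMap 𝓚 A).app (freeMod 𝓚 a)))
    (hδ : ∀ x y : X, x ⤳ y → x ≠ y → δ x < δ y) {d : ℕ} (hd : ∀ x, δ x ≤ d) {m k : ℕ}
    (hk : k + m = d + 1) {G : 𝓜} (hG : SupportedAbove δ k G) (a : Tot A) {n : ℕ} (hn : m < n)
    (x : Ext.{w} (locModule 𝓚 a) G n) : x = 0 := by
  induction m generalizing k G n with
  | zero =>
    have h0 : 𝟙 G = 0 :=
      id_eq_zero_of_supportedAbove (fun x => (hd x).trans_lt (by lia)) hG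
    rw [← x.comp_mk₀_id, h0, Ext.mk₀_zero, Ext.comp_zero]
  | succ m ih =>
    obtain ⟨n, rfl⟩ : ∃ l, n = l + 2 := ⟨n - 2, by lia⟩
    have hS := cokernelSeq_shortExact (toCousin δ (Injective.ι G) k)
    refine ext_eq_zero_of_shortExact hS _ (n + 1) ?_ ?_ x
    · exact ext_eq_zero_of_isFlasque hT n
        (isFlasque_cousin _ hδ (isFlasque_of_injective (Injective.under G)) hG) a
    · exact ih (by lia) (supportedAbove_cokernel_toCousin _) (by lia)

lemma ext_locModule_eq_zero (hT : ∀ a : Tot A, Mono ((hbarMap 𝓚 A).app (freeMod 𝓚 a)))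
    (hδ : ∀ x y : X, x ⤳ y → x ≠ y → δ x < δ y) {d : ℕ} (hd : ∀ x, δ x ≤ d) (G : 𝓜) (a : Tot A)
    {n : ℕ} (hn : d + 1 < n) (x : Ext.{w} (locModule 𝓚 a) G n) : x = 0 :=
  ext_eq_zero_of_supportedAbove hT hδ hd (zero_add (d + 1))
    (fun _ _ _ _ => Nat.zero_le _) a hn x

end Cousin

section Dimension

open TopologicalSpace

universe u

lemma topologicalKrullDim_lt_top_of_cover {X : Type*} [TopologicalSpace X] [CompactSpace X]
    (h : ∀ x : X, ∃ U : Opens X, x ∈ U ∧ topologicalKrullDim U < ⊤) :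
    topologicalKrullDim X < ⊤ := by
  choose U hxU hU using h
  obtain ⟨t, ht⟩ := CompactSpace.elim_nhds_subcover (fun x => (U x : Set X))
    fun x => (U x).isOpen.mem_nhds (hxU x)
  have hd : t.sup (fun x => topologicalKrullDim (U x)) < ⊤ :=
    (Finset.sup_lt_iff (by simp)).2 fun x _ => hU x
  refine lt_of_le_of_lt ?_ hd
  rw [topologicalKrullDim, Order.krullDim_eq_iSup_coheight]
  refine iSup_le fun Z => ?_
  obtain ⟨z, hz⟩ := Z.isIrreducible.nonempty
  obtain ⟨x, hx, hzx⟩ := Set.mem_iUnion₂.1 (ht.ge (Set.mem_univ z))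
  have hι := (U x).isOpenEmbedding'
  obtain ⟨W, rfl⟩ : ∃ W, IrreducibleCloseds.map _ hι.continuous W = Z := by
    let e := IrreducibleCloseds.orderIsoOfIsOpenEmbedding _ hι
    exact ⟨e.symm ⟨Z, ⟨⟨z, hzx⟩, hz⟩⟩, congrArg Subtype.val (e.apply_symm_apply ⟨Z, _⟩)⟩
  rw [hι.coheight_map]
  exact (Order.coheight_le_krullDim W).trans
    (Finset.le_sup (f := fun x => topologicalKrullDim (U x)) hx)

lemma exists_codimension {X : Type*} [TopologicalSpace X] [T0Space X]
    (hX : topologicalKrullDim X < ⊤) :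
    ∃ (δ : X → ℕ) (d : ℕ), (∀ x y : X, x ⤳ y → x ≠ y → δ x < δ y) ∧ ∀ x, δ x ≤ d := by
  let Z (x : X) : IrreducibleCloseds X :=
    ⟨closure {x}, isIrreducible_singleton.closure, isClosed_closure⟩
  obtain ⟨d, hd⟩ : ∃ d : ℕ, topologicalKrullDim X ≤ d := by
    cases h : topologicalKrullDim X with
    | bot => exact ⟨0, bot_le⟩
    | coe r =>
      lift r to ℕ using (WithBot.coe_lt_coe.1 (h ▸ hX)).ne
      exact ⟨r, le_rfl⟩
  have hZ (x : X) : Order.coheight (Z x) ≤ d :=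
    WithBot.coe_le_coe.1 ((Order.coheight_le_krullDim (Z x)).trans hd)
  have hfin (x : X) : Order.coheight (Z x) < ⊤ := (hZ x).trans_lt (ENat.natCast_lt_top d)
  refine ⟨fun x => (Order.coheight (Z x)).toNat, d, fun x y hxy hne => ?_, fun x => ?_⟩
  · have hlt : Z y < Z x := lt_of_le_not_ge
      (closure_minimal (Set.singleton_subset_iff.2 hxy.mem_closure) isClosed_closure)
      fun h => hne (hxy.antisymm (specializes_iff_mem_closure.2 (h (subset_closure rfl)))).eq
    have h := Order.coheight_strictAnti hlt (hfin x)
    rwa [← ENat.natCast_toNat (hfin x).ne, ← ENat.natCast_toNat (hfin y).ne, Nat.cast_lt] at h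
  · exact ENat.toNat_le_of_le_natCast (hZ x)

lemma ringKrullDim_lt_top_of_finiteType {R S : Type*} [CommRing R] [IsNoetherianRing R]
    (hR : ringKrullDim R < ⊤) [CommRing S] {φ : R →+* S} (hφ : φ.FiniteType) :
    ringKrullDim S < ⊤ := by
  algebraize [φ]
  obtain ⟨n, g, hg⟩ := Algebra.FiniteType.iff_quotient_mvPolynomial''.1 hφ
  refine (ringKrullDim_le_of_surjective g.toRingHom hg).trans_lt ?_
  rw [MvPolynomial.ringKrullDim_of_isNoetherianRing]
  cases h : ringKrullDim R with
  | bot => exact bot_lt_top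
  | coe r =>
    rw [h] at hR
    exact WithBot.coe_lt_coe.2
      (ENat.add_lt_top.2 ⟨WithBot.coe_lt_coe.1 hR, ENat.natCast_lt_top _⟩)

variable {X : Scheme.{u}} {k : Type u} [Field k] (f : X ⟶ Spec (.of k)) [LocallyOfFiniteType f]
  [CompactSpace X]

include f

lemma topologicalKrullDim_lt_top_of_locallyOfFiniteType :
    topologicalKrullDim X < ⊤ := by
  refine topologicalKrullDim_lt_top_of_cover fun x => ?_
  obtain ⟨R, g, _, hx, -⟩ := Scheme.exists_affine_mem_range_and_range_subset
    (show x ∈ (⊤ : X.Opens) from trivial)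
  refine ⟨g.opensRange, hx, ?_⟩
  have h : LocallyOfFiniteType (Spec.map (Spec.preimage (g ≫ f))) := by
    rw [Spec.map_preimage]
    infer_instance
  rw [HasRingHomProperty.Spec_iff (P := @LocallyOfFiniteType)] at h
  have e : Spec R ≃ₜ (g.opensRange : TopologicalSpace.Opens X) :=
    g.isOpenEmbedding.isEmbedding.toHomeomorph
  refine (e.isHomeomorph.topologicalKrullDim_eq).ge.trans_lt ?_
  refine (PrimeSpectrum.topologicalKrullDim_eq_ringKrullDim R).trans_lt ?_
  refine ringKrullDim_lt_top_of_finiteType (R := k) ?_ h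
  rw [ringKrullDim_eq_zero_of_field]
  exact WithBot.coe_lt_coe.2 ENat.top_pos

lemma noetherianSpace_of_locallyOfFiniteType : NoetherianSpace X := by
  have : AlgebraicGeometry.IsNoetherian X :=
    { __ := LocallyOfFiniteType.isLocallyNoetherian f }
  infer_instance

end Dimension

section TorsionFree

variable {C : Type} [SmallCategory C] {A : LocallyDiscrete Cᵒᵖ ⥤ᵖ Cat.{0, 0}} [LinearPrestack A]

instance {S T : Cᵒᵖ} (r : S ⟶ T) : (A.map r.toLoc).toFunctor.Additive where
  map_add := LinearPrestack.map_add r _ _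

instance {S T : Cᵒᵖ} (r : S ⟶ T) : (A.map r.toLoc).toFunctor.Linear Ch where
  map_smul φ c := LinearPrestack.map_smul r c φ

lemma map_comp_eq_zero {S T U : Cᵒᵖ} (r : S ⟶ T) (q : T ⟶ U) {σ τ : A.obj ⟨S⟩} (φ : σ ⟶ τ)
    (h : (A.map q.toLoc).toFunctor.map ((A.map r.toLoc).toFunctor.map φ) = 0) :
    (A.map (r ≫ q).toLoc).toFunctor.map φ = 0 := by
  let e := A.mapComp r.toLoc q.toLoc
  have : IsIso (e.hom.toNatTrans.app τ) := ⟨e.inv.toNatTrans.app τ,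
    congrArg (fun k => k.toNatTrans.app τ) e.hom_inv_id,
    congrArg (fun k => k.toNatTrans.app τ) e.inv_hom_id⟩
  refine (cancel_mono (e.hom.toNatTrans.app τ)).1 ?_
  exact (e.hom.toNatTrans.naturality φ).trans
    ((congrArg (e.hom.toNatTrans.app σ ≫ ·) h).trans (comp_zero.trans zero_comp.symm))

lemma FreeAt.eq_zero_of_hbar_smul
    (hA : ∀ (S : Cᵒᵖ) (σ τ : A.obj ⟨S⟩) (φ : σ ⟶ τ), hbar • φ = 0 → φ = 0) {a b : Tot A}
    (x : FreeAt a b) (hx : hbar • x = 0) : x = 0 :=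
  DirectSum.ext fun g => hA _ _ _ _ (congrArg (fun y : FreeAt a b => y g) hx)

lemma mono_hbarMap_freeMod (K : GrothendieckTopology C)
    (hA : ∀ (S : Cᵒᵖ) (σ τ : A.obj ⟨S⟩) (φ : σ ⟶ τ), hbar • φ = 0 → φ = 0) (a : Tot A) :
    Mono ((hbarMap K A).app (freeMod K a)) := by
  let η : freePresheaf a ⟶ freePresheaf a :=
    { app := fun b => ModuleCat.ofHom (hbar • LinearMap.id)
      naturality := fun b c g => ModuleCat.hom_ext (LinearMap.ext fun x =>
        (map_smul (act (freePresheaf a) g.unop.unop) hbar x).symm) }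
  have hη (b) : Function.Injective (η.app b) :=
    (injective_iff_map_eq_zero (η.app b).hom).2 fun x hx => FreeAt.eq_zero_of_hbar_smul hA x hx
  have e : (hbarMap K A).app (freeMod K a) =
      sheafifyModMap (isLinear_freePresheaf a) (isLinear_freePresheaf a) η := by
    refine sheafifyMod_hom_ext (Eq.trans ?_ (toSheafifyMod_map _ _ η).symm)
    refine NatTrans.ext (funext fun b => ModuleCat.hom_ext (LinearMap.ext fun x => ?_))
    exact (map_smul ((toSheafifyMod K _ (isLinear_freePresheaf a)).app b).hom hbar x).symm
  rw [e]
  exact mono_sheafifyModMap _ _ η hη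

end TorsionFree

section Algebroid

open TopologicalSpace

lemma hom_eq_zero_of_locally_eq_zero {X : Type} [TopologicalSpace X]
    {A : LocallyDiscrete (Opens X)ᵒᵖ ⥤ᵖ Cat.{0, 0}} [LinearPrestack A]
    (h : A.IsStack (Opens.grothendieckTopology X)) {U : Opens X} {σ τ : A.obj ⟨op U⟩} (φ : σ ⟶ τ)
    (hφ : ∀ x ∈ U, ∃ (V : Opens X) (hV : V ≤ U), x ∈ V ∧
      (A.map (homOfLE hV).op.toLoc).toFunctor.map φ = 0) : φ = 0 := by
  choose V hV hxV e using hφ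
  let g (x : U) : V x.1 x.2 ⟶ U := homOfLE (hV x.1 x.2)
  have hg : Sieve.ofArrows _ g ∈ Opens.grothendieckTopology X U := fun x hx =>
    ⟨V x hx, g ⟨x, hx⟩, Sieve.ofArrows_mk _ g (⟨x, hx⟩ : U), hxV x hx⟩
  refine (A.fullyFaithfulToDescentData g hg).map_injective ?_
  ext x
  exact (e x.1 x.2).trans (Functor.map_zero _ _ _).symm

variable {X : Scheme.{0}} {f : X ⟶ Spec (.of ℂ)} {A : LocallyDiscrete X.Opensᵒᵖ ⥤ᵖ Cat.{0, 0}}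
  [LinearPrestack A]

lemma EndTrivialization.eq_zero_of_hbar_smul {U V : X.Opens} {hV : V ≤ U} {σ : A.obj ⟨op U⟩}
    {S : StarProduct f V} (t : EndTrivialization f hV σ S) (u : restr hV σ ⟶ restr hV σ)
    (hu : hbar • u = 0) : u = 0 := by
  have h := t.map_smul V le_rfl hbar u
  rw [hu, map_zero, PowerSeries.map_X] at h
  exact (map_eq_zero_iff _ (t.equiv V le_rfl).injective).1
    (PowerSeries.X_mul_cancel (h.symm.trans (mul_zero _).symm))

lemma IsDQAlgebroid.eq_zero_of_hbar_smul (hA : IsDQAlgebroid f A) {U : X.Opens}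
    {σ τ : A.obj ⟨op U⟩} (φ : σ ⟶ τ) (hφ : hbar • φ = 0) : φ = 0 := by
  refine hom_eq_zero_of_locally_eq_zero hA.isStack φ fun x hx => ?_
  obtain ⟨W, hW, hxW, ⟨i⟩⟩ := hA.locally_iso U σ τ x hx
  obtain ⟨V, hV, hxV, S, ⟨t⟩⟩ := hA.locally_star W (restr hW σ) x hxW
  let F := (A.map (homOfLE hW).op.toLoc).toFunctor
  let G := (A.map (homOfLE hV).op.toLoc).toFunctor
  have hu : G.map (F.map φ ≫ i.inv) = 0 := by
    refine t.eq_zero_of_hbar_smul _ ?_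
    rw [← G.map_smul, ← Linear.smul_comp, ← F.map_smul, hφ, F.map_zero, zero_comp, G.map_zero]
  refine ⟨V, hV.trans hW, hxV, map_comp_eq_zero (homOfLE hW).op (homOfLE hV).op φ ?_⟩
  rw [G.map_comp] at hu
  exact (cancel_mono (G.map i.inv)).1 (hu.trans zero_comp.symm)

end Algebroid

section EndomorphismOfIdentity

universe v u

variable {𝓒 : Type u} [Category.{v} 𝓒] (θ : 𝟭 𝓒 ⟶ 𝟭 𝓒)

lemma mono_app_of_mono {M N : 𝓒} (f : M ⟶ N) [Mono f] (h : Mono (θ.app N)) :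
    Mono (θ.app M) := by
  have e : θ.app M ≫ f = f ≫ θ.app N := (θ.naturality f).symm
  have : Mono (θ.app M ≫ f) := by
    rw [e]
    exact mono_comp _ _
  exact mono_of_mono _ f

lemma isIso_app_of_iso {M N : 𝓒} (f : M ≅ N) (h : IsIso (θ.app M)) : IsIso (θ.app N) := by
  have e : θ.app N = f.inv ≫ θ.app M ≫ f.hom := by
    rw [Iso.eq_inv_comp]
    exact θ.naturality f.hom
  rw [e]
  infer_instance

lemma isIso_app_of_isZero {M : 𝓒} (hM : IsZero M) : IsIso (θ.app M) :=
  ⟨hM.to_ M, hM.eq_of_src _ _, hM.eq_of_src _ _⟩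

end EndomorphismOfIdentity

section TorsionFreeCover

open ZeroObject

universe v u

variable {𝓒 : Type u} [Category.{v} 𝓒] [HasCoproducts.{v} 𝓒] (θ : 𝟭 𝓒 ⟶ 𝟭 𝓒) {ι : Type v}
  (P : ι → 𝓒)

/-- The inclusion of a summand of the sum of the `P i`, over all the morphisms from `P i`
to `M`. -/
def sumCoverι {M : 𝓒} {i : ι} (f : P i ⟶ M) : P i ⟶ ∐ fun p : Σ i, (P i ⟶ M) => P p.1 :=
  Sigma.ι (fun p : Σ i, (P i ⟶ M) => P p.1) ⟨i, f⟩

variable {P} in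
lemma sumCoverι_desc {M N : 𝓒} (g : ∀ p : Σ i, (P i ⟶ M), P p.1 ⟶ N) {i : ι} (f : P i ⟶ M) :
    sumCoverι P f ≫ Sigma.desc g = g ⟨i, f⟩ :=
  Sigma.ι_desc g _

variable {P} in
lemma sumCover_hom_ext {M N : 𝓒} {u v : (∐ fun p : Σ i, (P i ⟶ M) => P p.1) ⟶ N}
    (h : ∀ i (f : P i ⟶ M), sumCoverι P f ≫ u = sumCoverι P f ≫ v) : u = v :=
  Sigma.hom_ext _ _ fun p => h p.1 p.2

/-- The sum of the `P i`, over all the morphisms from `P i` to `M`. -/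
abbrev sumCover : 𝓒 ⥤ 𝓒 where
  obj M := ∐ fun p : Σ i, (P i ⟶ M) => P p.1
  map {M N} f := Sigma.desc fun p => sumCoverι P (p.2 ≫ f)
  map_id M := sumCover_hom_ext fun i f => by
    rw [sumCoverι_desc, Category.comp_id, Category.comp_id]
  map_comp {M N L} f g := sumCover_hom_ext fun i k => by
    rw [sumCoverι_desc, ← Category.assoc (sumCoverι P k), sumCoverι_desc, sumCoverι_desc,
      Category.assoc]

lemma sumCoverι_map {M N : 𝓒} {i : ι} (f : P i ⟶ M) (g : M ⟶ N) :
    sumCoverι P f ≫ (sumCover P).map g = sumCoverι P (f ≫ g) :=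
  sumCoverι_desc _ f

/-- The morphism `sumCover P ⟶ 𝟭` whose components are the given morphisms. -/
abbrev sumCoverπ : sumCover P ⟶ 𝟭 𝓒 where
  app M := Sigma.desc fun p => p.2
  naturality {M N} f := sumCover_hom_ext fun i k => by
    rw [← Category.assoc, sumCoverι_map, sumCoverι_desc, ← Category.assoc, sumCoverι_desc]
    rfl

lemma sumCoverι_π {M : 𝓒} {i : ι} (f : P i ⟶ M) : sumCoverι P f ≫ (sumCoverπ P).app M = f :=
  sumCoverι_desc _ f

variable [Abelian 𝓒]

lemma mono_app_sumCover [AB4OfSize.{v} 𝓒]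
    (hP : ∀ i, Mono (θ.app (P i))) (M : 𝓒) : Mono (θ.app ((sumCover P).obj M)) := by
  let α : Discrete.functor (fun p : Σ i, (P i ⟶ M) => P p.1) ⟶
      Discrete.functor (fun p : Σ i, (P i ⟶ M) => P p.1) :=
    Discrete.natTrans fun p => θ.app _
  have : ∀ j, Mono (α.app j) := fun j => hP j.as.1
  have : Mono α := NatTrans.mono_of_mono_app α
  have h : Mono (colim.map α) := inferInstance
  have e : θ.app ((sumCover P).obj M) = colim.map α := by
    refine colimit.hom_ext fun j => ?_
    refine (θ.naturality (colimit.ι (Discrete.functor fun p : Σ i, (P i ⟶ M) => P p.1) j)).trans ?_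
    exact (colimit.ι_map α j).symm
  rw [e]
  exact h

/-- The kernel of `sumCover P ⟶ sumCover P 0`, which unlike `sumCover P` preserves the zero
morphisms. -/
abbrev cover : 𝓒 ⥤ 𝓒 where
  obj M := kernel ((sumCover P).map (0 : M ⟶ 0))
  map {M N} f := kernel.map _ _ ((sumCover P).map f) (𝟙 _) (by
    rw [Category.comp_id, ← (sumCover P).map_comp, comp_zero])
  map_id M := by
    rw [← cancel_mono (kernel.ι _), kernel.lift_ι, (sumCover P).map_id, Category.comp_id,
      Category.id_comp]
  map_comp f g := by
    rw [← cancel_mono (kernel.ι _), kernel.lift_ι, Category.assoc, kernel.lift_ι,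
      kernel.lift_ι_assoc, (sumCover P).map_comp, Category.assoc]

instance : (cover P).PreservesZeroMorphisms where
  map_zero M N := by
    have e : (0 : M ⟶ N) = (0 : M ⟶ 0) ≫ 0 := by simp
    refine (cancel_mono (kernel.ι ((sumCover P).map (0 : N ⟶ 0)))).1 ?_
    refine (kernel.lift_ι _ _ _).trans ?_
    rw [zero_comp, e, Functor.map_comp, kernel.condition_assoc, zero_comp]

/-- The morphism from `cover P` to the identity functor. -/
abbrev coverπ : cover P ⟶ 𝟭 𝓒 where
  app M := kernel.ι _ ≫ (sumCoverπ P).app M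
  naturality {M N} f := by
    change kernel.lift _ _ _ ≫ kernel.ι _ ≫ _ = (kernel.ι _ ≫ _) ≫ f
    rw [kernel.lift_ι_assoc, Category.assoc, Category.assoc, (sumCoverπ P).naturality]
    rfl

lemma epi_coverπ_app (hP : ∀ {M N : 𝓒} (g : M ⟶ N), (∀ i (f : P i ⟶ M), f ≫ g = 0) → g = 0)
    (M : 𝓒) : Epi ((coverπ P).app M) := by
  refine Preadditive.epi_of_cancel_zero _ fun {N} (g : M ⟶ N) hg => hP g
    fun i (f : P i ⟶ M) => ?_
  let s : P i ⟶ (sumCover P).obj M := sumCoverι P f - sumCoverι P (0 : P i ⟶ M)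
  have hs : s ≫ (sumCover P).map (0 : M ⟶ 0) = 0 := by
    rw [Preadditive.sub_comp, sumCoverι_map, sumCoverι_map, comp_zero, comp_zero, sub_self]
  have hs' : s ≫ (sumCoverπ P).app M = f := by
    refine (Preadditive.sub_comp _ _ _).trans ?_
    rw [sumCoverι_π, sumCoverι_π, sub_zero]
  have e : f = kernel.lift _ s hs ≫ (coverπ P).app M := by
    refine hs'.symm.trans ?_
    exact (kernel.lift_ι_assoc _ s hs _).symm
  rw [e, Category.assoc, hg, comp_zero]

lemma mono_app_cover [AB4OfSize.{v} 𝓒]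
    (hP : ∀ i, Mono (θ.app (P i))) (M : 𝓒) : Mono (θ.app ((cover P).obj M)) :=
  mono_app_of_mono θ (kernel.ι _) (mono_app_sumCover θ P hP M)

end TorsionFreeCover

section FunctorialResolution

universe v₁ v₂ v₃ u₁ u₂ u₃

variable {C : Type u₁} [Category.{v₁} C] {D : Type u₂} [Category.{v₂} D] {H : Type u₃}
  [Category.{v₃} H] (W : MorphismProperty C) (L : C ⥤ D) [L.IsLocalization W] (F : C ⥤ H)
  {ρ : C ⥤ C} (π : ρ ⟶ 𝟭 C)

/-- The functor induced by `ρ ⋙ F` on a localization, for a functorial resolution `ρ`. -/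
abbrev resolutionDerived (hρ : W.IsInvertedBy (ρ ⋙ F)) : D ⥤ H := Localization.lift (ρ ⋙ F) hρ L

/-- The counit of the left derived functor given by a functorial resolution. -/
def resolutionCounit (hρ : W.IsInvertedBy (ρ ⋙ F)) : L ⋙ resolutionDerived W L F hρ ⟶ F :=
  (Localization.fac (ρ ⋙ F) hρ L).hom ≫ Functor.whiskerRight π F ≫ F.leftUnitor.hom

lemma resolutionCounit_app (hρ : W.IsInvertedBy (ρ ⋙ F)) (X : C) :
    (resolutionCounit W L F π hρ).app X =
      (Localization.fac (ρ ⋙ F) hρ L).hom.app X ≫ F.map (π.app X) := by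
  simp [resolutionCounit]

variable {W L F π}

section

variable (hπ : ∀ X, W (π.app X)) (hρ : W.IsInvertedBy (ρ ⋙ F)) {G : D ⥤ H}

include hπ

lemma isIso_map_resolution (X : C) : IsIso (L.map (π.app X)) :=
  Localization.inverts L W _ (hπ X)

lemma resolutionDerived_hom_ext (h : ∀ X, IsIso (F.map (π.app (ρ.obj X))))
    {γ γ' : G ⟶ resolutionDerived W L F hρ}
    (e : Functor.whiskerLeft L γ ≫ resolutionCounit W L F π hρ =
      Functor.whiskerLeft L γ' ≫ resolutionCounit W L F π hρ) : γ = γ' := by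
  refine Localization.natTrans_ext L W fun X => ?_
  have hX : IsIso (L.map (π.app X)) := isIso_map_resolution hπ X
  have hα : IsIso ((resolutionCounit W L F π hρ).app (ρ.obj X)) := by
    rw [resolutionCounit_app]
    have := h X
    infer_instance
  have eX : γ.app (L.obj (ρ.obj X)) ≫ (resolutionCounit W L F π hρ).app (ρ.obj X) =
      γ'.app (L.obj (ρ.obj X)) ≫ (resolutionCounit W L F π hρ).app (ρ.obj X) :=
    congrArg (fun k => k.app (ρ.obj X)) e
  rw [cancel_mono] at eX
  refine (cancel_epi (G.map (L.map (π.app X)))).1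
    ((γ.naturality _).trans (Eq.trans ?_ (γ'.naturality _).symm))
  rw [eX]

/-- The natural transformation `L ⋙ G ⟶ ρ ⋙ F` induced by `β : L ⋙ G ⟶ F`, using that `L`
inverts the morphisms from the resolutions. -/
def toResolution (β : L ⋙ G ⟶ F) : L ⋙ G ⟶ ρ ⋙ F where
  app X :=
    have := isIso_map_resolution (L := L) hπ X
    inv (G.map (L.map (π.app X))) ≫ β.app (ρ.obj X)
  naturality X Y f := by
    have := isIso_map_resolution (L := L) hπ X
    have := isIso_map_resolution (L := L) hπ Y
    have hβ := β.naturality (ρ.map f)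
    have hf := congrArg (fun k => G.map (L.map k)) (π.naturality f)
    dsimp only [Functor.comp_obj, Functor.comp_map, Functor.id_obj, Functor.id_map] at hβ hf ⊢
    simp only [Functor.map_comp] at hf
    rw [Category.assoc, ← hβ, ← cancel_epi (G.map (L.map (π.app X))),
      IsIso.hom_inv_id_assoc, ← Category.assoc, ← hf, Category.assoc,
      IsIso.hom_inv_id_assoc]

lemma toResolution_app_comp_map (β : L ⋙ G ⟶ F) (X : C) :
    (toResolution hπ β).app X ≫ F.map (π.app X) = β.app X := by
  have := isIso_map_resolution (L := L) hπ X
  change (inv (G.map (L.map (π.app X))) ≫ β.app (ρ.obj X)) ≫ F.map (π.app X) = _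
  rw [Category.assoc, IsIso.inv_comp_eq]
  exact (β.naturality (π.app X)).symm

lemma exists_whiskerLeft_comp_resolutionCounit (β : L ⋙ G ⟶ F) :
    ∃ γ : G ⟶ resolutionDerived W L F hρ,
      Functor.whiskerLeft L γ ≫ resolutionCounit W L F π hρ = β := by
  let φ := Localization.fac (ρ ⋙ F) hρ L
  refine ⟨Localization.liftNatTrans L W (L ⋙ G) (L ⋙ resolutionDerived W L F hρ) G _
    (toResolution hπ β ≫ φ.inv), ?_⟩
  ext X
  refine Eq.trans ?_ (toResolution_app_comp_map hπ β X)
  simp [resolutionCounit_app, φ]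

end

lemma isLeftDerivedFunctor_of_resolution (hπ : ∀ X, W (π.app X)) (hρ : W.IsInvertedBy (ρ ⋙ F))
    (h : ∀ X, IsIso (F.map (π.app (ρ.obj X)))) :
    (resolutionDerived W L F hρ).IsLeftDerivedFunctor (resolutionCounit W L F π hρ) W := by
  choose γ hγ using fun G (β : L ⋙ G ⟶ F) => exists_whiskerLeft_comp_resolutionCounit hπ hρ β
  exact ⟨⟨⟨IsTerminal.ofUniqueHom
    (fun Y => CostructuredArrow.homMk (γ Y.left Y.hom) (hγ Y.left Y.hom)) fun Y m =>
    CostructuredArrow.hom_ext _ _ (resolutionDerived_hom_ext (L := L) hπ hρ h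
      ((CostructuredArrow.w m).trans (hγ Y.left Y.hom).symm))⟩⟩⟩

end FunctorialResolution

section Resolution

open CochainComplex

universe v u

variable {𝓒 : Type u} [Category.{v} 𝓒] [Abelian 𝓒] (T : 𝓒 ⥤ 𝓒) [T.PreservesZeroMorphisms]
  (κ : T ⟶ 𝟭 𝓒)

/-- The morphism of complexes from `T K` to `K` given by a natural transformation `T ⟶ 𝟭`. -/
def coverComplexπ (K : CochainComplex 𝓒 ℤ) :
    (T.mapHomologicalComplex (ComplexShape.up ℤ)).obj K ⟶ K where
  f i := κ.app (K.X i)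
  comm' i j _ := (κ.naturality (K.d i j)).symm

/-- The short exact sequence `0 ⟶ R ⟶ T K ⟶ K ⟶ 0` of complexes. -/
abbrev resolutionSeq (K : CochainComplex 𝓒 ℤ) : ShortComplex (CochainComplex 𝓒 ℤ) :=
  ShortComplex.mk (kernel.ι (coverComplexπ T κ K)) (coverComplexπ T κ K) (kernel.condition _)

lemma resolutionSeq_shortExact (hκ : ∀ M, Epi (κ.app M)) (K : CochainComplex 𝓒 ℤ) :
    (resolutionSeq T κ K).ShortExact where
  exact := ShortComplex.exact_kernel _
  mono_f := inferInstanceAs (Mono (kernel.ι _))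
  epi_g := HomologicalComplex.epi_of_epi_f _ fun i => hκ (K.X i)

lemma coverComplexπ_naturality {K L : CochainComplex 𝓒 ℤ} (f : K ⟶ L) :
    (T.mapHomologicalComplex (ComplexShape.up ℤ)).map f ≫ coverComplexπ T κ L =
      coverComplexπ T κ K ≫ f := by
  ext i
  exact κ.naturality (f.f i)

/-- The functoriality of `resolutionSeq`. -/
abbrev resolutionSeqMap {K L : CochainComplex 𝓒 ℤ} (f : K ⟶ L) :
    resolutionSeq T κ K ⟶ resolutionSeq T κ L where
  τ₁ := kernel.map _ _ ((T.mapHomologicalComplex (ComplexShape.up ℤ)).map f) f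
    (coverComplexπ_naturality T κ f).symm
  τ₂ := (T.mapHomologicalComplex (ComplexShape.up ℤ)).map f
  τ₃ := f
  comm₁₂ := kernel.lift_ι _ _ _
  comm₂₃ := coverComplexπ_naturality T κ f

lemma resolutionSeqMap_id (K : CochainComplex 𝓒 ℤ) : resolutionSeqMap T κ (𝟙 K) = 𝟙 _ := by
  ext : 1
  · rw [← cancel_mono (kernel.ι (coverComplexπ T κ K))]
    refine (kernel.lift_ι _ _ _).trans ?_
    rw [CategoryTheory.Functor.map_id, Category.comp_id]
    exact (Category.id_comp _).symm
  · exact (T.mapHomologicalComplex (ComplexShape.up ℤ)).map_id K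
  · rfl

lemma resolutionSeqMap_comp {K L N : CochainComplex 𝓒 ℤ} (f : K ⟶ L) (g : L ⟶ N) :
    resolutionSeqMap T κ (f ≫ g) = resolutionSeqMap T κ f ≫ resolutionSeqMap T κ g := by
  ext : 1
  · rw [← cancel_mono (kernel.ι (coverComplexπ T κ N))]
    refine (kernel.lift_ι _ _ _).trans ?_
    change _ = (kernel.lift _ _ _ ≫ kernel.lift _ _ _) ≫ _
    rw [Category.assoc, kernel.lift_ι, kernel.lift_ι_assoc, Functor.map_comp, Category.assoc]
  · exact (T.mapHomologicalComplex (ComplexShape.up ℤ)).map_comp f g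
  · rfl

/-- The functorial resolution of complexes given by a natural epimorphism `T ⟶ 𝟭`: the mapping
cone of `R ⟶ T K`. -/
def resolution : CochainComplex 𝓒 ℤ ⥤ CochainComplex 𝓒 ℤ where
  obj K := mappingCone (resolutionSeq T κ K).f
  map f := mappingCone.map _ _ (resolutionSeqMap T κ f).τ₁ (resolutionSeqMap T κ f).τ₂
    (resolutionSeqMap T κ f).comm₁₂.symm
  map_id K := by
    refine Eq.trans ?_ (mappingCone.map_id _)
    congr 1
    · exact congrArg ShortComplex.Hom.τ₁ (resolutionSeqMap_id T κ K)
    · exact congrArg ShortComplex.Hom.τ₂ (resolutionSeqMap_id T κ K)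
  map_comp f g := by
    refine Eq.trans ?_ (mappingCone.map_comp _ _ _ _ _ _ _ _ _)
    congr 1
    · exact congrArg ShortComplex.Hom.τ₁ (resolutionSeqMap_comp T κ f g)
    · exact congrArg ShortComplex.Hom.τ₂ (resolutionSeqMap_comp T κ f g)

/-- The morphism from the resolution of a complex to the complex. -/
def resolutionπ : resolution T κ ⟶ 𝟭 _ where
  app K := mappingCone.descShortComplex (resolutionSeq T κ K)
  naturality _ _ f := mappingCone.map_descShortComplex _ _ (resolutionSeqMap T κ f)

lemma quasiIso_resolutionπ (hκ : ∀ M, Epi (κ.app M)) (K : CochainComplex 𝓒 ℤ) :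
    QuasiIso ((resolutionπ T κ).app K) :=
  mappingCone.quasiIso_descShortComplex (resolutionSeq_shortExact T κ hκ K)

variable (θ : 𝟭 𝓒 ⟶ 𝟭 𝓒)

/-- The terms of the complex have no `θ`-torsion. -/
def IsTorsionFree (K : CochainComplex 𝓒 ℤ) : Prop := ∀ n, Mono (θ.app (K.X n))

variable {θ} in
lemma IsTorsionFree.of_mono {K L : CochainComplex 𝓒 ℤ} (hL : IsTorsionFree θ L) (f : K ⟶ L)
    [Mono f] : IsTorsionFree θ K := fun n =>
  have : Mono (f.f n) :=
    inferInstanceAs (Mono ((HomologicalComplex.eval 𝓒 (ComplexShape.up ℤ) n).map f))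
  mono_app_of_mono θ (f.f n) (hL n)

variable {θ} in
lemma IsTorsionFree.mappingCone {K L : CochainComplex 𝓒 ℤ} (hK : IsTorsionFree θ K)
    (hL : IsTorsionFree θ L) (f : K ⟶ L) : IsTorsionFree θ (mappingCone f) := by
  intro n
  refine Preadditive.mono_of_cancel_zero _ fun {G} (g : G ⟶ (CochainComplex.mappingCone f).X n)
    (hg : g ≫ θ.app ((CochainComplex.mappingCone f).X n) = 0) => ?_
  have hcomp {M : 𝓒} (hM : Mono (θ.app M)) (p : (CochainComplex.mappingCone f).X n ⟶ M) :
      g ≫ p = 0 := by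
    have hp : p ≫ θ.app M = θ.app ((CochainComplex.mappingCone f).X n) ≫ p := θ.naturality p
    refine zero_of_comp_mono (θ.app M) ?_
    rw [Category.assoc, hp, ← Category.assoc, hg, zero_comp]
  exact mappingCone.ext_to f n (n + 1) rfl ((hcomp (hK (n + 1)) _).trans zero_comp.symm)
    ((hcomp (hL n) _).trans zero_comp.symm)

lemma isTorsionFree_resolution (hT : ∀ M, Mono (θ.app (T.obj M))) (K : CochainComplex 𝓒 ℤ) :
    IsTorsionFree θ ((resolution T κ).obj K) := by
  have hTK : IsTorsionFree θ (resolutionSeq T κ K).X₂ := fun n => hT (K.X n)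
  have : Mono (resolutionSeq T κ K).f := inferInstanceAs (Mono (kernel.ι _))
  exact (hTK.of_mono (resolutionSeq T κ K).f).mappingCone hTK _

/-- The endomorphism `θ` of a complex. -/
def thetaMap (K : CochainComplex 𝓒 ℤ) : K ⟶ K where
  f i := θ.app (K.X i)
  comm' i j _ := (θ.naturality (K.d i j)).symm

/-- The complex `K / θ K`. -/
abbrev cokernelComplex (K : CochainComplex 𝓒 ℤ) : CochainComplex 𝓒 ℤ :=
  ((cokernelFunctor θ).mapHomologicalComplex (ComplexShape.up ℤ)).obj K

/-- The projection `K ⟶ K / θ K`. -/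
def toCokernelComplex (K : CochainComplex 𝓒 ℤ) : K ⟶ cokernelComplex θ K where
  f i := cokernel.π (θ.app (K.X i))
  comm' _ _ _ := cokernel.π_desc _ _ _

/-- The sequence `K ⟶ K ⟶ K / θ K`. -/
abbrev thetaSeq (K : CochainComplex 𝓒 ℤ) : ShortComplex (CochainComplex 𝓒 ℤ) :=
  ShortComplex.mk (thetaMap θ K) (toCokernelComplex θ K) (by
    ext i
    exact cokernel.condition (θ.app (K.X i)))

lemma thetaSeq_shortExact {K : CochainComplex 𝓒 ℤ} (hK : IsTorsionFree θ K) :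
    (thetaSeq θ K).ShortExact := by
  refine HomologicalComplex.shortExact_of_degreewise_shortExact _ fun i => ?_
  have := hK i
  exact { exact := ShortComplex.exact_cokernel (θ.app (K.X i))
          mono_f := hK i
          epi_g := inferInstanceAs (Epi (cokernel.π (θ.app (K.X i)))) }

lemma quasiIso_cokernelFunctor {K L : CochainComplex 𝓒 ℤ} (hK : IsTorsionFree θ K)
    (hL : IsTorsionFree θ L) (f : K ⟶ L) (hf : QuasiIso f) :
    QuasiIso (((cokernelFunctor θ).mapHomologicalComplex (ComplexShape.up ℤ)).map f) := by
  let φ : thetaSeq θ K ⟶ thetaSeq θ L :=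
    { τ₁ := f
      τ₂ := f
      τ₃ := ((cokernelFunctor θ).mapHomologicalComplex (ComplexShape.up ℤ)).map f
      comm₁₂ := by
        ext i
        exact θ.naturality (f.f i)
      comm₂₃ := by
        ext i
        exact (cokernel.π_desc _ _ _).symm }
  exact HomologicalComplex.HomologySequence.quasiIso_τ₃ φ (thetaSeq_shortExact θ hK)
    (thetaSeq_shortExact θ hL) hf hf

lemma cyclesMap_thetaMap (K : CochainComplex 𝓒 ℤ) (i : ℤ) :
    HomologicalComplex.cyclesMap (thetaMap θ K) i = θ.app (K.cycles i) := by
  rw [← cancel_mono (K.iCycles i), HomologicalComplex.cyclesMap_i]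
  exact θ.naturality (K.iCycles i)

lemma homologyMap_thetaMap (K : CochainComplex 𝓒 ℤ) (i : ℤ) :
    HomologicalComplex.homologyMap (thetaMap θ K) i = θ.app (K.homology i) := by
  rw [← cancel_epi (K.homologyπ i), HomologicalComplex.homologyπ_naturality, cyclesMap_thetaMap]
  exact (θ.naturality (K.homologyπ i)).symm

lemma isIso_theta_cycles {K : CochainComplex 𝓒 ℤ} (hK : ∀ i, IsIso (θ.app (K.X i))) (i : ℤ) :
    IsIso (θ.app (K.cycles i)) := by
  have : ∀ i, IsIso ((thetaMap θ K).f i) := hK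
  have : IsIso (thetaMap θ K) := HomologicalComplex.Hom.isIso_of_components _
  rw [← cyclesMap_thetaMap]
  exact inferInstanceAs
    (IsIso ((HomologicalComplex.cyclesFunctor 𝓒 (ComplexShape.up ℤ) i).map (thetaMap θ K)))

lemma isIso_theta_homology {K : CochainComplex 𝓒 ℤ} (hK : IsTorsionFree θ K) {i j : ℤ}
    (hij : i + 1 = j) (hi : (cokernelComplex θ K).ExactAt i)
    (hj : (cokernelComplex θ K).ExactAt j) : IsIso (θ.app (K.homology j)) := by
  have hS := thetaSeq_shortExact θ hK
  have h1 := hS.homology_exact₁ i j hij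
  have h2 := hS.homology_exact₂ j
  have hm : Mono (HomologicalComplex.homologyMap (thetaMap θ K) j) :=
    h1.mono_g (hi.isZero_homology.eq_of_src _ _)
  have he : Epi (HomologicalComplex.homologyMap (thetaMap θ K) j) :=
    h2.epi_f (hj.isZero_homology.eq_of_tgt _ _)
  rw [homologyMap_thetaMap] at hm he
  exact isIso_of_mono_of_epi _

end Resolution

section QuotientFunctor

universe v₁ v₂ u₁ u₂

variable {𝓒 : Type u₁} [Category.{v₁} 𝓒] [Abelian 𝓒] (θ : 𝟭 𝓒 ⟶ 𝟭 𝓒)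

instance : PreservesFiniteLimits (annihilated θ).ι := preservesFiniteLimits_ι _
instance : PreservesFiniteColimits (annihilated θ).ι := preservesFiniteColimits_ι _

variable {𝓑 : Type u₂} [Category.{v₂} 𝓑] [Abelian 𝓑] (E : (annihilated θ).FullSubcategory ⥤ 𝓑)
  [E.Additive] [PreservesFiniteLimits E] [PreservesFiniteColimits E]

lemma quasiIso_quotientFunctor_comp {K L : CochainComplex 𝓒 ℤ} (hK : IsTorsionFree θ K)
    (hL : IsTorsionFree θ L) (f : K ⟶ L) (hf : QuasiIso f) :
    QuasiIso (((quotientFunctor θ ⋙ E).mapHomologicalComplex (ComplexShape.up ℤ)).map f) := by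
  let g := ((quotientFunctor θ).mapHomologicalComplex (ComplexShape.up ℤ)).map f
  have hg : QuasiIso (((annihilated θ).ι.mapHomologicalComplex (ComplexShape.up ℤ)).map g) :=
    quasiIso_cokernelFunctor θ hK hL f hf
  rw [HomologicalComplex.quasiIso_map_iff_of_preservesHomology] at hg
  exact inferInstanceAs (QuasiIso ((E.mapHomologicalComplex (ComplexShape.up ℤ)).map g))

lemma exactAt_quotientFunctor_comp_iff [E.Faithful] (K : CochainComplex 𝓒 ℤ) (i : ℤ) :
    (((quotientFunctor θ ⋙ E).mapHomologicalComplex (ComplexShape.up ℤ)).obj K).ExactAt i ↔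
      (cokernelComplex θ K).ExactAt i := by
  let S := (((quotientFunctor θ).mapHomologicalComplex (ComplexShape.up ℤ)).obj K).sc i
  have hE : (S.map E).Exact ↔ S.Exact := S.exact_map_iff_of_faithful E
  have hι : (S.map (annihilated θ).ι).Exact ↔ S.Exact := S.exact_map_iff_of_faithful _
  exact hE.trans hι.symm

end QuotientFunctor

section Derived

variable {𝓒 𝓑 : Type 1} [Category.{0} 𝓒] [Abelian 𝓒] [Category.{0} 𝓑] [Abelian 𝓑]
  {T : 𝓒 ⥤ 𝓒} [T.PreservesZeroMorphisms] {κ : T ⟶ 𝟭 𝓒} (hκ : ∀ M, Epi (κ.app M))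
  {θ : 𝟭 𝓒 ⟶ 𝟭 𝓒} (hT : ∀ M, Mono (θ.app (T.obj M)))
  (E : (annihilated θ).FullSubcategory ⥤ 𝓑) [E.Additive] [PreservesFiniteLimits E]
  [PreservesFiniteColimits E] [HasDerivedCategory.{w} 𝓑]

include hκ hT

lemma isInvertedBy_resolution_comp :
    (HomologicalComplex.quasiIso 𝓒 (ComplexShape.up ℤ)).IsInvertedBy
      (resolution T κ ⋙ onComplexes (quotientFunctor θ ⋙ E)) := by
  intro K L f (hf : QuasiIso f)
  have := quasiIso_resolutionπ T κ hκ K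
  have := quasiIso_resolutionπ T κ hκ L
  have e : (resolution T κ).map f ≫ (resolutionπ T κ).app L = (resolutionπ T κ).app K ≫ f :=
    (resolutionπ T κ).naturality f
  have : QuasiIso ((resolution T κ).map f ≫ (resolutionπ T κ).app L) := by
    rw [e]
    infer_instance
  exact (DerivedCategory.isIso_Q_map_iff_quasiIso _ _).2
    (quasiIso_quotientFunctor_comp θ E (isTorsionFree_resolution T κ θ hT K)
      (isTorsionFree_resolution T κ θ hT L) _ (quasiIso_of_comp_right _ ((resolutionπ T κ).app L)))

lemma isIso_onComplexes_resolutionπ (K : CochainComplex 𝓒 ℤ) :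
    IsIso ((onComplexes (quotientFunctor θ ⋙ E)).map
      ((resolutionπ T κ).app ((resolution T κ).obj K))) :=
  (DerivedCategory.isIso_Q_map_iff_quasiIso _ _).2
    (quasiIso_quotientFunctor_comp θ E (isTorsionFree_resolution T κ θ hT _)
      (isTorsionFree_resolution T κ θ hT _) _ (quasiIso_resolutionπ T κ hκ _))

variable [HasDerivedCategory.{w} 𝓒]

lemma isLeftDerivedFunctor_resolution :
    (resolutionDerived _ DerivedCategory.Q _
      (isInvertedBy_resolution_comp hκ hT E)).IsLeftDerivedFunctor
      (resolutionCounit _ _ _ (resolutionπ T κ) _)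
        (HomologicalComplex.quasiIso 𝓒 (ComplexShape.up ℤ)) :=
  isLeftDerivedFunctor_of_resolution (fun K => quasiIso_resolutionπ T κ hκ K) _
    (isIso_onComplexes_resolutionπ hκ hT E)

lemma hasLeftDerived_quotientFunctor_comp : HasLeftDerived.{w} (quotientFunctor θ ⋙ E) := by
  have := isLeftDerivedFunctor_resolution hκ hT E
  exact Functor.HasLeftDerivedFunctor.mk' _ (resolutionCounit _ DerivedCategory.Q _
    (resolutionπ T κ) (isInvertedBy_resolution_comp hκ hT E))

lemma nonempty_leftDerived_iso [HasLeftDerived.{w} (quotientFunctor θ ⋙ E)]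
    (K : CochainComplex 𝓒 ℤ) :
    Nonempty ((leftDerived (quotientFunctor θ ⋙ E)).obj (DerivedCategory.Q.obj K) ≅
      (onComplexes (quotientFunctor θ ⋙ E)).obj ((resolution T κ).obj K)) := by
  have := isLeftDerivedFunctor_resolution hκ hT E
  let F := onComplexes (quotientFunctor θ ⋙ E)
  let W := HomologicalComplex.quasiIso 𝓒 (ComplexShape.up ℤ)
  let hρ : W.IsInvertedBy (resolution T κ ⋙ F) := isInvertedBy_resolution_comp hκ hT E
  let e := Functor.leftDerivedNatIso (leftDerived (quotientFunctor θ ⋙ E)) _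
    (F.totalLeftDerivedCounit DerivedCategory.Q W)
    (resolutionCounit W DerivedCategory.Q F (resolutionπ T κ) hρ) W (Iso.refl _)
  exact ⟨e.app _ ≪≫ (Localization.fac (resolution T κ ⋙ F) hρ DerivedCategory.Q).app K⟩

lemma exists_isIso_theta_homology [HasLeftDerived.{w} (quotientFunctor θ ⋙ E)] [E.Faithful]
    (K : CochainComplex 𝓒 ℤ)
    (hK : IsBounded ((leftDerived (quotientFunctor θ ⋙ E)).obj (DerivedCategory.Q.obj K))) :
    ∃ p q : ℤ, ∀ i, (i < p ∨ q < i) → IsIso (θ.app (K.homology i)) := by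
  obtain ⟨e⟩ := nonempty_leftDerived_iso hκ hT E K
  obtain ⟨⟨p, hp⟩, ⟨q, hq⟩⟩ := ObjectProperty.prop_of_iso _ e hK
  have hp' := (DerivedCategory.isGE_Q_obj_iff _ p).1 hp
  have hq' := (DerivedCategory.isLE_Q_obj_iff _ q).1 hq
  let P := (resolution T κ).obj K
  have hP (i : ℤ) (hi : i < p ∨ q < i) : (cokernelComplex θ P).ExactAt i := by
    rw [← exactAt_quotientFunctor_comp_iff θ E]
    rcases hi with hi | hi
    · exact CochainComplex.exactAt_of_isGE _ p i hi
    · exact CochainComplex.exactAt_of_isLE _ q i hi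
  refine ⟨p, q + 1, fun i hi => ?_⟩
  have := quasiIso_resolutionπ T κ hκ K
  let f : P.homology i ≅ K.homology i :=
    asIso (HomologicalComplex.homologyMap ((resolutionπ T κ).app K) i)
  exact isIso_app_of_iso θ f (isIso_theta_homology θ (isTorsionFree_resolution T κ θ hT K)
    (Int.sub_add_cancel i 1) (hP _ (by lia)) (hP _ (by lia)))

lemma exists_isIso_theta_homologyFunctor [HasLeftDerived.{w} (quotientFunctor θ ⋙ E)] [E.Faithful]
    (M : DerivedCategory 𝓒) (hM : IsBounded ((leftDerived (quotientFunctor θ ⋙ E)).obj M)) :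
    ∃ p q : ℤ, ∀ i, (i < p ∨ q < i) →
      IsIso (θ.app ((DerivedCategory.homologyFunctor 𝓒 i).obj M)) := by
  let K := DerivedCategory.Q.objPreimage M
  let e : DerivedCategory.Q.obj K ≅ M := DerivedCategory.Q.objObjPreimageIso M
  obtain ⟨p, q, h⟩ := exists_isIso_theta_homology hκ hT E K
    (ObjectProperty.prop_of_iso _ ((leftDerived (quotientFunctor θ ⋙ E)).mapIso e).symm hM)
  let eH (i : ℤ) : K.homology i ≅ (DerivedCategory.homologyFunctor 𝓒 i).obj M :=
    ((DerivedCategory.homologyFunctorFactors 𝓒 i).app K).symm ≪≫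
      (DerivedCategory.homologyFunctor 𝓒 i).mapIso e
  exact ⟨p, q, fun i hi => isIso_app_of_iso θ (eH i) (h i hi)⟩

end Derived

section InvertTheta

universe v u

variable {𝓒 : Type u} [Category.{v} 𝓒] (θ : 𝟭 𝓒 ⟶ 𝟭 𝓒)

/-- The sequence `M ⟶ M ⟶ ⋯` whose transition morphisms are `θ`. -/
abbrev thetaDiagram : 𝓒 ⥤ ℕ ⥤ 𝓒 where
  obj M := Functor.ofSequence (X := fun _ => M) (fun _ => θ.app M)
  map {M N} f := NatTrans.ofSequence (F := Functor.ofSequence (X := fun _ => M) (fun _ => θ.app M))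
    (G := Functor.ofSequence (X := fun _ => N) (fun _ => θ.app N)) (fun _ => f) (fun n => by
      rw [Functor.ofSequence_map_homOfLE_succ, Functor.ofSequence_map_homOfLE_succ]
      exact (θ.naturality f).symm)

variable [HasColimitsOfShape ℕ 𝓒]

/-- The functor inverting `θ`: the colimit of `M ⟶ M ⟶ ⋯`. -/
abbrev invertTheta : 𝓒 ⥤ 𝓒 := thetaDiagram θ ⋙ colim

variable {θ} in
/-- The `n`-th inclusion of `M` in the colimit of `M ⟶ M ⟶ ⋯`. -/
def invertThetaι (M : 𝓒) (n : ℕ) : M ⟶ (invertTheta θ).obj M :=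
  colimit.ι ((thetaDiagram θ).obj M) n

lemma theta_invertThetaι (M : 𝓒) (n : ℕ) :
    θ.app M ≫ invertThetaι (θ := θ) M (n + 1) = invertThetaι M n := by
  have h := colimit.w ((thetaDiagram θ).obj M) (homOfLE (Nat.le_add_right n 1))
  rw [Functor.ofSequence_map_homOfLE_succ] at h
  exact h

variable {θ} in
lemma invertTheta_hom_ext {M N : 𝓒} {f g : (invertTheta θ).obj M ⟶ N}
    (h : ∀ n, invertThetaι M n ≫ f = invertThetaι M n ≫ g) : f = g :=
  colimit.hom_ext h

lemma exists_invertTheta_desc {M N : 𝓒} (f : ℕ → (M ⟶ N)) (hf : ∀ n, θ.app M ≫ f (n + 1) = f n) :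
    ∃ g : (invertTheta θ).obj M ⟶ N, ∀ n, invertThetaι M n ≫ g = f n := by
  let c : Cocone ((thetaDiagram θ).obj M) := ⟨N,
    NatTrans.ofSequence (F := (thetaDiagram θ).obj M) (G := (Functor.const ℕ).obj N) f
      (fun n => by
        rw [Functor.ofSequence_map_homOfLE_succ]
        exact (hf n).trans (Category.comp_id _).symm)⟩
  exact ⟨colimit.desc _ c, fun n => colimit.ι_desc c n⟩

/-- The morphism from `M` to the colimit of `M ⟶ M ⟶ ⋯`. -/
def toInvertTheta : 𝟭 𝓒 ⟶ invertTheta θ where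
  app M := invertThetaι M 0
  naturality _ _ f := (colimit.ι_map ((thetaDiagram θ).map f) 0).symm

lemma isIso_theta_invertTheta (M : 𝓒) : IsIso (θ.app ((invertTheta θ).obj M)) := by
  obtain ⟨s, hs⟩ := exists_invertTheta_desc θ (fun n => invertThetaι (θ := θ) M (n + 1))
    fun n => theta_invertThetaι θ M (n + 1)
  have nat (n : ℕ) : invertThetaι M n ≫ θ.app ((invertTheta θ).obj M) =
      θ.app M ≫ invertThetaι M n := θ.naturality (invertThetaι M n)
  refine ⟨s, invertTheta_hom_ext fun n => ?_, invertTheta_hom_ext fun n => ?_⟩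
  · rw [← Category.assoc, nat, Category.assoc, hs, theta_invertThetaι]
    exact (Category.comp_id _).symm
  · rw [← Category.assoc, hs, nat, theta_invertThetaι]
    exact (Category.comp_id _).symm

lemma isIso_toInvertTheta (M : 𝓒) [IsIso (θ.app M)] : IsIso ((toInvertTheta θ).app M) := by
  let f (n : ℕ) : M ⟶ M := n.rec (𝟙 M) fun _ g => inv (θ.app M) ≫ g
  have hf (n : ℕ) : θ.app M ≫ f (n + 1) = f n := IsIso.hom_inv_id_assoc _ _
  have hf' (n : ℕ) : f n ≫ invertThetaι (θ := θ) M 0 = invertThetaι M n := by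
    induction n with
    | zero => exact Category.id_comp _
    | succ n ih =>
      rw [← cancel_epi (θ.app M), ← Category.assoc, hf, ih, theta_invertThetaι]
  obtain ⟨s, hs⟩ := exists_invertTheta_desc θ f hf
  refine ⟨s, hs 0, invertTheta_hom_ext fun n => ?_⟩
  rw [← Category.assoc, hs]
  exact (hf' n).trans (Category.comp_id _).symm

end InvertTheta

section InvertThetaExact

universe v u

variable {𝓒 : Type u} [Category.{v} 𝓒] [Abelian 𝓒] (θ : 𝟭 𝓒 ⟶ 𝟭 𝓒) [HasColimitsOfShape ℕ 𝓒]

instance : PreservesFiniteLimits (thetaDiagram θ) :=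
  preservesFiniteLimits_of_evaluation _ fun _ => inferInstanceAs (PreservesFiniteLimits (𝟭 𝓒))

instance : PreservesFiniteColimits (thetaDiagram θ) :=
  preservesFiniteColimits_of_evaluation _ fun _ => inferInstanceAs (PreservesFiniteColimits (𝟭 𝓒))

variable [HasExactColimitsOfShape ℕ 𝓒]

instance : PreservesFiniteLimits (invertTheta θ) := by
  have : PreservesFiniteLimits (colim (J := ℕ) (C := 𝓒)) :=
    HasExactColimitsOfShape.preservesFiniteLimits
  exact comp_preservesFiniteLimits _ _

instance : PreservesFiniteColimits (invertTheta θ) := comp_preservesFiniteColimits _ _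

/-- The complex obtained by inverting `θ`. -/
abbrev invertComplex (N : CochainComplex 𝓒 ℤ) : CochainComplex 𝓒 ℤ :=
  ((invertTheta θ).mapHomologicalComplex (ComplexShape.up ℤ)).obj N

/-- The morphism from a complex to the complex obtained by inverting `θ`. -/
def toInvertComplex (N : CochainComplex 𝓒 ℤ) : N ⟶ invertComplex θ N where
  f i := (toInvertTheta θ).app (N.X i)
  comm' i j _ := ((toInvertTheta θ).naturality (N.d i j)).symm

lemma quasiIso_toInvertComplex {N : CochainComplex 𝓒 ℤ}
    (hN : ∀ i, IsIso (θ.app (N.homology i))) : QuasiIso (toInvertComplex θ N) where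
  quasiIsoAt i := by
    rw [quasiIsoAt_iff_isIso_homologyMap]
    have h := (N.sc i).homologyMap_mapNatTrans (toInvertTheta θ)
    have := hN i
    have : IsIso ((toInvertTheta θ).app (N.sc i).homology) := isIso_toInvertTheta θ (N.homology i)
    have h2 : IsIso (ShortComplex.homologyMap ((N.sc i).mapNatTrans (toInvertTheta θ))) := by
      rw [h]
      infer_instance
    exact h2

end InvertThetaExact

section SingleFunctor

open DerivedCategory

universe v u

variable {𝓒 : Type u} [Category.{v} 𝓒] [Abelian 𝓒]

lemma comp_homologyπ_eq_zero {K : CochainComplex 𝓒 ℤ} {i : ℤ} {L : 𝓒} (u : L ⟶ K.cycles i)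
    (h : HomologicalComplex.homologyMap (HomologicalComplex.mkHomFromSingle
      (c := ComplexShape.up ℤ) (u ≫ K.iCycles i) (fun k _ => by simp)) i = 0) :
    u ≫ K.homologyπ i = 0 := by
  let s := HomologicalComplex.mkHomFromSingle (c := ComplexShape.up ℤ) (u ≫ K.iCycles i)
    (fun k _ => by simp)
  let w := (HomologicalComplex.singleObjCyclesSelfIso (ComplexShape.up ℤ) i L).inv
  have hw : w ≫ HomologicalComplex.cyclesMap s i = u := by
    rw [← cancel_mono (K.iCycles i), Category.assoc, HomologicalComplex.cyclesMap_i,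
      HomologicalComplex.mkHomFromSingle_f]
    simp [w]
  rw [← hw, Category.assoc, ← HomologicalComplex.homologyπ_naturality, h, comp_zero, comp_zero]

variable [HasDerivedCategory.{w} 𝓒]

lemma homologyMap_eq_zero_of_map_Q {K L : CochainComplex 𝓒 ℤ} (f : K ⟶ L) (i : ℤ)
    (h : (homologyFunctor 𝓒 i).map (Q.map f) = 0) : HomologicalComplex.homologyMap f i = 0 := by
  have hf := (homologyFunctorFactors 𝓒 i).hom.naturality f
  rw [show (Q ⋙ homologyFunctor 𝓒 i).map f = 0 from h, zero_comp] at hf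
  exact (cancel_epi ((homologyFunctorFactors 𝓒 i).hom.app K)).1 (hf.symm.trans comp_zero.symm)

lemma eq_zero_of_shift_eq_zero {X M : DerivedCategory 𝓒} (n : ℤ)
    (h : ∀ v : X⟦n⟧ ⟶ M⟦n⟧, v = 0) (u : X ⟶ M) : u = 0 :=
  (shiftFunctor (DerivedCategory 𝓒) n).map_injective ((h _).trans (h _).symm)

lemma hom_single_eq_zero {X : 𝓒} {M : DerivedCategory 𝓒}
    (hM : ∀ (n : ℤ) (u : (singleFunctor 𝓒 0).obj X ⟶ M⟦n⟧), u = 0) (i : ℤ)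
    (u : (singleFunctor 𝓒 i).obj X ⟶ M) : u = 0 := by
  refine eq_zero_of_shift_eq_zero i (fun v => ?_) u
  let e := ((singleFunctors 𝓒).shiftIso i 0 i (add_zero i)).app X
  exact (cancel_epi e.inv).1 ((hM _ _).trans (hM _ _).symm)

lemma hom_single_single_eq_zero {X Y : 𝓒} {d : ℕ}
    (h : ∀ n : ℕ, d ≤ n → ∀ u : (singleFunctor 𝓒 0).obj X ⟶ ((singleFunctor 𝓒 0).obj Y)⟦(n : ℤ)⟧,
      u = 0) {i t : ℤ} (hi : t + d ≤ i)
    (u : (singleFunctor 𝓒 i).obj X ⟶ (singleFunctor 𝓒 t).obj Y) : u = 0 := by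
  refine eq_zero_of_shift_eq_zero i (fun v => ?_) u
  obtain ⟨n, hn⟩ := Int.eq_ofNat_of_zero_le (show 0 ≤ i - t by lia)
  let e := ((singleFunctors 𝓒).shiftIso i 0 i (add_zero i)).app X
  let e₁ := ((singleFunctors 𝓒).shiftIso i (t - i) t (by lia)).app Y
  let e₂ := ((singleFunctors 𝓒).shiftIso (n : ℤ) (t - i) 0 (by lia)).app Y
  have h0 : e.inv ≫ v ≫ e₁.hom ≫ e₂.inv = 0 := h n (by lia) _
  refine (cancel_epi e.inv).1 ((cancel_mono (e₁.hom ≫ e₂.inv)).1 ?_)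
  rw [Category.assoc, h0, comp_zero, zero_comp]

end SingleFunctor

section Truncation

open DerivedCategory Pretriangulated

universe v u

variable {𝓒 : Type u} [Category.{v} 𝓒] [Abelian 𝓒] [HasDerivedCategory.{w} 𝓒]

lemma isIso_homologyFunctor_map_truncLTι (M : DerivedCategory 𝓒) {n i : ℤ} (hi : i < n) :
    IsIso ((homologyFunctor 𝓒 i).map ((TStructure.t.truncLTι n).app M)) := by
  let T := (TStructure.t.triangleLTGE n).obj M
  have hT : T ∈ distTriang _ := TStructure.t.triangleLTGE_distinguished n M
  have hB : T.obj₃.IsGE n := inferInstance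
  have : Mono ((homologyFunctor 𝓒 i).map T.mor₁) :=
    (HomologySequence.mono_homologyMap_mor₁_iff _ hT (i - 1) i).2
      ((isZero_of_isGE T.obj₃ n (i - 1) (by lia)).eq_of_src _ _)
  have : Epi ((homologyFunctor 𝓒 i).map T.mor₁) :=
    (HomologySequence.epi_homologyMap_mor₁_iff _ hT i).2
      ((isZero_of_isGE T.obj₃ n i hi).eq_of_tgt _ _)
  exact isIso_of_mono_of_epi ((homologyFunctor 𝓒 i).map T.mor₁)

lemma isIso_homologyFunctor_map_truncGEπ (M : DerivedCategory 𝓒) {n i : ℤ} (hi : n ≤ i) :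
    IsIso ((homologyFunctor 𝓒 i).map ((TStructure.t.truncGEπ n).app M)) := by
  let T := (TStructure.t.triangleLTGE n).obj M
  have hT : T ∈ distTriang _ := TStructure.t.triangleLTGE_distinguished n M
  have hA : T.obj₁.IsLE (n - 1) := inferInstance
  have : Mono ((homologyFunctor 𝓒 i).map T.mor₂) :=
    (HomologySequence.mono_homologyMap_mor₂_iff _ hT i).2
      ((isZero_of_isLE T.obj₁ (n - 1) i (by lia)).eq_of_src _ _)
  have : Epi ((homologyFunctor 𝓒 i).map T.mor₂) :=
    (HomologySequence.epi_homologyMap_mor₂_iff _ hT i (i + 1)).2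
      ((isZero_of_isLE T.obj₁ (n - 1) (i + 1) (by lia)).eq_of_tgt _ _)
  exact isIso_of_mono_of_epi ((homologyFunctor 𝓒 i).map T.mor₂)

lemma hom_single_eq_zero_of_isGE_of_isLE {X : 𝓒} {d : ℕ}
    (h : ∀ (Y : 𝓒) (n : ℕ), d ≤ n →
      ∀ u : (singleFunctor 𝓒 0).obj X ⟶ ((singleFunctor 𝓒 0).obj Y)⟦(n : ℤ)⟧, u = 0)
    {p q i : ℤ} (hpq : p ≤ q) (hi : q + d ≤ i) (Y : DerivedCategory 𝓒) [Y.IsGE p] [Y.IsLE q]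
    (u : (singleFunctor 𝓒 i).obj X ⟶ Y) : u = 0 := by
  induction q, hpq using Int.leInduction generalizing Y with
  | base =>
    obtain ⟨Z, ⟨e⟩⟩ := exists_iso_singleFunctor_obj_of_isGE_of_isLE Y p
    rw [← cancel_mono e.hom, zero_comp]
    exact hom_single_single_eq_zero (h Z) hi _
  | succ q _ ih =>
    let B := (TStructure.t.truncGE (q + 1)).obj Y
    have : B.IsGE (q + 1) := inferInstance
    have : B.IsLE (q + 1) := inferInstance
    let A := (TStructure.t.truncLT (q + 1)).obj Y
    have : A.IsGE p := inferInstance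
    have : A.IsLE q := inferInstance
    obtain ⟨Z, ⟨e⟩⟩ := exists_iso_singleFunctor_obj_of_isGE_of_isLE B (q + 1)
    have hu : u ≫ (TStructure.t.truncGEπ (q + 1)).app Y = 0 := by
      rw [← cancel_mono e.hom, zero_comp]
      exact hom_single_single_eq_zero (h Z) hi _
    obtain ⟨v, hv⟩ := Triangle.coyoneda_exact₂ _
      (TStructure.t.triangleLTGE_distinguished (q + 1) Y) u hu
    rw [hv, ih (by lia) A v]
    exact zero_comp

end Truncation

section Boundedness

open DerivedCategory Pretriangulated

universe v u

variable {𝓒 : Type u} [Category.{v} 𝓒]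

/-- The objects `L b` detect the nonzero morphisms from the objects on which `θ` is invertible. -/
def DetectsInverted [HasZeroMorphisms 𝓒] (θ : 𝟭 𝓒 ⟶ 𝟭 𝓒) {ι : Type*} (L : ι → 𝓒) : Prop :=
  ∀ ⦃Z H : 𝓒⦄ (φ : Z ⟶ H), IsIso (θ.app Z) → (∀ b (u : L b ⟶ Z), u ≫ φ = 0) → φ = 0

variable [Abelian 𝓒] [HasDerivedCategory.{w} 𝓒] [HasColimitsOfShape ℕ 𝓒]
  [HasExactColimitsOfShape ℕ 𝓒] {θ : 𝟭 𝓒 ⟶ 𝟭 𝓒} {ι : Type*} {L : ι → 𝓒}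

lemma DetectsInverted.isZero_homology (hL : DetectsInverted θ L) (N : DerivedCategory 𝓒)
    (hN : ∀ i, IsIso (θ.app ((homologyFunctor 𝓒 i).obj N))) (i : ℤ)
    (h : ∀ b (u : (singleFunctor 𝓒 i).obj (L b) ⟶ N), (homologyFunctor 𝓒 i).map u = 0) :
    IsZero ((homologyFunctor 𝓒 i).obj N) := by
  let K := Q.objPreimage N
  let e : Q.obj K ≅ N := Q.objObjPreimageIso N
  let eH (j : ℤ) : K.homology j ≅ (homologyFunctor 𝓒 j).obj N :=
    ((homologyFunctorFactors 𝓒 j).app K).symm ≪≫ (homologyFunctor 𝓒 j).mapIso e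
  have := quasiIso_toInvertComplex θ fun j => isIso_app_of_iso θ (eH j).symm (hN j)
  let K' := invertComplex θ K
  let e' : Q.obj K' ≅ N := (asIso (Q.map (toInvertComplex θ K))).symm ≪≫ e
  have hπ : K'.homologyπ i = 0 := by
    refine hL _ (isIso_theta_cycles θ (fun j => isIso_theta_invertTheta θ (K.X j)) i) fun b u =>
      comp_homologyπ_eq_zero u (homologyMap_eq_zero_of_map_Q _ i ?_)
    let a : (singleFunctor 𝓒 i).obj (L b) ≅
        Q.obj ((HomologicalComplex.single 𝓒 (ComplexShape.up ℤ) i).obj (L b)) :=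
      (singleFunctorIsoCompQ 𝓒 i).app (L b)
    have hu := h b (a.hom ≫
      Q.map (HomologicalComplex.mkHomFromSingle (u ≫ K'.iCycles i) (fun k _ => by simp)) ≫ e'.hom)
    rw [Functor.map_comp, Functor.map_comp] at hu
    exact (Preadditive.IsIso.comp_right_eq_zero _ _).1
      ((Preadditive.IsIso.comp_left_eq_zero _ _).1 hu)
  have hK' : IsZero (K'.homology i) := by
    rw [IsZero.iff_id_eq_zero, ← cancel_epi (K'.homologyπ i), hπ, zero_comp, zero_comp]
  exact hK'.of_iso ((eH i).symm ≪≫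
    asIso (HomologicalComplex.homologyMap (toInvertComplex θ K) i))

variable {M : DerivedCategory 𝓒}

lemma DetectsInverted.isGE (hL : DetectsInverted θ L)
    (hM : ∀ b (n : ℤ) (u : (singleFunctor 𝓒 0).obj (L b) ⟶ M⟦n⟧), u = 0) {p : ℤ}
    (hp : ∀ i < p, IsIso (θ.app ((homologyFunctor 𝓒 i).obj M))) : M.IsGE p := by
  let A := (TStructure.t.truncLT p).obj M
  let f : A ⟶ M := (TStructure.t.truncLTι p).app M
  have hA : A.IsLE (p - 1) := inferInstance
  have hf (i : ℤ) (hi : i < p) : IsIso ((homologyFunctor 𝓒 i).map f) :=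
    isIso_homologyFunctor_map_truncLTι M hi
  have hθ (i : ℤ) : IsIso (θ.app ((homologyFunctor 𝓒 i).obj A)) := by
    rcases lt_or_ge i p with hi | hi
    · have := hf i hi
      exact isIso_app_of_iso θ (asIso ((homologyFunctor 𝓒 i).map f)).symm (hp i hi)
    · exact isIso_app_of_isZero θ (isZero_of_isLE A (p - 1) i (by lia))
  refine (isGE_iff _ _).2 fun i hi => ?_
  have := hf i hi
  refine (hL.isZero_homology A hθ i fun b u => ?_).of_iso
    (asIso ((homologyFunctor 𝓒 i).map f)).symm
  rw [← cancel_mono ((homologyFunctor 𝓒 i).map f), ← Functor.map_comp,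
    hom_single_eq_zero (hM b) i (u ≫ f), Functor.map_zero, zero_comp]

lemma DetectsInverted.isLE (hL : DetectsInverted θ L)
    (hM : ∀ b (n : ℤ) (u : (singleFunctor 𝓒 0).obj (L b) ⟶ M⟦n⟧), u = 0) {d : ℕ}
    (hext : ∀ b (Y : 𝓒) (n : ℕ), d ≤ n →
      ∀ u : (singleFunctor 𝓒 0).obj (L b) ⟶ ((singleFunctor 𝓒 0).obj Y)⟦(n : ℤ)⟧, u = 0)
    {p q : ℤ} (hpq : p ≤ q) [hMp : M.IsGE p]
    (hq : ∀ i > q, IsIso (θ.app ((homologyFunctor 𝓒 i).obj M))) : M.IsLE (q + d) := by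
  let A := (TStructure.t.truncLT (q + 1)).obj M
  let B := (TStructure.t.truncGE (q + 1)).obj M
  let g : M ⟶ B := (TStructure.t.truncGEπ (q + 1)).app M
  have hB : B.IsGE (q + 1) := inferInstance
  have hg (i : ℤ) (hi : q < i) : IsIso ((homologyFunctor 𝓒 i).map g) :=
    isIso_homologyFunctor_map_truncGEπ M hi
  have hθ (i : ℤ) : IsIso (θ.app ((homologyFunctor 𝓒 i).obj B)) := by
    rcases lt_or_ge q i with hi | hi
    · have := hg i hi
      exact isIso_app_of_iso θ (asIso ((homologyFunctor 𝓒 i).map g)) (hq i hi)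
    · exact isIso_app_of_isZero θ (isZero_of_isGE B (q + 1) i (by lia))
  have hAp : A.IsGE p := inferInstance
  have hAq : A.IsLE q := inferInstance
  have : TStructure.t.IsGE (A⟦(1 : ℤ)⟧) (p - 1) := TStructure.t.isGE_shift A p 1 (p - 1)
  have : TStructure.t.IsLE (A⟦(1 : ℤ)⟧) (q - 1) := TStructure.t.isLE_shift A q 1 (q - 1)
  refine (isLE_iff _ _).2 fun i hi => ?_
  have := hg i (by lia)
  refine (hL.isZero_homology B hθ i fun b u => ?_).of_iso (asIso ((homologyFunctor 𝓒 i).map g))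
  have hδ : u ≫ (TStructure.t.truncGEδLT (q + 1)).app M = 0 :=
    hom_single_eq_zero_of_isGE_of_isLE (hext b) (p := p - 1) (q := q - 1) (by lia) (by lia)
      (A⟦(1 : ℤ)⟧) _
  obtain ⟨v, hv⟩ := Triangle.coyoneda_exact₃ _
    (TStructure.t.triangleLTGE_distinguished (q + 1) M) u hδ
  rw [hv, hom_single_eq_zero (hM b) i v]
  exact (congrArg _ zero_comp).trans ((homologyFunctor 𝓒 i).map_zero _ _)

lemma DetectsInverted.bounded (hL : DetectsInverted θ L)
    (hM : ∀ b (n : ℤ) (u : (singleFunctor 𝓒 0).obj (L b) ⟶ M⟦n⟧), u = 0) {d : ℕ}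
    (hext : ∀ b (Y : 𝓒) (n : ℕ), d ≤ n →
      ∀ u : (singleFunctor 𝓒 0).obj (L b) ⟶ ((singleFunctor 𝓒 0).obj Y)⟦(n : ℤ)⟧, u = 0)
    {p q : ℤ} (hpq : ∀ i, (i < p ∨ q < i) → IsIso (θ.app ((homologyFunctor 𝓒 i).obj M))) :
    TStructure.t.bounded M := by
  have : M.IsGE p := hL.isGE hM fun i hi => hpq i (.inl hi)
  have : M.IsLE (max p q + d) := hL.isLE hM hext (le_max_left p q) fun i hi =>
    hpq i (.inr ((le_max_right p q).trans_lt hi))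
  exact ⟨⟨p, ‹_›⟩, ⟨_, ‹_›⟩⟩

end Boundedness

section Detection

variable {C : Type} [SmallCategory C] {K : GrothendieckTopology C}
  {A : LocallyDiscrete Cᵒᵖ ⥤ᵖ Cat.{0, 0}} [LinearPrestack A]

lemma eq_zero_of_freeMod_comp {M N : AMod K A} (g : M ⟶ N)
    (h : ∀ (a : Tot A) (f : freeMod K a ⟶ M), f ≫ g = 0) : g = 0 :=
  hom_eq_zero_of_onSections g fun a s => by
    have h' := congrArg (fun u => onSections u a (freeGen K a)) (h a (freeDesc s))
    rw [onSections_comp, onSections_freeDesc] at h'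
    exact h'.trans (onSections_zero a _)

lemma detectsInverted_locModule : DetectsInverted (hbarMap K A) (locModule K) := by
  intro Z H φ hZ h
  refine hom_eq_zero_of_onSections φ fun a z => ?_
  let g : Z ⟶ Z := inv ((hbarMap K A).app Z)
  have hg (t : sections Z a) : hbar • onSections g a t = t := by
    rw [← onSections_hbarMap, ← onSections_comp]
    exact congrArg (fun u => onSections u a t) (IsIso.inv_hom_id ((hbarMap K A).app Z))
  let s (n : ℕ) : sections Z a := n.rec z fun _ t => onSections g a t
  have hs (n : ℕ) : hbar • s (n + 1) = s n := hg (s n)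
  have h0 : onSections (locDesc s hs) a (locGen K a 0) = z := onSections_locDesc s hs 0
  have h1 := congrArg (fun u => onSections u a (locGen K a 0)) (h a (locDesc s hs))
  rw [onSections_comp, h0] at h1
  exact h1.trans (onSections_zero a _)

end Detection

section VanishingBound

open TopologicalSpace Abelian

variable {X : Type} [TopologicalSpace X] [NoetherianSpace X] [QuasiSober X] [T0Space X]
  {A : LocallyDiscrete (Opens X)ᵒᵖ ⥤ᵖ Cat.{0, 0}} [LinearPrestack A]

lemma exists_hom_locModule_eq_zero (hX : topologicalKrullDim X < ⊤)
    (hA : ∀ (U : (Opens X)ᵒᵖ) (σ τ : A.obj ⟨U⟩) (φ : σ ⟶ τ), hbar • φ = 0 → φ = 0)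
    [HasDerivedCategory.{w} (AMod (Opens.grothendieckTopology X) A)] :
    ∃ d : ℕ, ∀ (a : Tot A) (Y : AMod (Opens.grothendieckTopology X) A) (n : ℕ), d ≤ n →
      ∀ u : (DerivedCategory.singleFunctor _ 0).obj (locModule (Opens.grothendieckTopology X) a) ⟶
        (shiftFunctor _ (n : ℤ)).obj ((DerivedCategory.singleFunctor _ 0).obj Y), u = 0 := by
  obtain ⟨δ, d, hδ, hd⟩ := exists_codimension hX
  have : HasExt.{w} (AMod (Opens.grothendieckTopology X) A) := hasExt_of_hasDerivedCategory _
  refine ⟨d + 2, fun a Y n hn u => ?_⟩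
  have h := ext_locModule_eq_zero (fun a => mono_hbarMap_freeMod _ hA a) hδ hd Y a (n := n)
    (by lia)
  exact Ext.homEquiv.symm.injective ((h _).trans (h _).symm)

end VanishingBound

end DQ

end

theorem proposition3p11_general {X : Type} [TopologicalSpace X] [TopologicalSpace.NoetherianSpace X]
    [QuasiSober X] [T0Space X] (hX : topologicalKrullDim X < ⊤)
    (A : LocallyDiscrete (TopologicalSpace.Opens X)ᵒᵖ ⥤ᵖ Cat.{0, 0}) [DQ.LinearPrestack A]
    (hA : ∀ (U : (TopologicalSpace.Opens X)ᵒᵖ) (σ τ : A.obj ⟨U⟩) (φ : σ ⟶ τ),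
      DQ.hbar • φ = 0 → φ = 0)
    [HasDerivedCategory.{w} (DQ.AMod (Opens.grothendieckTopology X) A)]
    {𝓑 : Type 1} [Category.{0} 𝓑] [Abelian 𝓑] [HasDerivedCategory.{w} 𝓑]
    (E : DQ.GrMod (Opens.grothendieckTopology X) A ⥤ 𝓑) [E.Additive] [PreservesFiniteLimits E]
    [PreservesFiniteColimits E] [E.Faithful] :
    ∃ _ : DQ.HasLeftDerived (DQ.gr (Opens.grothendieckTopology X) A ⋙ E),
      ∀ M : DerivedCategory (DQ.AMod (Opens.grothendieckTopology X) A),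
        DQ.IsCohomologicallyComplete M →
        DQ.IsBounded ((DQ.leftDerived (DQ.gr (Opens.grothendieckTopology X) A ⋙ E)).obj M) →
        DQ.IsBounded M := by
  let P : DQ.Tot A → DQ.AMod (Opens.grothendieckTopology X) A := DQ.freeMod _
  have : AB4OfSize.{0} (DQ.AMod (Opens.grothendieckTopology X) A) := ⟨fun _ => inferInstance⟩
  have hκ := DQ.epi_coverπ_app P DQ.eq_zero_of_freeMod_comp
  have hT := DQ.mono_app_cover (DQ.hbarMap _ A) P fun a => DQ.mono_hbarMap_freeMod _ hA a
  have hE := DQ.hasLeftDerived_quotientFunctor_comp hκ hT E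
  refine ⟨hE, fun M hM hb => ?_⟩
  obtain ⟨p, q, hpq⟩ := DQ.exists_isIso_theta_homologyFunctor hκ hT E M hb
  obtain ⟨d, hd⟩ := DQ.exists_hom_locModule_eq_zero.{w} hX hA
  exact DQ.detectsInverted_locModule.bounded hM hd hpq

theorem proposition3p11 {X : Scheme.{0}} (f : X ⟶ Spec (.of ℂ))
    [Smooth f] [IsSeparated f] [QuasiCompact f]
    (A : LocallyDiscrete X.Opensᵒᵖ ⥤ᵖ Cat.{0, 0}) [DQ.LinearPrestack A]
    (hA : DQ.IsDQAlgebroid f A)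
    [HasDerivedCategory.{w} (DQ.AMod (Opens.grothendieckTopology X) A)]
    [HasDerivedCategory.{w} (DQ.GrMod (Opens.grothendieckTopology X) A)]
    [HasDerivedCategory.{w} X.Modules] :
    (∃ _ : DQ.HasLeftDerived (DQ.gr (Opens.grothendieckTopology X) A),
      ∀ M : DerivedCategory (DQ.AMod (Opens.grothendieckTopology X) A),
        DQ.IsCohomologicallyComplete M →
        DQ.IsBounded ((DQ.leftDerived (DQ.gr (Opens.grothendieckTopology X) A)).obj M) →
        DQ.IsBounded M) ∧
    ∀ (e : DQ.GrMod (Opens.grothendieckTopology X) A ≌ X.Modules) [e.functor.Additive],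
      ∃ _ : DQ.HasLeftDerived (DQ.gr (Opens.grothendieckTopology X) A ⋙ e.functor),
        ∀ M : DerivedCategory (DQ.AMod (Opens.grothendieckTopology X) A),
          DQ.IsCohomologicallyComplete M →
          DQ.IsBounded ((DQ.leftDerived
            (DQ.gr (Opens.grothendieckTopology X) A ⋙ e.functor)).obj M) →
          DQ.IsBounded M := by
  have : CompactSpace X := (quasiCompact_iff_compactSpace f).1 ‹_›
  have := DQ.noetherianSpace_of_locallyOfFiniteType f
  have hX := DQ.topologicalKrullDim_lt_top_of_locallyOfFiniteType f
  have hA' (U : X.Opensᵒᵖ) (σ τ : A.obj ⟨U⟩) (φ : σ ⟶ τ) : DQ.hbar • φ = 0 → φ = 0 :=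
    hA.eq_zero_of_hbar_smul φ
  exact ⟨proposition3p11_general hX A hA' (𝟭 _),
    fun e _ => proposition3p11_general hX A hA' e.functor⟩
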